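/- Let $\mathbb{M}_2=\mathbb{F}_2[\tau]$ with $\tau$ in bidegree $(0,1)$. Let $A$ be the motivic Steenrod algebra over an algebraically closed field of characteristic zero, i.e. the bigraded $\mathbb{M}_2$-algebra generated by $\mathrm{Sq}^n$, $n\ge 1$, where $\mathrm{Sq}^{2k}$ has bidegree $(2k,k)$ and $\mathrm{Sq}^{2k-1}$ has bidegree $(2k-1,k-1)$ (topological degree, weight), subject for $0<a<2b$ to the Adem relations $$\mathrm{Sq}^a\mathrm{Sq}^b=\sum_{c=0}^{\lfloor a/2\rfloor}\binom{b-1-c}{a-2c}\,\tau^{?}\,\mathrm{Sq}^{a+b-c}\mathrm{Sq}^c ,$$ where $\mathrm{Sq}^0=1$ and $\tau^{?}\in\{1,\tau\}$ is determined by the bidegrees. Let $A_{\mathrm{cl}}$ be the classical mod $2$ Steenrod algebra (the same relations over $\mathbb{F}_2$ with $\tau$ replaced by $1$). Let $A(2)\subset A$ and $A(2)_{\mathrm{cl}}\subset A_{\mathrm{cl}}$ be the subalgebras (over $\mathbb{M}_2$ and over $\mathbb{F}_2$) generated by $\mathrm{Sq}^1,\mathrm{Sq}^2,\mathrm{Sq}^4$,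 let $I$ and $I_{\mathrm{cl}}$ be the two-sided ideals generated by these elements, and let $$\mathrm{Gr}\,A(2)=\bigoplus_{m\ge0} I^m/I^{m+1},\qquad \mathrm{Gr}\,A(2)_{\mathrm{cl}}=\bigoplus_{m\ge0} I_{\mathrm{cl}}^m/I_{\mathrm{cl}}^{m+1}.$$ $\mathrm{Gr}\,A(2)$ is tri-graded by $(m,t,w)$: $m$ is the May filtration, i.e. the $I$-adic filtration degree, $t$ the topological degree, $w$ the weight. $\mathrm{Gr}\,A(2)_{\mathrm{cl}}$ is tri-graded by the May filtration $m$, the degree $t$, and the weight $w$ for which the classes of $\mathrm{Sq}^1,\mathrm{Sq}^2,\mathrm{Sq}^4$ in $I_{\mathrm{cl}}/I_{\mathrm{cl}}^2$, which generate the algebra, have weights $0,1,2$. The algebras $\mathrm{Gr}\,A(2)$ and $\mathrm{Gr}\,A(2)_{\mathrm{cl}}$ act on $\mathbb{M}_2$ and $\mathbb{F}_2$ through the augmentations that kill all $\mathrm{Sq}^i$ with $i>0$; here $\mathbb{F}_2$ is in degree $0$. The corresponding $\mathrm{Ext}$ rings are the cohomology rings of the cobar complexes; they are graded by $(m,s,a,w)$,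 where $a$ is the homological degree, $s$ the stem (topological degree minus $a$), $m$ the May filtration and $w$ the weight. A homomorphism that lowers internal degrees by $(m,t,w)$ has internal degree $(m,t,w)$; in particular $\tau\in\mathrm{Ext}^0$ has degree $(0,0,0,-1)$. (a) The above are tri-gradings of the algebras $\mathrm{Gr}\,A(2)$ and $\mathrm{Gr}\,A(2)_{\mathrm{cl}}$, and there is an isomorphism of $\mathbb{M}_2$-algebras $$\mathrm{Gr}\,A(2)\;\cong\;\mathrm{Gr}\,A(2)_{\mathrm{cl}}\otimes_{\mathbb{F}_2}\mathbb{F}_2[\tau]$$ that respects the tri-gradings, where $\tau$ has degree $(0,0,1)$ on the right. (b) The above are quadruple gradings of the rings $\mathrm{Ext}_{\mathrm{Gr}\,A(2)}(\mathbb{M}_2,\mathbb{M}_2)$ and $\mathrm{Ext}_{\mathrm{Gr}\,A(2)_{\mathrm{cl}}}(\mathbb{F}_2,\mathbb{F}_2)$, and there is an isomorphism of $\mathbb{M}_2$-algebras $$\mathrm{Ext}_{\mathrm{Gr}\,A(2)}(\mathbb{M}_2,\mathbb{M}_2)\;\cong\;\mathrm{Ext}_{\mathrm{Gr}\,A(2)_{\mathrm{cl}}}(\mathbb{F}_2,\mathbb{F}_2)\otimes_{\mathbb{F}_2}\mathbb{M}_2$$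 that respects the quadruple gradings, where $\tau$ has degree $(0,0,0,-1)$ on the right. -/

import Mathlib

open scoped DirectSum TensorProduct Polynomial

set_option linter.unusedSectionVars false

noncomputable section

/-! ### The associated graded algebra of an ideal -/

section AssociatedGraded

variable (k : Type) [CommRing k] {A : Type} [Ring A] [Algebra k A]
  (I : Ideal A) [I.IsTwoSided]

/-- The power `I ^ n`, as a `k`-submodule of `A` (`I ^ 0 = A`). -/
def idealPow (n : ℕ) : Submodule k A := (I ^ n).restrictScalars k

/-- The `k`-module `I ^ n / I ^ (n + 1)`. -/
def GrPiece (n : ℕ) : Type :=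
  idealPow k I n ⧸ (idealPow k I (n + 1)).submoduleOf (idealPow k I n)

instance (n : ℕ) : AddCommGroup (GrPiece k I n) :=
  inferInstanceAs (AddCommGroup (_ ⧸ (idealPow k I (n + 1)).submoduleOf (idealPow k I n)))

instance (n : ℕ) : Module k (GrPiece k I n) :=
  inferInstanceAs (Module k (_ ⧸ (idealPow k I (n + 1)).submoduleOf (idealPow k I n)))

/-- The projection `I ^ n → I ^ n / I ^ (n + 1)`. -/
def grMk (n : ℕ) : idealPow k I n →ₗ[k] GrPiece k I n :=
  ((idealPow k I (n + 1)).submoduleOf (idealPow k I n)).mkQ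

variable {I}

theorem grMk_surjective (n : ℕ) : Function.Surjective (grMk k I n) :=
  Submodule.mkQ_surjective _

theorem grMk_eq_zero {n : ℕ} (x : idealPow k I n) (hx : (x : A) ∈ I ^ (n + 1)) :
    grMk k I n x = 0 :=
  (Submodule.Quotient.mk_eq_zero _).2 hx

theorem idealPow_mul_mem {m n : ℕ} {x y : A} (hx : x ∈ I ^ m) (hy : y ∈ I ^ n) :
    x * y ∈ I ^ (m + n) := by
  rw [Ideal.IsTwoSided.pow_add]
  exact Ideal.mul_mem_mul hx hy

variable (I)

/-- Multiplication `I ^ m × I ^ n → I ^ (m + n) / I ^ (m + n + 1)`. -/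
def grMulAux (m n : ℕ) :
    idealPow k I m →ₗ[k] idealPow k I n →ₗ[k] GrPiece k I (m + n) :=
  LinearMap.mk₂ k
    (fun x y => grMk k I (m + n) ⟨(x : A) * (y : A), idealPow_mul_mem x.2 y.2⟩)
    (fun x x' y => by
      rw [← map_add]; congr 1; ext; exact add_mul _ _ _)
    (fun c x y => by
      rw [← map_smul]; congr 1; ext; exact smul_mul_assoc _ _ _)
    (fun x y y' => by
      rw [← map_add]; congr 1; ext; exact mul_add _ _ _)
    (fun c x y => by
      rw [← map_smul]; congr 1; ext; exact mul_smul_comm _ _ _)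

/-- The product `I ^ m / I ^ (m + 1) × I ^ n / I ^ (n + 1) → I ^ (m + n) / I ^ (m + n + 1)`
induced by the multiplication of `A`. -/
def grMul (m n : ℕ) : GrPiece k I m →ₗ[k] GrPiece k I n →ₗ[k] GrPiece k I (m + n) :=
  Submodule.liftQ _
    { toFun := fun x => Submodule.liftQ _ (grMulAux k I m n x) (fun y hy =>
        grMk_eq_zero k _ (idealPow_mul_mem (n := n + 1) x.2 hy))
      map_add' := fun x x' => by
        refine LinearMap.ext fun y => ?_
        obtain ⟨y, rfl⟩ := grMk_surjective k n y
        exact LinearMap.congr_fun (map_add (grMulAux k I m n) x x') y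
      map_smul' := fun c x => by
        refine LinearMap.ext fun y => ?_
        obtain ⟨y, rfl⟩ := grMk_surjective k n y
        exact LinearMap.congr_fun (map_smul (grMulAux k I m n) c x) y }
    (fun x hx => by
      refine LinearMap.ext fun y => ?_
      obtain ⟨y, rfl⟩ := grMk_surjective k n y
      refine grMk_eq_zero k _ ?_
      have h := idealPow_mul_mem (m := m + 1) hx y.2
      rwa [Nat.add_right_comm] at h)

theorem grMul_mk (m n : ℕ) (x : idealPow k I m) (y : idealPow k I n) :
    grMul k I m n (grMk k I m x) (grMk k I n y) =
      grMk k I (m + n) ⟨(x : A) * (y : A), idealPow_mul_mem x.2 y.2⟩ := rfl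

theorem one_mem_idealPow : (1 : A) ∈ idealPow k I 0 := by
  change (1 : A) ∈ I ^ 0
  rw [Submodule.pow_zero, Ideal.one_eq_top]
  trivial

theorem grMk_sigma {m n : ℕ} (h : m = n) (x : idealPow k I m) (y : idealPow k I n)
    (hxy : (x : A) = y) :
    (⟨m, grMk k I m x⟩ : GradedMonoid (GrPiece k I)) = ⟨n, grMk k I n y⟩ := by
  subst h
  obtain rfl : x = y := Subtype.ext hxy
  rfl

instance : GradedMonoid.GOne (GrPiece k I) where
  one := grMk k I 0 ⟨1, one_mem_idealPow k I⟩

instance : GradedMonoid.GMul (GrPiece k I) where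
  mul x y := grMul k I _ _ x y

instance : DirectSum.GRing (GrPiece k I) where
  mul_zero {i j} x := map_zero (grMul k I i j x)
  zero_mul {i j} y := LinearMap.map_zero₂ (grMul k I i j) y
  mul_add {i j} x y z := map_add (grMul k I i j x) y z
  add_mul {i j} x y z := LinearMap.map_add₂ (grMul k I i j) x y z
  one_mul := by
    rintro ⟨n, x⟩
    obtain ⟨x, rfl⟩ := grMk_surjective k n x
    exact grMk_sigma k I (zero_add n) _ _ (one_mul (x : A))
  mul_one := by
    rintro ⟨n, x⟩
    obtain ⟨x, rfl⟩ := grMk_surjective k n x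
    exact grMk_sigma k I (add_zero n) _ _ (mul_one (x : A))
  mul_assoc := by
    rintro ⟨l, x⟩ ⟨m, y⟩ ⟨n, z⟩
    obtain ⟨x, rfl⟩ := grMk_surjective k l x
    obtain ⟨y, rfl⟩ := grMk_surjective k m y
    obtain ⟨z, rfl⟩ := grMk_surjective k n z
    exact grMk_sigma k I (add_assoc l m n) _ _ (mul_assoc _ _ _)
  natCast n := n • grMk k I 0 ⟨1, one_mem_idealPow k I⟩
  natCast_zero := zero_smul _ _
  natCast_succ n := succ_nsmul _ _
  intCast n := n • grMk k I 0 ⟨1, one_mem_idealPow k I⟩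
  intCast_ofNat n := natCast_zsmul _ _
  intCast_negSucc_ofNat n := negSucc_zsmul _ _

instance : DirectSum.GAlgebra k (GrPiece k I) where
  toFun := ((LinearMap.toSpanSingleton k _ (grMk k I 0 ⟨1, one_mem_idealPow k I⟩)) :
    k →ₗ[k] GrPiece k I 0).toAddMonoidHom
  map_one := one_smul k (grMk k I 0 ⟨1, one_mem_idealPow k I⟩)
  map_mul r s := by
    change (⟨0, (r * s) • grMk k I 0 _⟩ : GradedMonoid (GrPiece k I)) =
      ⟨0 + 0, grMul k I 0 0 (r • grMk k I 0 _) (s • grMk k I 0 _)⟩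
    rw [← map_smul, ← map_smul, ← map_smul]
    exact grMk_sigma k I rfl _ _ (by simp [mul_comm r s, mul_smul])
  commutes := by
    rintro r ⟨n, x⟩
    obtain ⟨x, rfl⟩ := grMk_surjective k n x
    change (⟨0 + n, grMul k I 0 n (r • grMk k I 0 _) (grMk k I n x)⟩ :
      GradedMonoid (GrPiece k I)) = ⟨n + 0, grMul k I n 0 (grMk k I n x) (r • grMk k I 0 _)⟩
    rw [← map_smul]
    exact grMk_sigma k I (by omega) _ _ (by simp)
  smul_def := by
    rintro r ⟨n, x⟩
    obtain ⟨x, rfl⟩ := grMk_surjective k n x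
    change (⟨n, r • grMk k I n x⟩ : GradedMonoid (GrPiece k I)) =
      ⟨0 + n, grMul k I 0 n (r • grMk k I 0 _) (grMk k I n x)⟩
    rw [← map_smul, ← map_smul]
    exact grMk_sigma k I (by omega) _ _ (by simp)

/-- The `I`-adic associated graded algebra `A/I ⊕ I/I² ⊕ I²/I³ ⊕ ⋯`. -/
abbrev Gr : Type := ⨁ n, GrPiece k I n

/-- The class in `I ^ n / I ^ (n + 1) ⊆ Gr` of an element `x` of `I ^ n`. -/
def grClass (n : ℕ) (x : A) (hx : x ∈ I ^ n) : Gr k I :=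
  DirectSum.of (GrPiece k I) n (grMk k I n ⟨x, hx⟩)

/-- An augmentation `ε` of `A` that kills `I` gives the augmentation `Gr → A/I → k` of the
associated graded algebra; it vanishes on `I ^ n / I ^ (n + 1)` for `n > 0`. -/
def grAug (ε : A →ₐ[k] k) (hε : ∀ x ∈ I, ε x = 0) : Gr k I →ₐ[k] k :=
  DirectSum.toAlgebra k (GrPiece k I)
    (fun n => match n with
      | 0 => Submodule.liftQ _ (ε.toLinearMap ∘ₗ (idealPow k I 0).subtype) (fun x hx =>
          hε x (by simpa [Submodule.pow_one] using (show (x : A) ∈ I ^ (0 + 1) from hx)))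
      | _ + 1 => 0)
    (map_one ε)
    (by
      rintro (_ | i) (_ | j) x y
      · obtain ⟨x, rfl⟩ := grMk_surjective k _ x
        obtain ⟨y, rfl⟩ := grMk_surjective k _ y
        exact map_mul ε _ _
      all_goals simp)

end AssociatedGraded

/-! ### `Ext` over an augmented algebra in characteristic two -/

section Cobar

variable (k : Type) [CommRing k] {R : Type} [Ring R] [Algebra k R]

variable (R) in
/-- The `n`-cochains of the cobar complex: `k`-multilinear maps `Rⁿ → k`, that is, the `R`-linear
maps to `k` from the `n`-th term `R ⊗ R^{⊗ n}` of the bar resolution of `k`. -/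
def Cochain (n : ℕ) : Type := MultilinearMap k (fun _ : Fin n => R) k

instance (n : ℕ) : AddCommGroup (Cochain k R n) :=
  inferInstanceAs (AddCommGroup (MultilinearMap k (fun _ : Fin n => R) k))

instance (n : ℕ) : Module k (Cochain k R n) :=
  inferInstanceAs (Module k (MultilinearMap k (fun _ : Fin n => R) k))

instance (n : ℕ) : FunLike (Cochain k R n) (Fin n → R) k :=
  inferInstanceAs (FunLike (MultilinearMap k (fun _ : Fin n => R) k) (Fin n → R) k)

variable {k}

@[ext]
theorem Cochain.ext {n : ℕ} {f g : Cochain k R n} (h : ∀ v, f v = g v) : f = g :=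
  MultilinearMap.ext h

@[simp] theorem Cochain.add_apply {n : ℕ} (f g : Cochain k R n) (v : Fin n → R) :
    (f + g) v = f v + g v := rfl

@[simp] theorem Cochain.zero_apply {n : ℕ} (v : Fin n → R) : (0 : Cochain k R n) v = 0 := rfl

@[simp] theorem Cochain.smul_apply {n : ℕ} (c : k) (f : Cochain k R n) (v : Fin n → R) :
    (c • f) v = c * f v := rfl

/-- The product of cochains:
`(f ⌣ g) (r₁, …, r_{m+n}) = f (r₁, …, r_m) * g (r_{m+1}, …, r_{m+n})`. -/
def cup {m n : ℕ} (f : Cochain k R m) (g : Cochain k R n) : Cochain k R (m + n) :=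
  ((LinearMap.mul' k k).compMultilinearMap (MultilinearMap.domCoprod f g)).domDomCongr
    finSumFinEquiv

@[simp] theorem cup_apply {m n : ℕ} (f : Cochain k R m) (g : Cochain k R n)
    (v : Fin (m + n) → R) :
    cup f g v = f (fun i => v (Fin.castAdd n i)) * g (fun i => v (Fin.natAdd m i)) := rfl

/-- The unit cochain `1 : R⁰ → k`. -/
def unitCochain : Cochain k R 0 := MultilinearMap.constOfIsEmpty k _ 1

@[simp] theorem unitCochain_apply (v : Fin 0 → R) : (unitCochain : Cochain k R 0) v = 1 := rfl

theorem Cochain.sigma_eq {m n : ℕ} (h : n = m) (f : Cochain k R m) (g : Cochain k R n)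
    (hfg : ∀ v : Fin m → R, f v = g (fun i => v (Fin.cast h i))) :
    (⟨m, f⟩ : GradedMonoid (Cochain k R)) = ⟨n, g⟩ := by
  subst h
  obtain rfl : f = g := Cochain.ext hfg
  rfl

theorem Cochain.of_eq {m n : ℕ} (h : n = m) (f : Cochain k R m) (g : Cochain k R n)
    (hfg : ∀ v : Fin m → R, f v = g (fun i => v (Fin.cast h i))) :
    DirectSum.of (Cochain k R) m f = DirectSum.of (Cochain k R) n g := by
  subst h
  obtain rfl : f = g := Cochain.ext hfg
  rfl

instance : GradedMonoid.GOne (Cochain k R) where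
  one := unitCochain

instance : GradedMonoid.GMul (Cochain k R) where
  mul f g := cup f g

instance : DirectSum.GRing (Cochain k R) where
  mul_zero f := Cochain.ext fun v => mul_zero _
  zero_mul g := Cochain.ext fun v => zero_mul _
  mul_add f g h := Cochain.ext fun v => mul_add _ _ _
  add_mul f g h := Cochain.ext fun v => add_mul _ _ _
  one_mul := by
    rintro ⟨n, f⟩
    refine Cochain.sigma_eq (zero_add n).symm _ _ fun v => ?_
    refine (one_mul _).trans (congrArg f (funext fun i => congrArg v (Fin.ext ?_)))
    simp
  mul_one := by
    rintro ⟨n, f⟩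
    refine Cochain.sigma_eq (add_zero n).symm _ _ fun v => ?_
    exact mul_one _
  mul_assoc := by
    rintro ⟨l, f⟩ ⟨m, g⟩ ⟨n, h⟩
    refine Cochain.sigma_eq (add_assoc l m n).symm _ _ fun v => ?_
    refine (mul_assoc (f _) (g _) (h _)).trans ?_
    refine congrArg₂ _ ?_ (congrArg₂ _ ?_ ?_)
    · exact congrArg f (funext fun i => congrArg v (Fin.ext (by simp)))
    · exact congrArg g (funext fun i => congrArg v (Fin.ext (by simp)))
    · exact congrArg h (funext fun i => congrArg v (Fin.ext (add_assoc l m i)))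
  natCast n := n • unitCochain
  natCast_zero := zero_smul _ _
  natCast_succ n := succ_nsmul _ _
  intCast n := n • unitCochain
  intCast_ofNat n := natCast_zsmul _ _
  intCast_negSucc_ofNat n := negSucc_zsmul _ _

instance : DirectSum.GAlgebra k (Cochain k R) where
  toFun := ((LinearMap.toSpanSingleton k _ unitCochain) : k →ₗ[k] Cochain k R 0).toAddMonoidHom
  map_one := one_smul k (unitCochain : Cochain k R 0)
  map_mul r s := by
    refine Cochain.sigma_eq rfl _ _ fun v => ?_
    change (r * s) * 1 = (r * 1) * (s * 1)
    ring
  commutes := by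
    rintro r ⟨n, f⟩
    refine Cochain.sigma_eq ((add_zero n).trans (zero_add n).symm) _ _ fun v => ?_
    change (r * 1) * f _ = f _ * (r * 1)
    rw [mul_comm]
    congr 2
    exact funext fun i => congrArg v (Fin.ext (zero_add (i : ℕ)))
  smul_def := by
    rintro r ⟨n, f⟩
    refine Cochain.sigma_eq (zero_add n) _ _ fun v => ?_
    change r * f _ = (r * 1) * f _
    rw [mul_one]
    congr 2
    exact funext fun i => congrArg v (Fin.ext (zero_add (i : ℕ)).symm)

variable (k R) in
/-- The algebra of all cochains. -/
abbrev CochainAlg : Type := ⨁ n, Cochain k R n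

theorem contractNth_update {n : ℕ} (i : Fin n) (v : Fin (n + 1) → R) (j : Fin (n + 1)) :
    ∃ (p : Fin n) (L : R →ₗ[k] R), ∀ x,
      i.castSucc.contractNth (· * ·) (Function.update v j x) =
        Function.update (i.castSucc.contractNth (· * ·) v) p (L x) := by
  rcases lt_trichotomy j i.castSucc with h | h | h
  · have hj : (j : ℕ) < i := h
    refine ⟨⟨j, by omega⟩, LinearMap.id, fun x => funext fun a => ?_⟩
    simp only [Fin.contractNth, Function.update_apply, Fin.ext_iff, LinearMap.id_apply,
      Fin.val_castSucc, Fin.val_succ]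
    split_ifs <;> first | rfl | omega
  · have hj : (j : ℕ) = i := congrArg Fin.val h
    refine ⟨i, LinearMap.mulRight k (v i.succ), fun x => funext fun a => ?_⟩
    simp only [Fin.contractNth, Function.update_apply, Fin.ext_iff, LinearMap.mulRight_apply,
      Fin.val_castSucc, Fin.val_succ]
    split_ifs <;> first | rfl | omega | (obtain rfl : a = i := Fin.ext (by omega)); rfl
  · have hj : (i : ℕ) < j := h
    by_cases hj' : (j : ℕ) = i + 1
    · refine ⟨i, LinearMap.mulLeft k (v i.castSucc), fun x => funext fun a => ?_⟩
      simp only [Fin.contractNth, Function.update_apply, Fin.ext_iff, LinearMap.mulLeft_apply,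
        Fin.val_castSucc, Fin.val_succ]
      split_ifs <;> first | rfl | omega | (obtain rfl : a = i := Fin.ext (by omega)); rfl
    · refine ⟨⟨j - 1, by omega⟩, LinearMap.id, fun x => funext fun a => ?_⟩
      simp only [Fin.contractNth, Function.update_apply, Fin.ext_iff, LinearMap.id_apply,
        Fin.val_castSucc, Fin.val_succ]
      split_ifs <;> first | rfl | omega

/-- The inner face `(r₀, …, r_n) ↦ f (r₀, …, r_i r_{i+1}, …, r_n)`. -/
def innerFace {n : ℕ} (i : Fin n) (f : Cochain k R n) : Cochain k R (n + 1) :=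
  MultilinearMap.mk' (fun v => f (i.castSucc.contractNth (· * ·) v))
    (fun v j x y => by
      obtain ⟨p, L, h⟩ := contractNth_update (k := k) i v j
      simp only [h, map_add]
      exact MultilinearMap.map_update_add f _ _ _ _)
    (fun v j c x => by
      obtain ⟨p, L, h⟩ := contractNth_update (k := k) i v j
      simp only [h, map_smul]
      exact MultilinearMap.map_update_smul f _ _ _ _)

/-- The outer face `(r₀, …, r_n) ↦ ε (r₀) * f (r₁, …, r_n)`. -/
def firstFace (ε : R →ₐ[k] k) {n : ℕ} (f : Cochain k R n) : Cochain k R (n + 1) :=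
  ((ε.toLinearMap : R →ₗ[k] k).smulRight (show MultilinearMap k (fun _ : Fin n => R) k from f)).uncurryLeft

/-- The outer face `(r₀, …, r_n) ↦ f (r₀, …, r_{n-1}) * ε (r_n)`. -/
def lastFace (ε : R →ₐ[k] k) {n : ℕ} (f : Cochain k R n) : Cochain k R (n + 1) :=
  ((LinearMap.toSpanSingleton k (R →ₗ[k] k) ε.toLinearMap).compMultilinearMap
    (show MultilinearMap k (fun _ : Fin n => R) k from f)).uncurryRight

theorem innerFace_apply {n : ℕ} (i : Fin n) (f : Cochain k R n) (v : Fin (n + 1) → R) :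
    innerFace i f v = f (i.castSucc.contractNth (· * ·) v) := rfl

theorem firstFace_apply (ε : R →ₐ[k] k) {n : ℕ} (f : Cochain k R n) (v : Fin (n + 1) → R) :
    firstFace ε f v = ε (v 0) * f (fun i => v i.succ) := rfl

theorem lastFace_apply (ε : R →ₐ[k] k) {n : ℕ} (f : Cochain k R n) (v : Fin (n + 1) → R) :
    lastFace ε f v = f (fun i => v i.castSucc) * ε (v (Fin.last n)) := rfl

/-- The differential of the cobar complex (no signs: it is used in characteristic two only),
`(δ f) (r₀, …, r_n) = ε (r₀) f (r₁, …, r_n) + ∑ i, f (r₀, …, r_i r_{i+1}, …, r_n)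
  + f (r₀, …, r_{n-1}) ε (r_n)`. -/
def cobarδ (ε : R →ₐ[k] k) (n : ℕ) : Cochain k R n →ₗ[k] Cochain k R (n + 1) where
  toFun f := firstFace ε f + ∑ i, innerFace i f + lastFace ε f
  map_add' f g := by
    have h1 : firstFace ε (f + g) = firstFace ε f + firstFace ε g :=
      Cochain.ext fun v => by simp [firstFace_apply, mul_add]
    have h2 : ∀ i, innerFace i (f + g) = innerFace i f + innerFace i g := fun i =>
      Cochain.ext fun v => by simp [innerFace_apply]
    have h3 : lastFace ε (f + g) = lastFace ε f + lastFace ε g :=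
      Cochain.ext fun v => by simp [lastFace_apply, add_mul]
    simp only [h1, h2, h3, Finset.sum_add_distrib]
    abel
  map_smul' c f := by
    have h1 : firstFace ε (c • f) = c • firstFace ε f :=
      Cochain.ext fun v => by simp [firstFace_apply, mul_left_comm]
    have h2 : ∀ i, innerFace i (c • f) = c • innerFace i f := fun i =>
      Cochain.ext fun v => by simp [innerFace_apply]
    have h3 : lastFace ε (c • f) = c • lastFace ε f :=
      Cochain.ext fun v => by simp [lastFace_apply, mul_assoc]
    simp only [h1, h2, h3, ← Finset.smul_sum, ← smul_add, RingHom.id_apply]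

theorem Cochain.sum_apply {n : ℕ} {ι : Type} (s : Finset ι) (f : ι → Cochain k R n)
    (v : Fin n → R) : (∑ i ∈ s, f i) v = ∑ i ∈ s, f i v :=
  map_sum ({ toFun := fun g => g v, map_zero' := rfl, map_add' := fun _ _ => rfl } :
    Cochain k R n →+ k) f s

theorem cobarδ_apply (ε : R →ₐ[k] k) {n : ℕ} (f : Cochain k R n) (v : Fin (n + 1) → R) :
    cobarδ ε n f v = ε (v 0) * f (fun i => v i.succ) +
      ∑ i : Fin n, f (i.castSucc.contractNth (· * ·) v) +
      f (fun i => v i.castSucc) * ε (v (Fin.last n)) := by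
  change (firstFace ε f + ∑ i, innerFace i f + lastFace ε f) v = _
  simp only [Cochain.add_apply, Cochain.sum_apply, firstFace_apply, innerFace_apply,
    lastFace_apply]

/-- The differential on the algebra of all cochains. -/
def cobarD (ε : R →ₐ[k] k) : CochainAlg k R →ₗ[k] CochainAlg k R :=
  DirectSum.toModule k ℕ _ fun n => DirectSum.lof k ℕ (Cochain k R) (n + 1) ∘ₗ cobarδ ε n

theorem cobarD_of (ε : R →ₐ[k] k) {n : ℕ} (f : Cochain k R n) :
    cobarD ε (DirectSum.of _ n f) = DirectSum.of _ (n + 1) (cobarδ ε n f) :=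
  DirectSum.toModule_lof k n f

theorem cobarD_of_mul_of [CharP k 2] (ε : R →ₐ[k] k) {m n : ℕ} (f : Cochain k R m)
    (g : Cochain k R n) :
    cobarD ε (DirectSum.of _ m f * DirectSum.of _ n g) =
      cobarD ε (DirectSum.of _ m f) * DirectSum.of _ n g +
        DirectSum.of _ m f * cobarD ε (DirectSum.of _ n g) := by
  have key : cobarδ ε (m + n) (cup f g) = (show Cochain k R (m + n + 1) from
      MultilinearMap.domDomCongr (finCongr (by omega)) (cup (cobarδ ε m f) g)) +
      cup f (cobarδ ε n g) := by
    refine Cochain.ext fun v => ?_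
    have e : ∀ w : Fin (m + n + 1) → R, (show Cochain k R (m + n + 1) from
      MultilinearMap.domDomCongr (finCongr (by omega : m + 1 + n = m + n + 1))
        (cup (cobarδ ε m f) g)) w = cup (cobarδ ε m f) g
          (fun i => w (Fin.cast (by omega) i)) := fun w => rfl
    rw [Cochain.add_apply, e, cup_apply, cup_apply, cobarδ_apply, cobarδ_apply, cobarδ_apply,
      Fin.sum_univ_add]
    have h1 : ∀ i : Fin m, (fun a : Fin m => (Fin.castAdd n i).castSucc.contractNth (· * ·) v
        (Fin.castAdd n a)) = i.castSucc.contractNth (· * ·)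
          (fun b : Fin (m + 1) => v (Fin.cast (by omega) (Fin.castAdd n b))) := fun i =>
      funext fun a => by simp only [Fin.contractNth]; split_ifs <;> first | rfl | grind
    have h2 : ∀ i : Fin m, (fun a : Fin n => (Fin.castAdd n i).castSucc.contractNth (· * ·) v
        (Fin.natAdd m a)) = fun a => v (Fin.cast (by omega) (Fin.natAdd (m + 1) a)) := fun i =>
      funext fun a => by
        rw [Fin.contractNth_apply_of_gt _ _ _ _ (by simp; omega)]
        exact congrArg v (Fin.ext (by simp; omega))
    have h3 : ∀ j : Fin n, (fun a : Fin m => (Fin.natAdd m j).castSucc.contractNth (· * ·) v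
        (Fin.castAdd n a)) = fun a => v (Fin.castAdd (n + 1) a) := fun j =>
      funext fun a => by
        rw [Fin.contractNth_apply_of_lt _ _ _ _ (by simp; omega)]
        rfl
    have h4 : ∀ j : Fin n, (fun a : Fin n => (Fin.natAdd m j).castSucc.contractNth (· * ·) v
        (Fin.natAdd m a)) = j.castSucc.contractNth (· * ·)
          (fun b : Fin (n + 1) => v (Fin.natAdd m b)) := fun j =>
      funext fun a => by
        simp only [Fin.contractNth, Fin.val_castSucc, Fin.val_natAdd, add_lt_add_iff_left,
          add_right_inj]
        rfl
    have e1 : (fun a : Fin n => v (Fin.succ (Fin.natAdd m a))) =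
        fun a => v (Fin.cast (by omega) (Fin.natAdd (m + 1) a)) :=
      funext fun a => congrArg v (Fin.ext (by simp; omega))
    have e2 : (fun a : Fin n => v (Fin.natAdd m a.succ)) =
        fun a => v (Fin.cast (by omega) (Fin.natAdd (m + 1) a)) :=
      funext fun a => congrArg v (Fin.ext (by simp; omega))
    have e3 : (v (Fin.cast (by omega) (Fin.castAdd n (Fin.last m)))) =
        v (Fin.natAdd m (0 : Fin (n + 1))) := congrArg v (Fin.ext (by simp))
    have e4 : (v (Fin.cast (by omega) (Fin.castAdd n (0 : Fin (m + 1))))) = v 0 :=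
      congrArg v (Fin.ext (by simp))
    have e5 : (fun a : Fin m => v (Fin.cast (by omega) (Fin.castAdd n a.castSucc))) =
        fun a => v (Fin.castAdd (n + 1) a) := rfl
    have e6 : (fun a : Fin m => v (Fin.cast (by omega) (Fin.castAdd n a.succ))) =
        fun a => v (Fin.succ (Fin.castAdd n a)) := rfl
    have e7 : (fun a : Fin m => v (Fin.castAdd n a).castSucc) =
        fun a => v (Fin.castAdd (n + 1) a) := rfl
    have e8 : (fun a : Fin n => v (Fin.natAdd m a).castSucc) =
        fun a => v (Fin.natAdd m a.castSucc) := rfl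
    have e9 : v (Fin.natAdd m (Fin.last n)) = v (Fin.last (m + n)) := rfl
    simp only [cup_apply, h1, h2, h3, h4, e1, e2, e3, e4, e5, e6, e7, e8, e9]
    rw [← Finset.sum_mul, ← Finset.mul_sum]
    linear_combination (-1 : k) * CharTwo.add_self_eq_zero
      ((f fun a => v (Fin.castAdd (n + 1) a)) * ε (v (Fin.natAdd m (0 : Fin (n + 1)))) *
        g fun a => v (Fin.cast (by omega) (Fin.natAdd (m + 1) a)))
  simp only [cobarD_of, DirectSum.of_mul_of]
  rw [show GradedMonoid.GMul.mul f g = cup f g from rfl, key, map_add]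
  congr 1
  exact Cochain.of_eq (by omega) _ _ fun v => rfl

theorem cobarD_mul [CharP k 2] (ε : R →ₐ[k] k) (x y : CochainAlg k R) :
    cobarD ε (x * y) = cobarD ε x * y + x * cobarD ε y := by
  induction x using DirectSum.induction_on with
  | zero => simp
  | add x x' hx hx' => simp only [add_mul, map_add, hx, hx']; abel
  | of m f =>
    induction y using DirectSum.induction_on with
    | zero => simp
    | add y y' hy hy' => simp only [mul_add, map_add, hy, hy']; abel
    | of n g => exact cobarD_of_mul_of ε f g

theorem cobarD_one [CharP k 2] (ε : R →ₐ[k] k) : cobarD ε (1 : CochainAlg k R) = 0 := by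
  have h := cobarD_mul ε (1 : CochainAlg k R) 1
  simpa using h

variable (ε : R →ₐ[k] k) [CharP k 2]

/-- The algebra of cocycles. -/
def cocycles : Subalgebra k (CochainAlg k R) where
  carrier := {z | cobarD ε z = 0}
  mul_mem' {x y} hx hy := by
    simp only [Set.mem_ofPred_eq] at hx hy ⊢
    rw [cobarD_mul, hx, hy, zero_mul, mul_zero, add_zero]
  add_mem' {x y} hx hy := by
    simp only [Set.mem_ofPred_eq] at hx hy ⊢
    rw [map_add, hx, hy, add_zero]
  algebraMap_mem' r := by
    simp only [Set.mem_ofPred_eq]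
    rw [Algebra.algebraMap_eq_smul_one, map_smul, cobarD_one, smul_zero]

/-- The two-sided ideal of coboundaries in the algebra of cocycles. -/
def coboundaries : Ideal (cocycles ε) where
  carrier := {z | ∃ c, cobarD ε c = z}
  add_mem' := by
    rintro x y ⟨c, hc⟩ ⟨c', hc'⟩
    exact ⟨c + c', by rw [map_add, hc, hc']; rfl⟩
  zero_mem' := ⟨0, map_zero _⟩
  smul_mem' := by
    rintro z x ⟨c, hc⟩
    refine ⟨z * c, ?_⟩
    rw [cobarD_mul, hc, show cobarD ε (z : CochainAlg k R) = 0 from z.2, zero_mul, zero_add]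
    rfl

instance : (coboundaries ε).IsTwoSided where
  mul_mem_of_left := by
    rintro x z ⟨c, hc⟩
    refine ⟨c * z, ?_⟩
    rw [cobarD_mul, hc, show cobarD ε (z : CochainAlg k R) = 0 from z.2, mul_zero, add_zero]
    rfl

/-- The algebra `Ext_R(k, k)` of an augmented `k`-algebra `R` that is free as a `k`-module, in
characteristic two: cocycles modulo coboundaries in the cobar complex `Hom_R(B(R), k)`, where
`B(R)` is the bar resolution of the `R`-module `k`, with the product induced by that of
cochains. -/
def ExtAlg : Type := cocycles ε ⧸ coboundaries ε

instance : Ring (ExtAlg ε) := inferInstanceAs (Ring (cocycles ε ⧸ coboundaries ε))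

instance : Algebra k (ExtAlg ε) := inferInstanceAs (Algebra k (cocycles ε ⧸ coboundaries ε))

/-- The class of a cocycle. -/
def extMk : cocycles ε →ₐ[k] ExtAlg ε := Ideal.Quotient.mkₐ k (coboundaries ε)

/-- A cochain `f` is homogeneous of internal degree `e`, for gradings `𝒢` of `R` and `𝒦` of `k`,
if it lowers degrees by `e`. -/
def Cochain.IsHomogeneous (𝒢 : ℤ × ℤ × ℤ → AddSubgroup R) (𝒦 : ℤ × ℤ × ℤ → AddSubgroup k)
    {n : ℕ} (f : Cochain k R n) (e : ℤ × ℤ × ℤ) : Prop :=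
  ∀ (d : Fin n → ℤ × ℤ × ℤ) (v : Fin n → R), (∀ i, v i ∈ 𝒢 (d i)) → f v ∈ 𝒦 (∑ i, d i - e)

/-- The part of `Ext_R(k, k)` of degree `(m, s, a, w)`: the classes of the cocycles of homological
degree `a` and of internal degree `(m, s + a, w)`. -/
def extGrading (𝒢 : ℤ × ℤ × ℤ → AddSubgroup R) (𝒦 : ℤ × ℤ × ℤ → AddSubgroup k) :
    ℤ × ℤ × ℕ × ℤ → AddSubgroup (ExtAlg ε) :=
  fun (m, s, a, w) => AddSubgroup.closure
    {q | ∃ (f : Cochain k R a) (hf : DirectSum.of _ a f ∈ cocycles ε),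
      f.IsHomogeneous 𝒢 𝒦 (m, s + a, w) ∧ q = extMk ε ⟨_, hf⟩}

end Cobar

/-! ### The motivic and the classical Steenrod algebra at the prime two -/

section Steenrod

/-- The weight of `Sq^n`: `Sq^{2k}` has weight `k` and `Sq^{2k-1}` has weight `k - 1`. -/
def sqWeight (n : ℕ) : ℕ := n / 2

/-- The exponent of `τ` in front of `Sq^{a+b-c} Sq^c` in the Adem relation for `Sq^a Sq^b`: it is
determined by the weights (see `tauExp_spec` and `tauExp_le_one`). -/
def tauExp (a b c : ℕ) : ℕ :=
  sqWeight a + sqWeight b - (sqWeight (a + b - c) + sqWeight c)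

theorem tauExp_le_one (a b c : ℕ) (_hc : c ≤ a / 2) : tauExp a b c ≤ 1 := by
  unfold tauExp sqWeight
  omega

/-- Every term of the Adem relation with a nonzero coefficient has the weight of `Sq^a Sq^b`. -/
theorem tauExp_spec (a b c : ℕ) (hab : a < 2 * b) (_hc : c ≤ a / 2)
    (h : (((b - 1 - c).choose (a - 2 * c) : ℕ) : ZMod 2) ≠ 0) :
    tauExp a b c + (sqWeight (a + b - c) + sqWeight c) = sqWeight a + sqWeight b := by
  by_cases hp : a % 2 = 1 ∧ b % 2 = 1 ∧ c % 2 = 0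
  · exfalso
    apply h
    rw [ZMod.natCast_eq_zero_iff]
    have h2 : Nat.Prime 2 := Nat.prime_two
    have := Fact.mk h2
    have hl := Choose.choose_modEq_choose_mod_mul_choose_div_nat (n := b - 1 - c)
      (k := a - 2 * c) (p := 2)
    rw [show (b - 1 - c) % 2 = 0 by omega, show (a - 2 * c) % 2 = 1 by omega] at hl
    exact (Nat.modEq_zero_iff_dvd).1 (by simpa using hl)
  · unfold tauExp sqWeight
    omega

variable (k : Type) [CommRing k] (τ : k)

/-- The relations of the Steenrod algebra over `k` with parameter `τ`: `Sq^0 = 1` and the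
Adem relations. -/
inductive SteenrodRel : FreeAlgebra k ℕ → FreeAlgebra k ℕ → Prop
  | zero : SteenrodRel (FreeAlgebra.ι k 0) 1
  | adem (a b : ℕ) (ha : 0 < a) (hab : a < 2 * b) :
      SteenrodRel (FreeAlgebra.ι k a * FreeAlgebra.ι k b)
        (∑ c ∈ Finset.range (a / 2 + 1),
          (((b - 1 - c).choose (a - 2 * c) : k) * τ ^ tauExp a b c) •
            (FreeAlgebra.ι k (a + b - c) * FreeAlgebra.ι k c))

/-- The `k`-algebra generated by `Sq^n`, `n ≥ 1`, subject to the Adem relations. The motivic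
Steenrod algebra is the case `k = 𝔽₂[τ]`; the classical one is the case `k = 𝔽₂`, `τ = 1`. -/
def SteenrodAlg : Type := RingQuot (SteenrodRel k τ)

instance : Ring (SteenrodAlg k τ) := inferInstanceAs (Ring (RingQuot (SteenrodRel k τ)))

instance : Algebra k (SteenrodAlg k τ) := inferInstanceAs (Algebra k (RingQuot (SteenrodRel k τ)))

/-- The Steenrod square `Sq^n`; `Sq^0 = 1`. -/
def Sq (n : ℕ) : SteenrodAlg k τ := RingQuot.mkAlgHom k (SteenrodRel k τ) (FreeAlgebra.ι k n)

/-- The augmentation: `Sq^n` acts trivially on `k` for `n > 0`, and `Sq^0` as the identity. -/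
def steenrodAug : SteenrodAlg k τ →ₐ[k] k :=
  RingQuot.liftAlgHom k (s := SteenrodRel k τ) ⟨FreeAlgebra.lift k fun n => if n = 0 then 1 else 0, by
    rintro _ _ (_ | ⟨a, b, ha, hab⟩)
    · simp
    · rw [map_mul, FreeAlgebra.lift_ι_apply, FreeAlgebra.lift_ι_apply, if_neg ha.ne', zero_mul,
        map_sum]
      refine (Finset.sum_eq_zero fun c hc => ?_).symm
      have := Finset.mem_range.1 hc
      rw [map_smul, map_mul, FreeAlgebra.lift_ι_apply, if_neg (by omega), zero_mul, smul_zero]⟩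

theorem steenrodAug_Sq (n : ℕ) : steenrodAug k τ (Sq k τ n) = if n = 0 then 1 else 0 :=
  (RingQuot.liftAlgHom_mkAlgHom_apply k _ _ _).trans (FreeAlgebra.lift_ι_apply _ _)

/-- The subalgebra `A(2)` generated by `Sq^1`, `Sq^2`, `Sq^4`. -/
def A2sub : Subalgebra k (SteenrodAlg k τ) := Algebra.adjoin k {Sq k τ 1, Sq k τ 2, Sq k τ 4}

/-- The algebra `A(2)`. -/
def A2 : Type := A2sub k τ

instance : Ring (A2 k τ) := inferInstanceAs (Ring (A2sub k τ))

instance : Algebra k (A2 k τ) := inferInstanceAs (Algebra k (A2sub k τ))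

/-- The inclusion of `A(2)` into the Steenrod algebra. -/
def A2val : A2 k τ →ₐ[k] SteenrodAlg k τ := (A2sub k τ).val

/-- The generators `Sq^1`, `Sq^2`, `Sq^4` of `A(2)`, as `i = 0, 1, 2`. -/
def A2gen (i : Fin 3) : A2 k τ := ⟨Sq k τ (2 ^ (i : ℕ)), Algebra.subset_adjoin (by
  fin_cases i <;> simp)⟩

/-- The two-sided ideal `I` of `A(2)` generated by `Sq^1`, `Sq^2`, `Sq^4`. -/
def A2ideal : Ideal (A2 k τ) := (TwoSidedIdeal.span (Set.range (A2gen k τ))).asIdeal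

instance : (A2ideal k τ).IsTwoSided :=
  inferInstanceAs (TwoSidedIdeal.span (Set.range (A2gen k τ))).asIdeal.IsTwoSided

theorem A2gen_mem (i : Fin 3) : A2gen k τ i ∈ A2ideal k τ :=
  TwoSidedIdeal.subset_span ⟨i, rfl⟩

/-- The augmentation of `A(2)`. -/
def A2aug : A2 k τ →ₐ[k] k := (steenrodAug k τ).comp (A2val k τ)

theorem A2aug_ideal (x : A2 k τ) (hx : x ∈ A2ideal k τ) : A2aug k τ x = 0 := by
  have h := TwoSidedIdeal.mem_span_iff.1 (show x ∈ TwoSidedIdeal.span _ from hx)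
    (TwoSidedIdeal.ker (A2aug k τ)) (by
      rintro _ ⟨i, rfl⟩
      refine (TwoSidedIdeal.mem_ker _).2 ((steenrodAug_Sq k τ _).trans (if_neg ?_))
      positivity)
  exact (TwoSidedIdeal.mem_ker _).1 h

/-- The `I`-adic associated graded algebra `Gr A(2)`. -/
abbrev GrA2 : Type := Gr k (A2ideal k τ)

/-- The augmentation of `Gr A(2)`, through which it acts on `k`. -/
def GrA2aug : GrA2 k τ →ₐ[k] k := grAug k (A2ideal k τ) (A2aug k τ) (A2aug_ideal k τ)

/-- The algebra `Ext_{Gr A(2)}(k, k)`. -/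
abbrev ExtGrA2 [CharP k 2] : Type := ExtAlg (GrA2aug k τ)

end Steenrod

/-! ### Gradings -/

section Gradings

/-- The ring `𝕄₂ = 𝔽₂[τ]`. -/
abbrev M2 : Type := (ZMod 2)[X]

/-- The element `τ` of `𝕄₂`. -/
abbrev tau : M2 := Polynomial.X

/-- The grading of `𝔽₂[τ]` in which `τ` has degree `u` (of infinite order). -/
def M2Grading {ι : Type} [AddCommMonoid ι] (u : ι) : ι → AddSubgroup M2 :=
  fun d => AddSubgroup.closure {x | ∃ j : ℕ, d = j • u ∧ x = tau ^ j}

/-- The grading of `𝔽₂` concentrated in degree `0`. -/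
def F2Grading : ℤ × ℤ × ℤ → AddSubgroup (ZMod 2) :=
  fun d => AddSubgroup.closure {x | d = 0 ∧ x = 1}

/-- The tensor product over `𝔽₂` of two gradings. -/
def tensorGrading {ι B C : Type} [Add ι] [Ring B] [Algebra (ZMod 2) B] [Ring C]
    [Algebra (ZMod 2) C] (ℬ : ι → AddSubgroup B) (𝒞 : ι → AddSubgroup C) :
    ι → AddSubgroup (B ⊗[ZMod 2] C) :=
  fun d => AddSubgroup.closure
    {z | ∃ p q, p + q = d ∧ ∃ x ∈ ℬ p, ∃ y ∈ 𝒞 q, z = x ⊗ₜ[ZMod 2] y}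

/-- The part of the motivic Steenrod algebra of topological degree `t` and weight `w`: here
`Sq^n` has bidegree `(n, sqWeight n)` and `τ` has bidegree `(0, 1)`. -/
def motivicPart (t w : ℤ) : AddSubgroup (SteenrodAlg M2 tau) :=
  AddSubgroup.closure {x | ∃ (j : ℕ) (l : List ℕ), ((l.sum : ℕ) : ℤ) = t ∧
    ((j + (l.map sqWeight).sum : ℕ) : ℤ) = w ∧ x = tau ^ j • (l.map (Sq M2 tau)).prod}

/-- The part of the classical Steenrod algebra of degree `t`. -/
def classicalPart (t : ℤ) : AddSubgroup (SteenrodAlg (ZMod 2) 1) :=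
  AddSubgroup.closure {x | ∃ l : List ℕ, ((l.sum : ℕ) : ℤ) = t ∧
    x = (l.map (Sq (ZMod 2) 1)).prod}

/-- The trigrading `(m, t, w)` of motivic `Gr A(2)`: May filtration, topological degree, weight. -/
def motivicGrading : ℤ × ℤ × ℤ → AddSubgroup (GrA2 M2 tau) :=
  fun (m, t, w) => AddSubgroup.closure
    {y | ∃ (n : ℕ) (x : A2 M2 tau) (hx : x ∈ A2ideal M2 tau ^ n),
      (n : ℤ) = m ∧ A2val M2 tau x ∈ motivicPart t w ∧ y = grClass M2 _ n x hx}

/-- The bigrading `(m, t)` of classical `Gr A(2)`: May filtration and degree. -/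
def classicalBigrading (m t : ℤ) : AddSubgroup (GrA2 (ZMod 2) 1) :=
  AddSubgroup.closure
    {y | ∃ (n : ℕ) (x : A2 (ZMod 2) 1) (hx : x ∈ A2ideal (ZMod 2) 1 ^ n),
      (n : ℤ) = m ∧ A2val (ZMod 2) 1 x ∈ classicalPart t ∧
        y = grClass (ZMod 2) _ n x hx}

/-- The class of `Sq^1`, `Sq^2`, `Sq^4` (as `i = 0, 1, 2`) in `I/I² ⊆ Gr A(2)`, classically. -/
def classicalGen (i : Fin 3) : GrA2 (ZMod 2) 1 :=
  grClass (ZMod 2) (A2ideal (ZMod 2) 1) 1 (A2gen (ZMod 2) 1 i)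
    (by rw [Submodule.pow_one]; exact A2gen_mem _ _ i)

/-- The part of weight `w` of classical `Gr A(2)`: the span of the products of the classes of
`Sq^1`, `Sq^2`, `Sq^4` whose weights `0`, `1`, `2` add up to `w`. -/
def classicalWeight (w : ℤ) : AddSubgroup (GrA2 (ZMod 2) 1) :=
  AddSubgroup.closure {y | ∃ l : List (Fin 3),
    (((l.map fun i => sqWeight (2 ^ (i : ℕ))).sum : ℕ) : ℤ) = w ∧
      y = (l.map classicalGen).prod}

/-- The trigrading `(m, t, w)` of classical `Gr A(2)`. -/
def classicalGrading : ℤ × ℤ × ℤ → AddSubgroup (GrA2 (ZMod 2) 1) :=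
  fun (m, t, w) => classicalBigrading m t ⊓ classicalWeight w

/-- The grading `(m, s, a, w)` of motivic `Ext_{Gr A(2)}(𝕄₂, 𝕄₂)`: May filtration, stem,
homological degree, weight. -/
def motivicExtGrading : ℤ × ℤ × ℕ × ℤ → AddSubgroup (ExtGrA2 M2 tau) :=
  extGrading (GrA2aug M2 tau) motivicGrading (M2Grading (0, 0, 1))

/-- The grading `(m, s, a, w)` of classical `Ext_{Gr A(2)}(𝔽₂, 𝔽₂)`. -/
def classicalExtGrading : ℤ × ℤ × ℕ × ℤ → AddSubgroup (ExtGrA2 (ZMod 2) 1) :=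
  extGrading (GrA2aug (ZMod 2) 1) classicalGrading F2Grading

end Gradings

end

/-!
The proof determines both associated graded algebras completely. Let `g 0`, `g 1`, `g 2` be the
classes of `Sq^1`, `Sq^2`, `Sq^4`. Motivically as well as classically they satisfy the relations of
the restricted enveloping algebra of the strictly upper triangular `4 × 4` matrices over `𝔽₂`
(`mayRelations_gr`): the additional terms of the Adem relations, in particular all those with a
factor `τ`, have higher filtration. These relations determine the product of each of the 64
Poincaré–Birkhoff–Witt monomials with a generator (`mayMono_mul`), so that the monomials span
(`span_mayMono_gr`). They form a basis (`grBasis`), for the following reasons.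

* Every monomial has a multiple equal to the top monomial, and it can be chosen to kill all later
  monomials; hence independence reduces to the nonvanishing of the multiples of the top monomial
  (`linearIndependent_mayMono`). This can be tested in `A(2)`, because the augmentation ideal has
  vanishing eleventh power (`A2_pow_eleven`).
* Classically, the top monomial acts nontrivially on the polynomial ring `𝔽₂[ξ₁, ξ₂, ξ₃]`
  (`xiAction_mayTop`), a quotient of which is the dual of `A(2)`. The action exists because the
  total square satisfies the Bullett–Macdonald identity, which is equivalent to the Adem relations
  (`adem_of_bullett_macdonald`).
* Motivically, `Sq^n ↦ τ ^ w ⊗ Sq^n`, with `w` the weight of `Sq^n`, defines a homomorphism to the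
  classical algebra with scalars extended to `𝕄₂`, which maps the top monomial to a nonzero multiple
  of the classical one (`motivic_mayTop`).

Two algebras with the same basis and the same multiplication table agree, which gives the
isomorphism `grEquiv`. The degrees are read off from the basis: a grading of the Steenrod algebra
is a coaction of the monoid ring of degrees, by which the class of a homogeneous element of
`I ^ m` is a combination of monomials of the same degree (`grClass_mem_closure`).

For `Ext`, a cochain is given by its values on tuples of basis elements. A cochain over `𝕄₂` is
therefore a polynomial in `τ` with classical cochains as coefficients, and the differential is
linear over `𝔽₂[τ]`; as `𝔽₂[τ]` is free over `𝔽₂`, cohomology commutes with this extension of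
scalars (`exists_extEquiv`). The projections of cochains to an internal degree commute with the
differential (`cobarδ_homPart`) and split `Ext` into its homogeneous parts
(`nonempty_gradedRing_ext`).
-/

noncomputable section

/-! ### The restricted enveloping algebra of strictly upper triangular matrices -/

section MayAlgebra

/-- The commutator of `x` and `y` in characteristic two. -/
def comm₂ {R : Type} [Ring R] (x y : R) : R := x * y + y * x

/-- The relations, in characteristic two, of the restricted enveloping algebra of the strictly
upper triangular `4 × 4` matrices with zero restriction, in terms of the generators `g 0`, `g 1`,
`g 2`, which stand for the elementary matrices next to the diagonal. -/
structure MayRelations {R : Type} [Ring R] (g : Fin 3 → R) : Prop where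
  add_self : ∀ x : R, x + x = 0
  sq0 : g 0 * g 0 = 0
  sq1 : g 1 * g 1 = 0
  sq2 : g 2 * g 2 = 0
  comm02 : g 0 * g 2 = g 2 * g 0
  sq01 : comm₂ (g 0) (g 1) * comm₂ (g 0) (g 1) = 0
  sq12 : comm₂ (g 1) (g 2) * comm₂ (g 1) (g 2) = 0
  sq012 : comm₂ (comm₂ (g 0) (g 1)) (g 2) * comm₂ (comm₂ (g 0) (g 1)) (g 2) = 0
  comm1 : comm₂ (comm₂ (g 0) (g 1)) (g 2) * g 1 = g 1 * comm₂ (comm₂ (g 0) (g 1)) (g 2)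

/-- Indices `(α, δ, β, φ, ε, γ)` of the Poincaré–Birkhoff–Witt monomials
`c ^ γ * e ^ ε * b ^ β * f ^ φ * d ^ δ * a ^ α`, where `a, b, c` are the generators and
`d = [a, b]`, `e = [b, c]`, `f = [d, c]`. -/
abbrev MayIdx : Type := Bool × Bool × Bool × Bool × Bool × Bool

/-- Formal sums of words, encoded as lists, evaluated at `g`. -/
def evalWords {R ι : Type} [Ring R] (g : ι → R) (P : List (List ι)) : R :=
  (P.map fun l => (l.map g).prod).sum

/-- The product of formal sums of words. -/
def mulWords {ι : Type} (P Q : List (List ι)) : List (List ι) :=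
  P.flatMap fun p => Q.map fun q => p ++ q

theorem evalWords_cons {R ι : Type} [Ring R] (g : ι → R) (p : List ι) (P : List (List ι)) :
    evalWords g (p :: P) = (p.map g).prod + evalWords g P := by
  simp [evalWords]

theorem evalWords_mul {R ι : Type} [Ring R] (g : ι → R) (P Q : List (List ι)) :
    evalWords g (mulWords P Q) = evalWords g P * evalWords g Q := by
  induction P with
  | nil => simp [evalWords, mulWords]
  | cons p P ih =>
    have h : evalWords g (mulWords (p :: P) Q) =
        (p.map g).prod * evalWords g Q + evalWords g (mulWords P Q) := by
      simp [evalWords, mulWords, Function.comp_def, List.sum_map_mul_left]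
    rw [h, ih, evalWords_cons, add_mul]

/-- The expansion of a Poincaré–Birkhoff–Witt monomial into words in the generators. -/
def mayWords : MayIdx → List (List (Fin 3))
  | (α, δ, β, φ, ε, γ) =>
    mulWords (if γ then [[2]] else [[]]) <|
    mulWords (if ε then [[1, 2], [2, 1]] else [[]]) <|
    mulWords (if β then [[1]] else [[]]) <|
    mulWords (if φ then [[0, 1, 2], [1, 0, 2], [2, 0, 1], [2, 1, 0]] else [[]]) <|
    mulWords (if δ then [[0, 1], [1, 0]] else [[]]) <|
    (if α then [[0]] else [[]])

/-- The Poincaré–Birkhoff–Witt monomials. -/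
def mayMono {R : Type} [Ring R] (g : Fin 3 → R) (S : MayIdx) : R := evalWords g (mayWords S)

/-- The factor `x ^ β` with exponent `0` or `1`. -/
def boolPow {R : Type} [Ring R] (x : R) (β : Bool) : R := if β then x else 1

@[simp] theorem boolPow_true {R : Type} [Ring R] (x : R) : boolPow x true = x := rfl

@[simp] theorem boolPow_false {R : Type} [Ring R] (x : R) : boolPow x false = 1 := rfl

theorem mayMono_eq {R : Type} [Ring R] (g : Fin 3 → R) (α δ β φ ε γ : Bool) :
    mayMono g (α, δ, β, φ, ε, γ) =
      boolPow (g 2) γ * (boolPow (comm₂ (g 1) (g 2)) ε * (boolPow (g 1) β *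
        (boolPow (comm₂ (comm₂ (g 0) (g 1)) (g 2)) φ * (boolPow (comm₂ (g 0) (g 1)) δ *
          boolPow (g 0) α)))) := by
  have h (x : R) (P Q : List (List (Fin 3))) (b : Bool) (hP : evalWords g P = x)
      (hQ : evalWords g Q = 1) : evalWords g (if b then P else Q) = boolPow x b := by
    cases b <;> simp [boolPow, hP, hQ]
  have h1 : evalWords g ([[]] : List (List (Fin 3))) = 1 := by simp [evalWords]
  rw [mayMono, mayWords, evalWords_mul, evalWords_mul, evalWords_mul, evalWords_mul,
    evalWords_mul]
  rw [h (g 2) _ _ γ _ h1, h (comm₂ (g 1) (g 2)) _ _ ε _ h1, h (g 1) _ _ β _ h1,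
    h (comm₂ (comm₂ (g 0) (g 1)) (g 2)) _ _ φ _ h1, h (comm₂ (g 0) (g 1)) _ _ δ _ h1,
    h (g 0) _ _ α _ h1]
  all_goals simp [evalWords, comm₂, mul_add, add_mul, mul_assoc, add_assoc]

/-- The monomials whose sum is the product of a monomial with a generator on the right. -/
def mayTable : Fin 3 → MayIdx → List MayIdx
  | 0, (α, δ, β, φ, ε, γ) => if α then [] else [(true, δ, β, φ, ε, γ)]
  | 1, (α, δ, β, φ, ε, γ) =>
    (if β then [] else [(α, δ, true, φ, ε, γ)]) ++
      (if α && !δ then [(false, true, β, φ, ε, γ)] else [])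
  | 2, (α, δ, β, φ, ε, γ) =>
    (if γ then [] else [(α, δ, β, φ, ε, true)]) ++
      ((if δ && !φ then [(α, false, β, true, ε, γ)] else []) ++
        (if β && !ε then [(α, δ, false, φ, true, γ)] else []))

/-- Multiplication by a generator on the right, as the table `mayTable`, follows from the
relations alone. -/
theorem mayMono_mul {R : Type} [Ring R] {g : Fin 3 → R} (hg : MayRelations g) (i : Fin 3)
    (S : MayIdx) : mayMono g S * g i = ((mayTable i S).map (mayMono g)).sum := by
  obtain ⟨h2, aa, bb, cc, ac, dd, ee, ff, fb⟩ := hg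
  obtain ⟨α, δ, β, φ, ε, γ⟩ := S
  have swap (x y : R) : x * y = y * x + comm₂ x y := by
    rw [comm₂, add_left_comm, h2, add_zero]
  -- an element of square zero commutes with its commutators
  have sq (x y : R) (hy : y * y = 0) : comm₂ x y * y = y * comm₂ x y := by
    simp only [comm₂, add_mul, mul_add, mul_assoc, hy, mul_zero, zero_add]
    rw [← mul_assoc y y, hy, zero_mul, add_zero]
  have ab := swap (g 0) (g 1)
  have bc := swap (g 1) (g 2)
  have dc := swap (comm₂ (g 0) (g 1)) (g 2)
  have db := sq (g 0) (g 1) bb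
  have ec := sq (g 1) (g 2) cc
  have fc := sq (comm₂ (g 0) (g 1)) (g 2) cc
  simp only [mayTable]
  generalize hf : comm₂ (comm₂ (g 0) (g 1)) (g 2) = f at *
  generalize hd : comm₂ (g 0) (g 1) = d at *
  generalize he : comm₂ (g 1) (g 2) = e at *
  have hm (α δ β φ ε γ : Bool) : mayMono g (α, δ, β, φ, ε, γ) = boolPow (g 2) γ *
      (boolPow e ε * (boolPow (g 1) β * (boolPow f φ * (boolPow d δ * boolPow (g 0) α)))) := by
    rw [mayMono_eq, hd, he, hf]
  have assoc {x y z : R} (h : x * y = z) (t : R) : x * (y * t) = z * t := by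
    rw [← mul_assoc, h]
  match i with
  | 0 => cases α <;> simp [hm, mul_assoc, aa]
  | 1 =>
    cases α <;> cases δ <;> cases β <;> cases φ <;>
      simp [hm, mul_assoc, mul_add, ab, db, fb, bb, dd, assoc db, assoc fb, assoc bb]
  | 2 =>
    cases α <;> cases δ <;> cases β <;> cases φ <;> cases ε <;> cases γ <;>
      simp [hm, mul_assoc, mul_add, add_mul, ac, dc, fc, bc, ec, cc, ff, ee, assoc dc,
        assoc fc, assoc bc, assoc ec, assoc cc, assoc ff, assoc ee, add_assoc, add_comm,
        add_left_comm]

/-- The product of a monomial with a word on the right, computed with `mayTable`. -/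
def mayMulWord : List (Fin 3) → MayIdx → List MayIdx
  | [], S => [S]
  | i :: l, S => (mayTable i S).flatMap (mayMulWord l)

theorem mayMono_mul_word {R : Type} [Ring R] {g : Fin 3 → R} (hg : MayRelations g)
    (l : List (Fin 3)) (S : MayIdx) :
    mayMono g S * (l.map g).prod = ((mayMulWord l S).map (mayMono g)).sum := by
  induction l generalizing S with
  | nil => simp [mayMulWord]
  | cons i l ih =>
    rw [List.map_cons, List.prod_cons, ← mul_assoc, mayMono_mul hg, ← List.sum_map_mul_right]
    simp only [mayMulWord, ih]
    induction mayTable i S with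
    | nil => rfl
    | cons Q L ihL => simp [ihL]

/-- The monomial `1`. -/
def mayBot : MayIdx := (false, false, false, false, false, false)

/-- The product of all generators of the Poincaré–Birkhoff–Witt basis. -/
def mayTop : MayIdx := (true, true, true, true, true, true)

theorem mayMono_bot {R : Type} [Ring R] (g : Fin 3 → R) : mayMono g mayBot = 1 := by
  simp [mayBot, mayMono_eq, boolPow]

/-- Every word in the generators is a sum of Poincaré–Birkhoff–Witt monomials. -/
theorem word_eq_sum_mayMono {R : Type} [Ring R] {g : Fin 3 → R} (hg : MayRelations g)
    (l : List (Fin 3)) : (l.map g).prod = ((mayMulWord l mayBot).map (mayMono g)).sum := by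
  rw [← mayMono_mul_word hg, mayMono_bot, one_mul]

/-- The number of letters `g i` in a monomial. -/
def mayCount : MayIdx → Fin 3 → ℕ
  | (α, δ, β, φ, ε, γ) =>
    ![α.toNat + δ.toNat + φ.toNat, β.toNat + δ.toNat + φ.toNat + ε.toNat,
      γ.toNat + φ.toNat + ε.toNat]

theorem mayCount_words : ∀ S : MayIdx, ∀ l ∈ mayWords S, ∀ i, l.count i = mayCount S i := by
  decide +kernel

/-- The relations preserve the number of occurrences of each generator, so that every grading of
the words by degrees of the generators descends to the algebra. -/
theorem mayCount_table : ∀ (i : Fin 3) (S : MayIdx), ∀ R ∈ mayTable i S, ∀ j,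
    mayCount R j = mayCount S j + if i = j then 1 else 0 := by
  decide +kernel

theorem mayCount_mulWord (l : List (Fin 3)) (S R : MayIdx) (hR : R ∈ mayMulWord l S)
    (j : Fin 3) : mayCount R j = mayCount S j + l.count j := by
  induction l generalizing S with
  | nil => simp [mayMulWord] at hR; simp [hR]
  | cons i l ih =>
    obtain ⟨Q, hQ, hR⟩ := List.mem_flatMap.1 hR
    rw [ih Q hR, mayCount_table i S Q hQ, List.count_cons]
    simp [add_assoc, add_comm]

/-- The degree of a monomial, for given degrees of the generators. -/
def mayDeg {Γ : Type} [AddCommMonoid Γ] (δ : Fin 3 → Γ) (S : MayIdx) : Γ :=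
  ∑ i, mayCount S i • δ i

theorem sum_map_eq_count {Γ : Type} [AddCommMonoid Γ] (δ : Fin 3 → Γ) (l : List (Fin 3)) :
    (l.map δ).sum = ∑ i, l.count i • δ i := by
  induction l with
  | nil => simp
  | cons i l ih =>
    simp [ih, List.count_cons, add_smul, Finset.sum_add_distrib, add_comm, ite_smul]

theorem mayDeg_words {Γ : Type} [AddCommMonoid Γ] (δ : Fin 3 → Γ) {S : MayIdx}
    {l : List (Fin 3)} (hl : l ∈ mayWords S) : (l.map δ).sum = mayDeg δ S := by
  simp [sum_map_eq_count, mayDeg, mayCount_words S l hl]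

theorem mayDeg_mulWord {Γ : Type} [AddCommMonoid Γ] (δ : Fin 3 → Γ) {l : List (Fin 3)}
    {R : MayIdx} (hR : R ∈ mayMulWord l mayBot) : mayDeg δ R = (l.map δ).sum := by
  have h (j : Fin 3) : mayCount R j = l.count j := by
    rw [mayCount_mulWord l mayBot R hR, show mayCount mayBot j = 0 by fin_cases j <;> rfl,
      zero_add]
  simp [sum_map_eq_count, mayDeg, h]

/-- A word that multiplies the monomial `S` to the top monomial and annihilates the monomials
after `S` in the lexicographic order: the words in the list raise the exponents `α`, `δ`, `β`,
`φ`, `ε`, `γ`, one after the other, when all exponents before are `1`. -/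
def mayDual : MayIdx → List (Fin 3)
  | (α, δ, β, φ, ε, γ) =>
    (if α then [] else [0]) ++ (if δ then [] else [1, 0]) ++ (if β then [] else [1]) ++
      (if φ then [] else [2, 1, 0]) ++ (if ε then [] else [2, 1]) ++ (if γ then [] else [2])

/-- The position of a monomial in the lexicographic order. -/
def mayRank : MayIdx → ℕ
  | (α, δ, β, φ, ε, γ) => 32 * α.toNat + 16 * δ.toNat + 8 * β.toNat + 4 * φ.toNat +
    2 * ε.toNat + γ.toNat

instance : DecidableEq MayIdx := inferInstance

instance : Fintype MayIdx := inferInstance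

theorem mayDual_self : ∀ S : MayIdx, mayMulWord (mayDual S) S = [mayTop] := by
  decide +kernel

theorem mayDual_of_lt : ∀ S R : MayIdx, mayRank S < mayRank R →
    mayMulWord (mayDual S) R = [] := by
  decide +kernel

theorem mayRank_injective : ∀ S R : MayIdx, mayRank S = mayRank R → S = R := by
  decide +kernel

/-- The socle of the algebra is spanned by the top monomial, so that the monomials are
independent as soon as the top monomial is. -/
theorem linearIndependent_mayMono {k R : Type} [CommRing k] [Ring R] [Algebra k R]
    {g : Fin 3 → R} (hg : MayRelations g)
    (htop : ∀ c : k, c • mayMono g mayTop = 0 → c = 0) : LinearIndependent k (mayMono g) := by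
  rw [Fintype.linearIndependent_iff]
  intro u hu S
  induction h : mayRank S using Nat.strong_induction_on generalizing S with
  | _ n ih =>
    subst h
    apply htop
    -- the word `mayDual S` kills the monomials after `S`, and those before have coefficient zero
    have h1 := congrArg (· * ((mayDual S).map g).prod) hu
    simp only [Finset.sum_mul, smul_mul_assoc, mayMono_mul_word hg, zero_mul] at h1
    rw [Finset.sum_eq_single S] at h1
    · simpa [mayDual_self] using h1
    · intro T _ hT
      rcases lt_trichotomy (mayRank S) (mayRank T) with h | h | h
      · simp [mayDual_of_lt S T h]
      · exact absurd (mayRank_injective _ _ h).symm hT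
      · rw [ih _ h T rfl, zero_smul]
    · simp

end MayAlgebra

/-! ### Consequences of the Adem relations -/

section Adem

variable {k : Type} [CommRing k] {τ : k}

theorem Sq_zero : Sq k τ 0 = 1 := by
  have h := RingQuot.mkAlgHom_rel k (SteenrodRel.zero (k := k) (τ := τ))
  rwa [map_one] at h

theorem adem (a b : ℕ) (ha : 0 < a) (hab : a < 2 * b) :
    Sq k τ a * Sq k τ b = ∑ c ∈ Finset.range (a / 2 + 1),
      (((b - 1 - c).choose (a - 2 * c) : k) * τ ^ tauExp a b c) •
        (Sq k τ (a + b - c) * Sq k τ c) := by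
  have h := RingQuot.mkAlgHom_rel k (SteenrodRel.adem (k := k) (τ := τ) a b ha hab)
  rw [map_mul, map_sum] at h
  simp only [map_smul, map_mul] at h
  exact h

variable [CharP k 2]

/-- The Adem relations with the binomial coefficients reduced modulo two, in the form in which
they are evaluated for given `a` and `b`. -/
theorem adem_mod (a b : ℕ) (ha : 0 < a) (hab : a < 2 * b) :
    Sq k τ a * Sq k τ b = ∑ c ∈ Finset.range (a / 2 + 1),
      ((((b - 1 - c).choose (a - 2 * c) % 2 : ℕ) : k) * τ ^ tauExp a b c) •
        (Sq k τ (a + b - c) * Sq k τ c) := by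
  rw [adem a b ha hab]
  refine Finset.sum_congr rfl fun c _ => ?_
  rw [← CharP.cast_eq_mod]

theorem steenrod_add_self {A : Type} [Ring A] [Algebra k A] (x : A) : x + x = 0 := by
  rw [← two_smul k x, CharTwo.two_eq_zero, zero_smul]

theorem adem_1_1 : Sq k τ 1 * Sq k τ 1 = 0 := by
  rw [adem_mod _ _ (by norm_num) (by norm_num)]
  norm_num [Finset.sum_range_succ, tauExp, sqWeight, Nat.choose, Sq_zero]

theorem adem_1_2 : Sq k τ 1 * Sq k τ 2 = Sq k τ 3 := by
  rw [adem_mod _ _ (by norm_num) (by norm_num)]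
  norm_num [Finset.sum_range_succ, tauExp, sqWeight, Nat.choose, Sq_zero]

theorem adem_1_3 : Sq k τ 1 * Sq k τ 3 = 0 := by
  rw [adem_mod _ _ (by norm_num) (by norm_num)]
  norm_num [Finset.sum_range_succ, tauExp, sqWeight, Nat.choose, Sq_zero]

theorem adem_1_4 : Sq k τ 1 * Sq k τ 4 = Sq k τ 5 := by
  rw [adem_mod _ _ (by norm_num) (by norm_num)]
  norm_num [Finset.sum_range_succ, tauExp, sqWeight, Nat.choose, Sq_zero]

theorem adem_1_5 : Sq k τ 1 * Sq k τ 5 = 0 := by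
  rw [adem_mod _ _ (by norm_num) (by norm_num)]
  norm_num [Finset.sum_range_succ, tauExp, sqWeight, Nat.choose, Sq_zero]

theorem adem_1_6 : Sq k τ 1 * Sq k τ 6 = Sq k τ 7 := by
  rw [adem_mod _ _ (by norm_num) (by norm_num)]
  norm_num [Finset.sum_range_succ, tauExp, sqWeight, Nat.choose, Sq_zero]

theorem adem_1_7 : Sq k τ 1 * Sq k τ 7 = 0 := by
  rw [adem_mod _ _ (by norm_num) (by norm_num)]
  norm_num [Finset.sum_range_succ, tauExp, sqWeight, Nat.choose, Sq_zero]

theorem adem_2_2 : Sq k τ 2 * Sq k τ 2 = τ • (Sq k τ 3 * Sq k τ 1) := by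
  rw [adem_mod _ _ (by norm_num) (by norm_num)]
  norm_num [Finset.sum_range_succ, tauExp, sqWeight, Nat.choose, Sq_zero]

theorem adem_2_3 : Sq k τ 2 * Sq k τ 3 = Sq k τ 5 + Sq k τ 4 * Sq k τ 1 := by
  rw [adem_mod _ _ (by norm_num) (by norm_num)]
  norm_num [Finset.sum_range_succ, tauExp, sqWeight, Nat.choose, Sq_zero]

theorem adem_2_4 : Sq k τ 2 * Sq k τ 4 = Sq k τ 6 + τ • (Sq k τ 5 * Sq k τ 1) := by
  rw [adem_mod _ _ (by norm_num) (by norm_num)]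
  norm_num [Finset.sum_range_succ, tauExp, sqWeight, Nat.choose, Sq_zero]

theorem adem_2_5 : Sq k τ 2 * Sq k τ 5 = Sq k τ 6 * Sq k τ 1 := by
  rw [adem_mod _ _ (by norm_num) (by norm_num)]
  norm_num [Finset.sum_range_succ, tauExp, sqWeight, Nat.choose, Sq_zero]

theorem adem_2_6 : Sq k τ 2 * Sq k τ 6 = τ • (Sq k τ 7 * Sq k τ 1) := by
  rw [adem_mod _ _ (by norm_num) (by norm_num)]
  norm_num [Finset.sum_range_succ, tauExp, sqWeight, Nat.choose, Sq_zero]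

theorem adem_2_7 : Sq k τ 2 * Sq k τ 7 = Sq k τ 9 + Sq k τ 8 * Sq k τ 1 := by
  rw [adem_mod _ _ (by norm_num) (by norm_num)]
  norm_num [Finset.sum_range_succ, tauExp, sqWeight, Nat.choose, Sq_zero]

theorem adem_3_2 : Sq k τ 3 * Sq k τ 2 = 0 := by
  rw [adem_mod _ _ (by norm_num) (by norm_num)]
  norm_num [Finset.sum_range_succ, tauExp, sqWeight, Nat.choose, Sq_zero]

theorem adem_3_3 : Sq k τ 3 * Sq k τ 3 = Sq k τ 5 * Sq k τ 1 := by
  rw [adem_mod _ _ (by norm_num) (by norm_num)]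
  norm_num [Finset.sum_range_succ, tauExp, sqWeight, Nat.choose, Sq_zero]

theorem adem_3_4 : Sq k τ 3 * Sq k τ 4 = Sq k τ 7 := by
  rw [adem_mod _ _ (by norm_num) (by norm_num)]
  norm_num [Finset.sum_range_succ, tauExp, sqWeight, Nat.choose, Sq_zero]

theorem adem_4_3 : Sq k τ 4 * Sq k τ 3 = Sq k τ 5 * Sq k τ 2 := by
  rw [adem_mod _ _ (by norm_num) (by norm_num)]
  norm_num [Finset.sum_range_succ, tauExp, sqWeight, Nat.choose, Sq_zero]

theorem adem_4_4 : Sq k τ 4 * Sq k τ 4 = τ • (Sq k τ 7 * Sq k τ 1) + Sq k τ 6 * Sq k τ 2 := by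
  rw [adem_mod _ _ (by norm_num) (by norm_num)]
  norm_num [Finset.sum_range_succ, tauExp, sqWeight, Nat.choose, Sq_zero]

theorem adem_4_6 : Sq k τ 4 * Sq k τ 6 = Sq k τ 10 + Sq k τ 8 * Sq k τ 2 := by
  rw [adem_mod _ _ (by norm_num) (by norm_num)]
  norm_num [Finset.sum_range_succ, tauExp, sqWeight, Nat.choose, Sq_zero]

theorem adem_4_9 : Sq k τ 4 * Sq k τ 9 = Sq k τ 12 * Sq k τ 1 + Sq k τ 11 * Sq k τ 2 := by
  rw [adem_mod _ _ (by norm_num) (by norm_num)]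
  norm_num [Finset.sum_range_succ, tauExp, sqWeight, Nat.choose, Sq_zero]

theorem adem_5_5 : Sq k τ 5 * Sq k τ 5 = Sq k τ 9 * Sq k τ 1 := by
  rw [adem_mod _ _ (by norm_num) (by norm_num)]
  norm_num [Finset.sum_range_succ, tauExp, sqWeight, Nat.choose, Sq_zero]

theorem adem_5_6 : Sq k τ 5 * Sq k τ 6 = Sq k τ 11 + Sq k τ 9 * Sq k τ 2 := by
  rw [adem_mod _ _ (by norm_num) (by norm_num)]
  norm_num [Finset.sum_range_succ, tauExp, sqWeight, Nat.choose, Sq_zero]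

theorem adem_5_8 : Sq k τ 5 * Sq k τ 8 = Sq k τ 13 + Sq k τ 11 * Sq k τ 2 := by
  rw [adem_mod _ _ (by norm_num) (by norm_num)]
  norm_num [Finset.sum_range_succ, tauExp, sqWeight, Nat.choose, Sq_zero]

theorem adem_5_9 : Sq k τ 5 * Sq k τ 9 = Sq k τ 13 * Sq k τ 1 := by
  rw [adem_mod _ _ (by norm_num) (by norm_num)]
  norm_num [Finset.sum_range_succ, tauExp, sqWeight, Nat.choose, Sq_zero]

theorem adem_6_5 : Sq k τ 6 * Sq k τ 5 = Sq k τ 9 * Sq k τ 2 + Sq k τ 8 * Sq k τ 3 := by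
  rw [adem_mod _ _ (by norm_num) (by norm_num)]
  norm_num [Finset.sum_range_succ, tauExp, sqWeight, Nat.choose, Sq_zero]

theorem adem_6_7 : Sq k τ 6 * Sq k τ 7 =
    Sq k τ 13 + Sq k τ 12 * Sq k τ 1 + Sq k τ 10 * Sq k τ 3 := by
  rw [adem_mod _ _ (by norm_num) (by norm_num)]
  norm_num [Finset.sum_range_succ, tauExp, sqWeight, Nat.choose, Sq_zero]

theorem adem_7_4 : Sq k τ 7 * Sq k τ 4 = 0 := by
  rw [adem_mod _ _ (by norm_num) (by norm_num)]
  norm_num [Finset.sum_range_succ, tauExp, sqWeight, Nat.choose, Sq_zero]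

theorem adem_7_5 : Sq k τ 7 * Sq k τ 5 = Sq k τ 9 * Sq k τ 3 := by
  rw [adem_mod _ _ (by norm_num) (by norm_num)]
  norm_num [Finset.sum_range_succ, tauExp, sqWeight, Nat.choose, Sq_zero]

theorem adem_7_6 : Sq k τ 7 * Sq k τ 6 = Sq k τ 11 * Sq k τ 2 := by
  rw [adem_mod _ _ (by norm_num) (by norm_num)]
  norm_num [Finset.sum_range_succ, tauExp, sqWeight, Nat.choose, Sq_zero]

theorem adem_7_7 : Sq k τ 7 * Sq k τ 7 = Sq k τ 13 * Sq k τ 1 + Sq k τ 11 * Sq k τ 3 := by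
  rw [adem_mod _ _ (by norm_num) (by norm_num)]
  norm_num [Finset.sum_range_succ, tauExp, sqWeight, Nat.choose, Sq_zero]

theorem adem_8_5 : Sq k τ 8 * Sq k τ 5 = Sq k τ 9 * Sq k τ 4 := by
  rw [adem_mod _ _ (by norm_num) (by norm_num)]
  norm_num [Finset.sum_range_succ, tauExp, sqWeight, Nat.choose, Sq_zero]

theorem adem_9_5 : Sq k τ 9 * Sq k τ 5 = 0 := by
  rw [adem_mod _ _ (by norm_num) (by norm_num)]
  norm_num [Finset.sum_range_succ, tauExp, sqWeight, Nat.choose, Sq_zero]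

theorem mul_mul_of_mul_eq {R : Type} [Ring R] {x y z : R} (h : x * y = z) (t : R) :
    x * (y * t) = z * t := by
  rw [← mul_assoc, h]

/-- The square of the Milnor element `Q₂ = Sq^7 + Sq^6 Sq^1 + Sq^5 Sq^2 + Sq^4 Sq^2 Sq^1`. -/
theorem milnor_sq : (Sq k τ 7 + Sq k τ 6 * Sq k τ 1 + Sq k τ 5 * Sq k τ 2 +
    Sq k τ 4 * Sq k τ 2 * Sq k τ 1) * (Sq k τ 7 + Sq k τ 6 * Sq k τ 1 + Sq k τ 5 * Sq k τ 2 +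
    Sq k τ 4 * Sq k τ 2 * Sq k τ 1) = 0 := by
  have h2 (x : SteenrodAlg k τ) : (2 : ℤ) • x = 0 := by
    rw [two_smul, steenrod_add_self (k := k)]
  have h4 (x : SteenrodAlg k τ) : (4 : ℤ) • x = 0 := by
    rw [show (4 : ℤ) = 2 * 2 by norm_num, mul_smul, h2]
  simp only [mul_add, add_mul, mul_assoc, smul_mul_assoc, mul_smul_comm, zero_mul, mul_zero,
    add_zero, zero_add, smul_zero,
    adem_1_1, adem_1_2, adem_1_7, adem_2_3, adem_2_7, adem_3_2, adem_5_9, adem_7_7, adem_9_5,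
    mul_mul_of_mul_eq adem_1_2, mul_mul_of_mul_eq adem_1_3, mul_mul_of_mul_eq adem_1_4,
    mul_mul_of_mul_eq adem_1_5, mul_mul_of_mul_eq adem_1_6, mul_mul_of_mul_eq adem_2_2,
    mul_mul_of_mul_eq adem_2_3, mul_mul_of_mul_eq adem_2_4, mul_mul_of_mul_eq adem_2_5,
    mul_mul_of_mul_eq adem_2_6, mul_mul_of_mul_eq adem_2_7, mul_mul_of_mul_eq adem_3_2,
    mul_mul_of_mul_eq adem_4_6, mul_mul_of_mul_eq adem_4_9, mul_mul_of_mul_eq adem_5_5,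
    mul_mul_of_mul_eq adem_5_6, mul_mul_of_mul_eq adem_5_8, mul_mul_of_mul_eq adem_6_5,
    mul_mul_of_mul_eq adem_6_7, mul_mul_of_mul_eq adem_7_4, mul_mul_of_mul_eq adem_7_5,
    mul_mul_of_mul_eq adem_7_6, mul_mul_of_mul_eq adem_8_5]
  abel_nf
  simp only [h2, h4, add_zero]

theorem Sq_sq_two : Sq k τ 2 * Sq k τ 2 = τ • (Sq k τ 1 * Sq k τ 2 * Sq k τ 1) := by
  rw [adem_2_2, adem_1_2]

theorem comm₂_Sq_one_four :
    comm₂ (Sq k τ 1) (Sq k τ 4) = Sq k τ 2 * Sq k τ 1 * Sq k τ 2 := by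
  rw [comm₂, mul_assoc (Sq k τ 2), adem_1_2, adem_2_3, adem_1_4]

theorem Sq_sq_four : Sq k τ 4 * Sq k τ 4 = τ • (Sq k τ 1 * Sq k τ 2 * Sq k τ 4 * Sq k τ 1) +
    Sq k τ 2 * Sq k τ 4 * Sq k τ 2 + τ • (Sq k τ 1 * Sq k τ 4 * Sq k τ 1 * Sq k τ 2) := by
  rw [adem_4_4, adem_1_2, adem_1_4, adem_2_4, adem_3_4, add_mul, smul_mul_assoc, add_assoc,
    add_assoc, steenrod_add_self (k := k), add_zero]

theorem comm₂_Sq_one_two_sq :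
    comm₂ (Sq k τ 1) (Sq k τ 2) * comm₂ (Sq k τ 1) (Sq k τ 2) = 0 := by
  have h (t : SteenrodAlg k τ) := steenrod_add_self (k := k) t
  simp only [comm₂, adem_1_2, mul_add, add_mul, mul_assoc, adem_1_3,
    mul_mul_of_mul_eq adem_3_2, mul_mul_of_mul_eq adem_2_3, adem_3_3, adem_1_1, zero_mul,
    mul_zero, add_zero, mul_mul_of_mul_eq adem_1_2, zero_add, h]

/-- The Milnor element `Q₂` is the iterated commutator of `Sq^1`, `Sq^2` and `Sq^4`. -/
theorem comm₂_Sq_one_two_four : comm₂ (comm₂ (Sq k τ 1) (Sq k τ 2)) (Sq k τ 4) =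
    Sq k τ 7 + Sq k τ 6 * Sq k τ 1 + Sq k τ 5 * Sq k τ 2 + Sq k τ 4 * Sq k τ 2 * Sq k τ 1 := by
  rw [comm₂, comm₂, adem_1_2, add_mul, mul_add, mul_assoc, adem_1_4, adem_2_5, adem_3_4,
    adem_4_3, mul_assoc, add_assoc (Sq k τ 7 + _)]

end Adem

/-! ### Relations in the associated graded algebra -/

section GrRelations

section Lifts

variable {k : Type} [CommRing k] {A : Type} [Ring A] [Algebra k A] (I : Ideal A) [I.IsTwoSided]

variable (k) in
/-- The element `x` lies in `I ^ n` and `u` is its class in `I ^ n / I ^ (n + 1)`. -/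
def Lifts (n : ℕ) (x : A) (u : Gr k I) : Prop := ∃ hx : x ∈ I ^ n, u = grClass k I n x hx

variable {I} {m n : ℕ} {x y : A} {u v : Gr k I}

theorem Lifts.add (hx : Lifts k I n x u) (hy : Lifts k I n y v) :
    Lifts k I n (x + y) (u + v) := by
  obtain ⟨hx, rfl⟩ := hx
  obtain ⟨hy, rfl⟩ := hy
  refine ⟨add_mem hx hy, ?_⟩
  rw [grClass, grClass, ← map_add, ← map_add]
  rfl

theorem Lifts.smul (c : k) (hx : Lifts k I n x u) : Lifts k I n (c • x) (c • u) := by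
  obtain ⟨hx, rfl⟩ := hx
  refine ⟨(idealPow k I n).smul_mem c hx, ?_⟩
  change c • DirectSum.lof k ℕ (GrPiece k I) n _ = DirectSum.lof k ℕ (GrPiece k I) n _
  rw [← map_smul, ← map_smul]
  rfl

theorem Lifts.mul (hx : Lifts k I m x u) (hy : Lifts k I n y v) :
    Lifts k I (m + n) (x * y) (u * v) := by
  obtain ⟨hx, rfl⟩ := hx
  obtain ⟨hy, rfl⟩ := hy
  exact ⟨idealPow_mul_mem hx hy, DirectSum.of_mul_of _ _⟩

theorem Lifts.one : Lifts k I 0 (1 : A) (1 : Gr k I) := ⟨one_mem_idealPow k I, rfl⟩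

theorem Lifts.zero (n : ℕ) : Lifts k I n (0 : A) (0 : Gr k I) := by
  refine ⟨zero_mem _, ?_⟩
  rw [grClass, grMk_eq_zero k _ (zero_mem _), map_zero]

theorem Lifts.comm₂ (hx : Lifts k I m x u) (hy : Lifts k I n y v) :
    Lifts k I (m + n) (comm₂ x y) (comm₂ u v) := by
  have h := hy.mul hx
  rw [add_comm n m] at h
  exact (hx.mul hy).add h

theorem Lifts.unique (hx : Lifts k I n x u) (hy : Lifts k I n x v) : u = v := by
  obtain ⟨hx, rfl⟩ := hx
  obtain ⟨_, rfl⟩ := hy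
  rfl

/-- Membership in the next power of the ideal is vanishing of the class: relations in the
associated graded algebra are proved and used in this form. -/
theorem Lifts.eq_zero_iff (hx : Lifts k I n x u) : u = 0 ↔ x ∈ I ^ (n + 1) := by
  obtain ⟨hx, rfl⟩ := hx
  rw [grClass, map_eq_zero_iff _ (DirectSum.of_injective n)]
  exact Submodule.Quotient.mk_eq_zero _

theorem Lifts.word {ι : Type} {h : ι → A} {g : ι → Gr k I} (hg : ∀ i, Lifts k I 1 (h i) (g i))
    (l : List ι) : Lifts k I l.length (l.map h).prod (l.map g).prod := by
  induction l with
  | nil => exact Lifts.one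
  | cons i l ih =>
    simp only [List.map_cons, List.prod_cons, List.length_cons]
    rw [add_comm]
    exact (hg i).mul ih

end Lifts

variable (k : Type) [CommRing k] (τ : k)

/-- The classes of `Sq^1`, `Sq^2`, `Sq^4` in `I / I ^ 2`. -/
def grGen (i : Fin 3) : GrA2 k τ :=
  grClass k (A2ideal k τ) 1 (A2gen k τ i) (by rw [Submodule.pow_one]; exact A2gen_mem k τ i)

theorem lifts_grGen (i : Fin 3) : Lifts k (A2ideal k τ) 1 (A2gen k τ i) (grGen k τ i) :=
  ⟨_, rfl⟩

theorem A2val_injective : Function.Injective (A2val k τ) := Subtype.val_injective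

variable {k τ}

theorem A2_pow_le {m n : ℕ} (h : m ≤ n) : A2ideal k τ ^ n ≤ A2ideal k τ ^ m := by
  exact Ideal.pow_le_pow_right h

theorem A2gen_mem_pow (i : Fin 3) : A2gen k τ i ∈ A2ideal k τ ^ 1 := by
  rw [Submodule.pow_one]; exact A2gen_mem k τ i

theorem A2_smul_mem {n : ℕ} (c : k) {x : A2 k τ} (hx : x ∈ A2ideal k τ ^ n) :
    c • x ∈ A2ideal k τ ^ n := (idealPow k (A2ideal k τ) n).smul_mem c hx

variable [CharP k 2]

/-- The generators of `Gr A(2)` satisfy the relations of the restricted enveloping algebra: in the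
Adem relations, the terms that do not belong to these relations have higher filtration. -/
theorem mayRelations_gr : MayRelations (grGen k τ) := by
  set x := A2gen k τ 0 with hx
  set y := A2gen k τ 1 with hy
  set z := A2gen k τ 2 with hz
  have a := lifts_grGen k τ 0
  have b := lifts_grGen k τ 1
  have c := lifts_grGen k τ 2
  have add_self (u : A2 k τ) : u + u = 0 := steenrod_add_self (k := k) u
  have xI : x ∈ A2ideal k τ ^ 1 := A2gen_mem_pow 0
  have yI : y ∈ A2ideal k τ ^ 1 := A2gen_mem_pow 1
  have zI : z ∈ A2ideal k τ ^ 1 := A2gen_mem_pow 2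
  have xx : x * x = 0 := A2val_injective k τ adem_1_1
  have yy : y * y = τ • (x * y * x) := A2val_injective k τ Sq_sq_two
  have zz : z * z = τ • (x * y * z * x) + y * z * y + τ • (x * z * x * y) :=
    A2val_injective k τ Sq_sq_four
  have xz : comm₂ x z = y * x * y := A2val_injective k τ comm₂_Sq_one_four
  have dd : comm₂ x y * comm₂ x y = 0 := A2val_injective k τ comm₂_Sq_one_two_sq
  have ff : comm₂ (comm₂ x y) z * comm₂ (comm₂ x y) z = 0 := by
    refine A2val_injective k τ ?_
    have h := milnor_sq (k := k) (τ := τ)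
    rw [← comm₂_Sq_one_two_four] at h
    exact h
  have mm {m n : ℕ} {p q : A2 k τ} (hp : p ∈ A2ideal k τ ^ m) (hq : q ∈ A2ideal k τ ^ n) :
      p * q ∈ A2ideal k τ ^ (m + n) := idealPow_mul_mem hp hq
  have yyI : y * y ∈ A2ideal k τ ^ 3 := by
    rw [yy]; exact A2_smul_mem _ (mm (mm xI yI) xI)
  have zzI : z * z ∈ A2ideal k τ ^ 3 := by
    rw [zz]
    exact add_mem (add_mem
      (A2_smul_mem _ (A2_pow_le (by norm_num) (mm (mm (mm xI yI) zI) xI)))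
      (mm (mm yI zI) yI)) (A2_smul_mem _ (A2_pow_le (by norm_num) (mm (mm (mm xI zI) xI) yI)))
  set W : A2 k τ := τ • (x * y * z * x) + τ • (x * z * x * y) with hW
  have WI : W ∈ A2ideal k τ ^ 4 :=
    add_mem (A2_smul_mem _ (mm (mm (mm xI yI) zI) xI)) (A2_smul_mem _ (mm (mm (mm xI zI) xI) yI))
  have zzW : z * z = y * z * y + W := by rw [zz, hW]; abel
  have yzy : y * z * y = z * z + W := by rw [zzW, add_assoc, add_self, add_zero]
  -- each relation holds modulo a power of the ideal one above the length of its words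
  refine ⟨steenrod_add_self (k := k), ?_, ?_, ?_, ?_, ?_, ?_, ?_, ?_⟩
  · exact (a.mul a).eq_zero_iff.2 (by rw [← hx, xx]; exact zero_mem _)
  · exact (b.mul b).eq_zero_iff.2 yyI
  · exact (c.mul c).eq_zero_iff.2 zzI
  · refine eq_of_sub_eq_zero ?_
    rw [sub_eq_add_neg, neg_eq_of_add_eq_zero_left (steenrod_add_self (k := k) _)]
    refine (a.comm₂ c).eq_zero_iff.2 ?_
    rw [← hx, ← hz, xz]
    exact mm (mm yI xI) yI
  · exact ((a.comm₂ b).mul (a.comm₂ b)).eq_zero_iff.2 (by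
      rw [← hx, ← hy, dd]; exact zero_mem _)
  · refine ((b.comm₂ c).mul (b.comm₂ c)).eq_zero_iff.2 ?_
    rw [← hy, ← hz]
    have h : comm₂ y z * comm₂ y z =
        W * z + y * (z * z) * y + z * (y * y) * z + z * W + (z * z * z + z * z * z) := by
      rw [← sub_eq_zero, show comm₂ y z * comm₂ y z =
        y * z * y * z + y * (z * z) * y + z * (y * y) * z + z * (y * z * y) by
          simp only [comm₂]; noncomm_ring, yzy]
      noncomm_ring
    rw [h, add_self, add_zero]
    have le {n : ℕ} (hn : 5 ≤ n) {p : A2 k τ} (hp : p ∈ A2ideal k τ ^ n) :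
        p ∈ A2ideal k τ ^ (1 + 1 + (1 + 1) + 1) := A2_pow_le hn hp
    exact add_mem (add_mem (add_mem (le le_rfl (mm WI zI)) (le le_rfl (mm (mm yI zzI) yI)))
      (le le_rfl (mm (mm zI yyI) zI))) (le le_rfl (mm zI WI))
  · exact (((a.comm₂ b).comm₂ c).mul ((a.comm₂ b).comm₂ c)).eq_zero_iff.2 (by
      rw [← hx, ← hy, ← hz, ff]; exact zero_mem _)
  · refine eq_of_sub_eq_zero ?_
    rw [sub_eq_add_neg, neg_eq_of_add_eq_zero_left (steenrod_add_self (k := k) _)]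
    refine (((a.comm₂ b).comm₂ c).comm₂ b).eq_zero_iff.2 ?_
    rw [← hx, ← hy, ← hz]
    -- the commutator of `Sq^1` with `Sq^4 Sq^4`, computed in two ways
    have h1 : z * (y * x * y) + y * x * y * z =
        y * z * y * x + x * (y * z * y) + (W * x + x * W) := by
      have h : z * comm₂ x z + comm₂ x z * z =
          z * z * x + x * (z * z) + (z * x * z + z * x * z) := by
        simp only [comm₂]; noncomm_ring
      rw [← xz, h, add_self, add_zero, zzW]
      noncomm_ring
    have h2 : comm₂ (comm₂ (comm₂ x y) z) y = z * (y * x * y) + y * x * y * z +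
        (y * z * y * x + x * (y * z * y)) + z * x * (y * y) + y * y * x * z +
          y * comm₂ x z * y := by
      simp only [comm₂]; noncomm_ring
    have h3 : comm₂ (comm₂ (comm₂ x y) z) y = W * x + x * W + z * x * (y * y) + y * y * x * z +
          y * (y * x * y) * y := by
      rw [h2, h1, xz, add_right_comm (_ + _) (W * x + x * W), add_self, zero_add]
    rw [h3]
    have le {n : ℕ} (hn : 5 ≤ n) {p : A2 k τ} (hp : p ∈ A2ideal k τ ^ n) :
        p ∈ A2ideal k τ ^ (1 + 1 + 1 + 1 + 1) := A2_pow_le hn hp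
    exact add_mem (add_mem (add_mem (add_mem (le le_rfl (mm WI xI)) (le le_rfl (mm xI WI)))
      (le le_rfl (mm (mm zI xI) yyI))) (le le_rfl (mm (mm yyI xI) zI)))
      (le le_rfl (mm (mm yI (mm (mm yI xI) yI)) yI))

end GrRelations

/-! ### Homomorphisms out of the Steenrod algebra and its gradings -/

section Coaction

/-- The ring `B`, with the algebra structure given by a homomorphism to its centre. -/
def Twist {k B : Type} [CommRing k] [Ring B] (i : k →+* B) (_ : ∀ c x, i c * x = x * i c) :
    Type := B

instance {k B : Type} [CommRing k] [Ring B] (i : k →+* B) (h : ∀ c x, i c * x = x * i c) :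
    Ring (Twist i h) := inferInstanceAs (Ring B)

instance {k B : Type} [CommRing k] [Ring B] (i : k →+* B) (h : ∀ c x, i c * x = x * i c) :
    Algebra k (Twist i h) := i.toAlgebra' h

/-- The homomorphism from the Steenrod algebra that sends `Sq^n` to `s n`. -/
def steenrodLift {k : Type} [CommRing k] {τ : k} {B : Type} [Ring B] [Algebra k B] (s : ℕ → B)
    (h0 : s 0 = 1)
    (hs : ∀ a b, 0 < a → a < 2 * b → s a * s b = ∑ c ∈ Finset.range (a / 2 + 1),
      (((b - 1 - c).choose (a - 2 * c) : k) * τ ^ tauExp a b c) • (s (a + b - c) * s c)) :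
    SteenrodAlg k τ →ₐ[k] B :=
  RingQuot.liftAlgHom k (s := SteenrodRel k τ) ⟨FreeAlgebra.lift k s, by
    rintro _ _ (_ | ⟨a, b, ha, hab⟩)
    · simp [h0]
    · simp only [map_mul, FreeAlgebra.lift_ι_apply, map_sum, map_smul]
      exact hs a b ha hab⟩

theorem steenrodLift_Sq {k : Type} [CommRing k] {τ : k} {B : Type} [Ring B] [Algebra k B]
    (s : ℕ → B) (h0 hs) (n : ℕ) :
    steenrodLift (k := k) (τ := τ) s h0 hs (Sq k τ n) = s n :=
  (RingQuot.liftAlgHom_mkAlgHom_apply k _ _ _).trans (FreeAlgebra.lift_ι_apply _ _)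

/-- A coaction on the Steenrod algebra, that is, a multiplicative choice of homogeneous
components, for which `τ` has degree `u` and `Sq^n` has degree `g n`. -/
structure IsCoaction {k : Type} [CommRing k] {τ : k} {Γ : Type} [AddCommMonoid Γ]
    (γ : SteenrodAlg k τ →+* AddMonoidAlgebra (SteenrodAlg k τ) Γ) (u : Γ) (g : ℕ → Γ) :
    Prop where
  tau : γ (algebraMap k _ τ) = AddMonoidAlgebra.single u (algebraMap k _ τ)
  Sq : ∀ n, γ (Sq k τ n) = AddMonoidAlgebra.single (g n) (Sq k τ n)

theorem choose_cast_eq_zero {k : Type} [CommRing k] [CharP k 2] {n : ℕ}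
    (h : (n : ZMod 2) = 0) : (n : k) = 0 := by
  rw [CharP.cast_eq_zero_iff (ZMod 2) 2] at h
  rwa [CharP.cast_eq_zero_iff k 2]

/-- Degrees `u` of `τ` and `g n` of `Sq^n` define a coaction as soon as the Adem relations are
homogeneous. The coaction need not be `k`-linear; it is semilinear over a ring homomorphism `i`. -/
theorem exists_coaction {k : Type} [CommRing k] [CharP k 2] {τ : k} {Γ : Type} [AddCommMonoid Γ]
    (i : k →+* AddMonoidAlgebra (SteenrodAlg k τ) Γ) (hi : ∀ c x, i c * x = x * i c) (u : Γ)
    (g : ℕ → Γ) (hτ : i τ = AddMonoidAlgebra.single u (algebraMap k _ τ)) (h0 : g 0 = 0)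
    (hg : ∀ a b c, a < 2 * b → c ≤ a / 2 → (((b - 1 - c).choose (a - 2 * c) : ℕ) : ZMod 2) ≠ 0 →
      tauExp a b c • u + (g (a + b - c) + g c) = g a + g b) :
    ∃ γ : SteenrodAlg k τ →+* AddMonoidAlgebra (SteenrodAlg k τ) Γ, IsCoaction γ u g := by
  let s (n : ℕ) : Twist i hi :=
    (AddMonoidAlgebra.single (g n) (Sq k τ n) : AddMonoidAlgebra (SteenrodAlg k τ) Γ)
  have hs0 : s 0 = 1 := by
    simp only [s, h0, Sq_zero]; rfl
  have hs : ∀ a b, 0 < a → a < 2 * b → s a * s b = ∑ c ∈ Finset.range (a / 2 + 1),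
      (((b - 1 - c).choose (a - 2 * c) : k) * τ ^ tauExp a b c) • (s (a + b - c) * s c) := by
    intro a b ha hab
    change (AddMonoidAlgebra.single (g a) (Sq k τ a) : AddMonoidAlgebra (SteenrodAlg k τ) Γ) *
      AddMonoidAlgebra.single (g b) (Sq k τ b) = ∑ c ∈ Finset.range (a / 2 + 1),
        i (((b - 1 - c).choose (a - 2 * c) : k) * τ ^ tauExp a b c) *
          ((AddMonoidAlgebra.single (g (a + b - c)) (Sq k τ (a + b - c)) :
            AddMonoidAlgebra (SteenrodAlg k τ) Γ) * AddMonoidAlgebra.single (g c) (Sq k τ c))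
    rw [AddMonoidAlgebra.single_mul_single, adem a b ha hab,
      ← AddMonoidAlgebra.singleAddHom_apply, map_sum]
    refine Finset.sum_congr rfl fun c hc => ?_
    rw [AddMonoidAlgebra.singleAddHom_apply]
    by_cases hz : (((b - 1 - c).choose (a - 2 * c) : ℕ) : ZMod 2) = 0
    · rw [choose_cast_eq_zero hz]; simp
    · rw [map_mul, map_natCast, map_pow, hτ, AddMonoidAlgebra.single_pow,
        AddMonoidAlgebra.single_mul_single, mul_assoc, AddMonoidAlgebra.single_mul_single,
        hg a b c hab (by simpa [Nat.lt_succ_iff] using hc) hz, mul_smul,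
        Nat.cast_smul_eq_nsmul, Algebra.smul_def (τ ^ _), map_pow, ← nsmul_eq_mul]
      exact map_nsmul (AddMonoidAlgebra.singleAddHom _) _ _
  refine ⟨(steenrodLift (τ := τ) s hs0 hs : SteenrodAlg k τ →ₐ[k] Twist i hi).toRingHom, ?_, ?_⟩
  · exact ((steenrodLift (τ := τ) s hs0 hs).commutes τ).trans hτ
  · exact fun n => steenrodLift_Sq s hs0 hs n

variable {k : Type} [CommRing k] {τ : k} {Γ : Type} [AddCommMonoid Γ]
  {γ : SteenrodAlg k τ →+* AddMonoidAlgebra (SteenrodAlg k τ) Γ} {u : Γ} {g : ℕ → Γ}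

theorem IsCoaction.word (h : IsCoaction γ u g) (j : ℕ) (l : List ℕ) :
    γ (τ ^ j • (l.map (_root_.Sq k τ)).prod) =
      AddMonoidAlgebra.single (j • u + (l.map g).sum) (τ ^ j • (l.map (_root_.Sq k τ)).prod) := by
  have hl : γ (l.map (_root_.Sq k τ)).prod =
      AddMonoidAlgebra.single (l.map g).sum (l.map (_root_.Sq k τ)).prod := by
    induction l with
    | nil => simp [AddMonoidAlgebra.one_def]
    | cons n l ih => simp [h.Sq, ih, AddMonoidAlgebra.single_mul_single]
  rw [Algebra.smul_def, map_mul, map_pow, map_pow, h.tau, hl, AddMonoidAlgebra.single_pow,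
    AddMonoidAlgebra.single_mul_single]

/-- The grading of the Steenrod algebra by the topological degree. -/
theorem exists_degree_coaction (k : Type) [CommRing k] [CharP k 2] (τ : k) :
    ∃ γ : SteenrodAlg k τ →+* AddMonoidAlgebra (SteenrodAlg k τ) ℤ,
      IsCoaction γ 0 fun n => (n : ℤ) := by
  refine exists_coaction (algebraMap k _) (fun c x => Algebra.commutes c x) 0 _ ?_ (by simp) ?_
  · rfl
  · intro a b c h1 h2 _
    simp only [smul_zero, zero_add]
    omega

/-- The grading of the motivic Steenrod algebra by the topological degree and the weight. -/
theorem exists_motivic_coaction :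
    ∃ γ : SteenrodAlg M2 tau →+* AddMonoidAlgebra (SteenrodAlg M2 tau) (ℤ × ℤ),
      IsCoaction γ (0, 1) fun n => ((n : ℤ), (sqWeight n : ℤ)) := by
  let B := AddMonoidAlgebra (SteenrodAlg M2 tau) (ℤ × ℤ)
  let t : B := AddMonoidAlgebra.single (0, 1) (algebraMap M2 _ tau)
  have ht (x : B) : t * x = x * t := by
    induction x using AddMonoidAlgebra.induction_linear with
    | zero => simp
    | add x y hx hy => rw [mul_add, add_mul, hx, hy]
    | single d x =>
      change AddMonoidAlgebra.single (0, 1) (algebraMap M2 (SteenrodAlg M2 tau) tau) *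
        AddMonoidAlgebra.single d x = AddMonoidAlgebra.single d x *
          AddMonoidAlgebra.single (0, 1) (algebraMap M2 (SteenrodAlg M2 tau) tau)
      rw [AddMonoidAlgebra.single_mul_single, AddMonoidAlgebra.single_mul_single, add_comm d,
        Algebra.commutes]
  let i : M2 →+* B := Polynomial.eval₂RingHom' ((algebraMap M2 B).comp Polynomial.C) t
    fun a => Algebra.commutes (Polynomial.C a) t
  have hiX : i tau = t := Polynomial.eval₂_X _ _
  have hiC (c : ZMod 2) : i (Polynomial.C c) = algebraMap M2 B (Polynomial.C c) :=
    Polynomial.eval₂_C _ _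
  refine exists_coaction i (fun c x => ?_) (0, 1) _ hiX (by simp [sqWeight]) ?_
  · induction c using Polynomial.induction_on' with
    | add p q hp hq => rw [map_add, add_mul, mul_add, hp, hq]
    | monomial n a =>
      rw [← Polynomial.C_mul_X_pow_eq_monomial, map_mul, map_pow, hiX, hiC, mul_assoc,
        (Commute.pow_left (ht x) n).eq, ← mul_assoc, Algebra.commutes, mul_assoc]
  · intro a b c h1 h2 h3
    have := tauExp_spec a b c h1 h2 h3
    ext
    · simp; omega
    · simp; exact_mod_cast this

end Coaction

/-! ### The filtration by powers of the augmentation ideal -/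

section Filtration

/-- The additive group generated by the multiples `τ ^ j • g l₁ ⋯ g lᵣ` of words with `Q j l`. -/
def wordSpan {k R ι : Type} [CommRing k] [Ring R] [Algebra k R] (τ : k) (g : ι → R)
    (Q : ℕ → List ι → Prop) : AddSubgroup R :=
  AddSubgroup.closure {x | ∃ j l, Q j l ∧ x = τ ^ j • (l.map g).prod}

theorem mem_wordSpan {k R ι : Type} [CommRing k] [Ring R] [Algebra k R] {τ : k} {g : ι → R}
    {Q : ℕ → List ι → Prop} {j : ℕ} {l : List ι} (h : Q j l) :
    τ ^ j • (l.map g).prod ∈ wordSpan τ g Q :=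
  AddSubgroup.subset_closure ⟨j, l, h, rfl⟩

theorem wordSpan_mono {k R ι : Type} [CommRing k] [Ring R] [Algebra k R] {τ : k} {g : ι → R}
    {Q Q' : ℕ → List ι → Prop} (h : ∀ j l, Q j l → Q' j l) :
    wordSpan τ g Q ≤ wordSpan τ g Q' :=
  AddSubgroup.closure_mono fun _ ⟨j, l, hQ, hx⟩ => ⟨j, l, h j l hQ, hx⟩

theorem mul_mem_wordSpan {k R ι : Type} [CommRing k] [Ring R] [Algebra k R] {τ : k} {g : ι → R}
    {P Q T : ℕ → List ι → Prop} (h : ∀ i j l m, P i l → Q j m → T (i + j) (l ++ m)) {x y : R}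
    (hx : x ∈ wordSpan τ g P) (hy : y ∈ wordSpan τ g Q) : x * y ∈ wordSpan τ g T := by
  induction hx using AddSubgroup.closure_induction with
  | mem x hx =>
    obtain ⟨i, l, hl, rfl⟩ := hx
    induction hy using AddSubgroup.closure_induction with
    | mem y hy =>
      obtain ⟨j, m, hm, rfl⟩ := hy
      have := mem_wordSpan (τ := τ) (g := g) (h i j l m hl hm)
      rwa [smul_mul_smul_comm, ← pow_add, ← List.prod_append, ← List.map_append]
    | zero => rw [mul_zero]; exact zero_mem _
    | add y z _ _ h1 h2 => rw [mul_add]; exact add_mem h1 h2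
    | neg y _ h => rw [mul_neg]; exact neg_mem h
  | zero => rw [zero_mul]; exact zero_mem _
  | add x z _ _ h1 h2 => rw [add_mul]; exact add_mem h1 h2
  | neg x _ h => rw [neg_mul]; exact neg_mem h

/-- An additive subgroup stable under multiplication on both sides, as a two-sided ideal. -/
theorem exists_twoSidedIdeal {R : Type} [Ring R] (W : AddSubgroup R)
    (hl : ∀ x y, y ∈ W → x * y ∈ W) (hr : ∀ x y, x ∈ W → x * y ∈ W) :
    ∃ K : TwoSidedIdeal R, ∀ x, x ∈ K ↔ x ∈ W :=
  ⟨TwoSidedIdeal.mk' (W : Set R) W.zero_mem W.add_mem W.neg_mem (hl _ _) (hr _ _),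
    TwoSidedIdeal.mem_mk' _ _ _ _ _ _⟩

variable {k : Type} [CommRing k] {τ : k}

/-- If `k` is additively generated by the powers of `τ`, then `I ^ n` is additively generated by
the multiples by powers of `τ` of the words of length at least `n` in the generators. -/
theorem A2_pow_le_wordSpan (hk : AddSubgroup.closure (Set.range fun j : ℕ => τ ^ j) = ⊤)
    {n : ℕ} {x : A2 k τ} (hx : x ∈ A2ideal k τ ^ n) :
    x ∈ wordSpan τ (A2gen k τ) fun _ l => n ≤ l.length := by
  have mul {m n : ℕ} {x y : A2 k τ} (hx : x ∈ wordSpan τ (A2gen k τ) fun _ l => m ≤ l.length)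
      (hy : y ∈ wordSpan τ (A2gen k τ) fun _ l => n ≤ l.length) :
      x * y ∈ wordSpan τ (A2gen k τ) fun _ l => m + n ≤ l.length :=
    mul_mem_wordSpan (fun i j l m hl hm => by rw [List.length_append]; omega) hx hy
  have h0 (x : A2 k τ) : x ∈ wordSpan τ (A2gen k τ) fun _ l => 0 ≤ l.length := by
    obtain ⟨x, hx⟩ := x
    induction hx using Algebra.adjoin_induction with
    | mem x hx =>
      have hg (i : Fin 3) : A2gen k τ i ∈ wordSpan τ (A2gen k τ) fun _ l => 0 ≤ l.length := by
        have := mem_wordSpan (τ := τ) (g := A2gen k τ) (Q := fun _ l => 0 ≤ l.length)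
          (j := 0) (l := [i]) (Nat.zero_le _)
        simpa using this
      obtain rfl | rfl | rfl := hx
      · exact hg 0
      · exact hg 1
      · exact hg 2
    | algebraMap r =>
      change algebraMap k (A2 k τ) r ∈ _
      have hr : r ∈ AddSubgroup.closure (Set.range fun j : ℕ => τ ^ j) := hk ▸ AddSubgroup.mem_top r
      induction hr using AddSubgroup.closure_induction with
      | mem r hr =>
        obtain ⟨j, rfl⟩ := hr
        have := mem_wordSpan (τ := τ) (g := A2gen k τ) (Q := fun _ l => 0 ≤ l.length)
          (j := j) (l := []) (Nat.zero_le _)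
        rwa [List.map_nil, List.prod_nil, ← Algebra.algebraMap_eq_smul_one] at this
      | zero => rw [map_zero]; exact zero_mem _
      | add _ _ _ _ h1 h2 => rw [map_add]; exact add_mem h1 h2
      | neg _ _ h => rw [map_neg]; exact neg_mem h
    | add x y hx hy h1 h2 => exact add_mem h1 h2
    | mul x y hx hy h1 h2 => exact wordSpan_mono (fun _ _ _ => Nat.zero_le _) (mul h1 h2)
  have h1 {x : A2 k τ} (hx : x ∈ A2ideal k τ) :
      x ∈ wordSpan τ (A2gen k τ) fun _ l => 1 ≤ l.length := by
    obtain ⟨K, hK⟩ := exists_twoSidedIdeal (wordSpan τ (A2gen k τ) fun _ l => 1 ≤ l.length)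
      (fun x y hy => wordSpan_mono (fun _ _ h => by omega) (mul (h0 x) hy))
      (fun x y hx => wordSpan_mono (fun _ _ h => by omega) (mul hx (h0 y)))
    refine (hK x).1 (TwoSidedIdeal.mem_span_iff.1
      (show x ∈ TwoSidedIdeal.span (Set.range (A2gen k τ)) from hx) K ?_)
    rintro _ ⟨i, rfl⟩
    refine (hK _).2 ?_
    have := mem_wordSpan (τ := τ) (g := A2gen k τ) (Q := fun _ l => 1 ≤ l.length)
      (j := 0) (l := [i]) le_rfl
    simpa using this
  induction n generalizing x with
  | zero => exact h0 x
  | succ n ih =>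
    rw [Submodule.pow_succ] at hx
    induction hx using Submodule.mul_induction_on' with
    | mem_mul_mem x hx y hy => exact mul (ih hx) (h1 hy)
    | add x _ y _ hx hy => exact add_mem hx hy

theorem A2_word_mem (l : List (Fin 3)) : (l.map (A2gen k τ)).prod ∈ A2ideal k τ ^ l.length :=
  (Lifts.word (lifts_grGen k τ) l).1

variable [CharP k 2]

/-- The class of a combination of words of length at least `n` is the combination of the
Poincaré–Birkhoff–Witt monomials that occur in the words of length `n`. -/
theorem lifts_of_mem_wordSpan {n : ℕ} {Q : ℕ → List (Fin 3) → Prop} {x : A2 k τ}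
    (hx : x ∈ wordSpan τ (A2gen k τ) fun j l => Q j l ∧ n ≤ l.length) :
    ∃ u, Lifts k (A2ideal k τ) n x u ∧ u ∈ AddSubgroup.closure
      {y | ∃ j l S, Q j l ∧ l.length = n ∧ S ∈ mayMulWord l mayBot ∧
        y = τ ^ j • mayMono (grGen k τ) S} := by
  induction hx using AddSubgroup.closure_induction with
  | mem x hx =>
    obtain ⟨j, l, ⟨hQ, hl⟩, rfl⟩ := hx
    obtain hl | hl := hl.eq_or_lt
    · refine ⟨τ ^ j • (l.map (grGen k τ)).prod, ?_, ?_⟩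
      · rw [hl]; exact (Lifts.word (lifts_grGen k τ) l).smul _
      · rw [word_eq_sum_mayMono mayRelations_gr, List.smul_sum]
        refine AddSubgroup.list_sum_mem _ fun y hy => ?_
        simp only [List.mem_map, exists_exists_and_eq_and] at hy
        obtain ⟨S, hS, rfl⟩ := hy
        exact AddSubgroup.subset_closure ⟨j, l, S, hQ, hl.symm, hS, rfl⟩
    · have h : τ ^ j • (l.map (A2gen k τ)).prod ∈ A2ideal k τ ^ (n + 1) :=
        A2_smul_mem _ (A2_pow_le hl (A2_word_mem l))
      have h' : Lifts k (A2ideal k τ) n (τ ^ j • (l.map (A2gen k τ)).prod)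
        (grClass k _ n _ (A2_pow_le (Nat.le_succ n) h)) := ⟨_, rfl⟩
      exact ⟨0, h'.eq_zero_iff.2 h ▸ h', zero_mem _⟩
  | zero => exact ⟨0, Lifts.zero n, zero_mem _⟩
  | add x y _ _ hx hy =>
    obtain ⟨u, hu, hu'⟩ := hx
    obtain ⟨v, hv, hv'⟩ := hy
    exact ⟨u + v, hu.add hv, add_mem hu' hv'⟩
  | neg x _ hx =>
    obtain ⟨u, hu, hu'⟩ := hx
    refine ⟨-u, ?_, neg_mem hu'⟩
    simpa using hu.smul (-1)

/-- Every class in `I ^ n / I ^ (n + 1)` is a combination of monomials with `n` letters. -/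
theorem lifts_of_mem_pow (hk : AddSubgroup.closure (Set.range fun j : ℕ => τ ^ j) = ⊤)
    {n : ℕ} {x : A2 k τ} (hx : x ∈ A2ideal k τ ^ n) :
    ∃ u, Lifts k (A2ideal k τ) n x u ∧ u ∈ AddSubgroup.closure
      {y | ∃ j l S, True ∧ l.length = n ∧ S ∈ mayMulWord l mayBot ∧
        y = τ ^ j • mayMono (grGen k τ) S} :=
  lifts_of_mem_wordSpan (wordSpan_mono (fun _ _ h => ⟨trivial, h⟩) (A2_pow_le_wordSpan hk hx))

theorem span_mayMono_gr (hk : AddSubgroup.closure (Set.range fun j : ℕ => τ ^ j) = ⊤) :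
    Submodule.span k (Set.range (mayMono (grGen k τ))) = ⊤ := by
  rw [eq_top_iff]
  rintro u -
  induction u using DirectSum.induction_on with
  | zero => exact zero_mem _
  | add u v hu hv => exact add_mem hu hv
  | of n u =>
    obtain ⟨⟨x, hx⟩, rfl⟩ := grMk_surjective k n u
    obtain ⟨v, ⟨hx', rfl⟩, hv⟩ := lifts_of_mem_pow hk hx
    refine (AddSubgroup.closure_le (K := (Submodule.span k
      (Set.range (mayMono (grGen k τ)))).toAddSubgroup)).2 ?_ hv
    rintro _ ⟨j, l, S, -, -, -, rfl⟩
    exact Submodule.smul_mem _ _ (Submodule.subset_span ⟨S, rfl⟩)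

theorem mayDeg_one_le (S : MayIdx) : mayDeg (fun _ => (1 : ℕ)) S ≤ 10 := by
  revert S
  decide +kernel

theorem mayDeg_length {l : List (Fin 3)} {S : MayIdx} (hS : S ∈ mayMulWord l mayBot) :
    mayDeg (fun _ => (1 : ℕ)) S = l.length := by
  rw [mayDeg_mulWord _ hS]
  simp

/-- The homogeneous component of degree `d` of an element of the Steenrod algebra. -/
def homComponent {Γ : Type} [AddCommMonoid Γ]
    (γ : SteenrodAlg k τ →+* AddMonoidAlgebra (SteenrodAlg k τ) Γ) (d : Γ) :
    SteenrodAlg k τ →+ SteenrodAlg k τ where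
  toFun x := (γ x).coeff d
  map_zero' := by simp
  map_add' x y := by simp

theorem homComponent_word {Γ : Type} [AddCommMonoid Γ] [DecidableEq Γ]
    {γ : SteenrodAlg k τ →+* AddMonoidAlgebra (SteenrodAlg k τ) Γ} {u : Γ} {g : ℕ → Γ}
    (hγ : IsCoaction γ u g) (d : Γ) (j : ℕ) (l : List (Fin 3)) :
    homComponent γ d (A2val k τ (τ ^ j • (l.map (A2gen k τ)).prod)) =
      if j • u + (l.map fun i : Fin 3 => g (2 ^ (i : ℕ))).sum = d
        then A2val k τ (τ ^ j • (l.map (A2gen k τ)).prod) else 0 := by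
  have h : A2val k τ (τ ^ j • (l.map (A2gen k τ)).prod) =
      τ ^ j • ((l.map fun i : Fin 3 => 2 ^ (i : ℕ)).map (Sq k τ)).prod := by
    rw [map_smul, map_list_prod, List.map_map, List.map_map]
    rfl
  change (γ _).coeff d = _
  rw [h, hγ.word, AddMonoidAlgebra.coeff_single, Finsupp.single_apply, List.map_map]
  rfl

/-- An element of `I ^ n` that is homogeneous of degree `d` is a combination of words of length
at least `n` and of degree `d`. -/
theorem mem_wordSpan_of_homogeneous {Γ : Type} [AddCommMonoid Γ]
    {γ : SteenrodAlg k τ →+* AddMonoidAlgebra (SteenrodAlg k τ) Γ} {u : Γ} {g : ℕ → Γ}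
    (hγ : IsCoaction γ u g) {d : Γ} {n : ℕ} {x : A2 k τ}
    (hx : x ∈ wordSpan τ (A2gen k τ) fun _ l => n ≤ l.length)
    (hd : homComponent γ d (A2val k τ x) = A2val k τ x) :
    x ∈ wordSpan τ (A2gen k τ) fun j l =>
      j • u + (l.map fun i : Fin 3 => g (2 ^ (i : ℕ))).sum = d ∧ n ≤ l.length := by
  classical
  set W := wordSpan τ (A2gen k τ) fun j l =>
      j • u + (l.map fun i : Fin 3 => g (2 ^ (i : ℕ))).sum = d ∧ n ≤ l.length
  have h : homComponent γ d (A2val k τ x) ∈ W.map (A2val k τ).toRingHom.toAddMonoidHom := by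
    clear hd
    induction hx using AddSubgroup.closure_induction with
    | mem x hx =>
      obtain ⟨j, l, hl, rfl⟩ := hx
      rw [homComponent_word hγ]
      split_ifs with hjl
      · exact ⟨_, mem_wordSpan ⟨hjl, hl⟩, rfl⟩
      · exact zero_mem _
    | zero => rw [map_zero, map_zero]; exact zero_mem _
    | add x y _ _ hx hy => rw [map_add, map_add]; exact add_mem hx hy
    | neg x _ hx => rw [map_neg, map_neg]; exact neg_mem hx
  rw [hd] at h
  obtain ⟨y, hy, hxy⟩ := h
  obtain rfl : y = x := A2val_injective k τ hxy
  exact hy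

/-- The augmentation ideal is nilpotent: no Poincaré–Birkhoff–Witt monomial has more than ten
letters, hence the powers of the ideal are constant from the eleventh on, and elements of `I ^ n`
have components in degrees `≥ n` only. -/
theorem A2_pow_eleven (hk : AddSubgroup.closure (Set.range fun j : ℕ => τ ^ j) = ⊤)
    {x : A2 k τ} (hx : x ∈ A2ideal k τ ^ 11) : x = 0 := by
  have hN (N : ℕ) : x ∈ A2ideal k τ ^ (11 + N) := by
    induction N with
    | zero => exact hx
    | succ N ih =>
      obtain ⟨u, hu, hu'⟩ := lifts_of_mem_pow hk ih
      refine hu.eq_zero_iff.1 ?_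
      have : {y | ∃ j l S, True ∧ l.length = 11 + N ∧ S ∈ mayMulWord l mayBot ∧
          y = τ ^ j • mayMono (grGen k τ) S} = ∅ := by
        refine Set.eq_empty_of_forall_notMem ?_
        rintro _ ⟨j, l, S, -, hl, hS, -⟩
        have h1 := mayDeg_one_le S
        rw [mayDeg_length hS] at h1
        omega
      rw [this, AddSubgroup.closure_empty] at hu'
      exact hu'
  obtain ⟨γ, hγ⟩ := exists_degree_coaction k τ
  have hsum (y : A2 k τ) (hy : y ∈ wordSpan τ (A2gen k τ) fun _ l => 0 ≤ l.length) :
      Finsupp.liftAddHom (fun _ : ℤ => AddMonoidHom.id (SteenrodAlg k τ))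
        (γ (A2val k τ y)).coeff = A2val k τ y := by
    induction hy using AddSubgroup.closure_induction with
    | mem y hy =>
      obtain ⟨j, l, -, rfl⟩ := hy
      rw [map_smul, map_list_prod, List.map_map, show (A2val k τ ∘ A2gen k τ) =
        Sq k τ ∘ fun i : Fin 3 => 2 ^ (i : ℕ) from rfl, ← List.map_map, hγ.word,
        AddMonoidAlgebra.coeff_single, Finsupp.liftAddHom_apply_single]
      rfl
    | zero => simp
    | add y z _ _ hy hz =>
      rw [map_add, map_add, AddMonoidAlgebra.coeff_add, map_add, hy, hz]
    | neg y _ hy => rw [map_neg, map_neg, AddMonoidAlgebra.coeff_neg, map_neg, hy]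
  have hlow (n : ℕ) (y : A2 k τ) (hy : y ∈ wordSpan τ (A2gen k τ) fun _ l => n ≤ l.length)
      (d : ℤ) (hd : d < n) : homComponent γ d (A2val k τ y) = 0 := by
    induction hy using AddSubgroup.closure_induction with
    | mem y hy =>
      obtain ⟨j, l, hl, rfl⟩ := hy
      rw [homComponent_word hγ, if_neg]
      rw [smul_zero, zero_add]
      have : (l.length : ℤ) ≤ (l.map fun i : Fin 3 => ((2 ^ (i : ℕ) : ℕ) : ℤ)).sum := by
        clear hl
        induction l with
        | nil => simp
        | cons i l ih =>
          have : (1 : ℤ) ≤ ((2 ^ (i : ℕ) : ℕ) : ℤ) := by exact_mod_cast Nat.one_le_two_pow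
          simp only [List.length_cons, List.map_cons, List.sum_cons]
          push_cast at *
          omega
      omega
    | zero => rw [map_zero, map_zero]
    | add y z _ _ hy hz => rw [map_add, map_add, hy, hz, add_zero]
    | neg y _ hy => rw [map_neg, map_neg, hy, neg_zero]
  refine A2val_injective k τ ?_
  rw [map_zero, ← hsum x (A2_pow_le_wordSpan hk (A2_pow_le (Nat.zero_le _) hx))]
  have hz : (γ (A2val k τ x)).coeff = 0 := by
    ext d
    -- the degree `d` is below the lower bound for elements of `I ^ (d + 1)`
    exact hlow (d.toNat + 1) x (A2_pow_le_wordSpan hk (A2_pow_le (by omega) (hN (d.toNat + 1))))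
      d (by omega)
  rw [hz, map_zero]

/-- The Poincaré–Birkhoff–Witt monomials in the generators of `A(2)` lift those of `Gr A(2)`. -/
theorem lifts_mayMono (S : MayIdx) : Lifts k (A2ideal k τ) (mayDeg (fun _ => (1 : ℕ)) S)
    (mayMono (A2gen k τ) S) (mayMono (grGen k τ) S) := by
  have h (P : List (List (Fin 3))) (n : ℕ) (hP : ∀ l ∈ P, l.length = n) :
      Lifts k (A2ideal k τ) n (evalWords (A2gen k τ) P) (evalWords (grGen k τ) P) := by
    induction P with
    | nil => exact Lifts.zero n
    | cons l P ih =>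
      rw [evalWords_cons, evalWords_cons]
      refine Lifts.add ?_ (ih fun l hl => hP l (List.mem_cons_of_mem _ hl))
      rw [← hP l List.mem_cons_self]
      exact Lifts.word (lifts_grGen k τ) l
  refine h _ _ fun l hl => ?_
  rw [← mayDeg_words (fun _ => (1 : ℕ)) hl]
  simp

/-- `Gr A(2)` is free on the Poincaré–Birkhoff–Witt monomials if no multiple of the top monomial
vanishes in `A(2)`. -/
def grBasis (hk : AddSubgroup.closure (Set.range fun j : ℕ => τ ^ j) = ⊤)
    (htop : ∀ c : k, c • mayMono (A2gen k τ) mayTop = 0 → c = 0) :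
    Module.Basis MayIdx k (GrA2 k τ) :=
  Module.Basis.mk (linearIndependent_mayMono mayRelations_gr fun c hc =>
      htop c (A2_pow_eleven hk (((lifts_mayMono mayTop).smul c).eq_zero_iff.1 hc)))
    (span_mayMono_gr hk).ge

theorem grBasis_apply (hk : AddSubgroup.closure (Set.range fun j : ℕ => τ ^ j) = ⊤)
    (htop : ∀ c : k, c • mayMono (A2gen k τ) mayTop = 0 → c = 0) (S : MayIdx) :
    grBasis hk htop S = mayMono (grGen k τ) S := by
  rw [grBasis, Module.Basis.mk_apply]

end Filtration

/-! ### Total squares and the Bullett–Macdonald identity -/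

section BullettMacdonald

variable {R : Type} [CommRing R] (P : R →+* R[X])

/-- The total square `P` with its parameter specialised to `u T`. -/
def scaledSq (u : R[X]) : R →+* R[X][X] :=
  (Polynomial.eval₂RingHom (Polynomial.C.comp Polynomial.C)
    (Polynomial.C u * Polynomial.X)).comp P

/-- The composite of the total squares with parameters `u T` and `u' T`. -/
def scaledSqComp (u u' : R[X]) : R →+* R[X][X] :=
  (Polynomial.eval₂RingHom (scaledSq P u) (Polynomial.C u' * Polynomial.X)).comp P

theorem coeff_scaledSq (u : R[X]) (v : R) (n : ℕ) :
    (scaledSq P u v).coeff n = Polynomial.C ((P v).coeff n) * u ^ n := by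
  have h (p : R[X]) : (Polynomial.eval₂ (Polynomial.C.comp Polynomial.C)
      (Polynomial.C u * Polynomial.X) p).coeff n = Polynomial.C (p.coeff n) * u ^ n := by
    induction p using Polynomial.induction_on' with
    | add p q hp hq => simp [Polynomial.eval₂_add, hp, hq, add_mul]
    | monomial m a =>
      rw [Polynomial.eval₂_monomial, mul_pow (Polynomial.C u), ← mul_assoc, ← map_pow,
        RingHom.comp_apply, ← map_mul, Polynomial.coeff_C_mul_X_pow, Polynomial.coeff_monomial]
      by_cases hmn : n = m
      · subst hmn; simp
      · simp [hmn, Ne.symm hmn]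
  exact h _

theorem coeff_scaledSqComp (u u' : R[X]) (v : R) (n : ℕ) :
    (scaledSqComp P u u' v).coeff n = ∑ p ∈ Finset.HasAntidiagonal.antidiagonal n,
      Polynomial.C ((P ((P v).coeff p.2)).coeff p.1) * (u ^ p.1 * u' ^ p.2) := by
  have h (p : R[X]) : (Polynomial.eval₂ (scaledSq P u)
      (Polynomial.C u' * Polynomial.X) p).coeff n =
        ∑ q ∈ Finset.HasAntidiagonal.antidiagonal n,
          Polynomial.C ((P (p.coeff q.2)).coeff q.1) * (u ^ q.1 * u' ^ q.2) := by
    induction p using Polynomial.induction_on' with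
    | add p q hp hq => simp [Polynomial.eval₂_add, hp, hq, add_mul, Finset.sum_add_distrib]
    | monomial m a =>
      rw [Polynomial.eval₂_monomial, mul_pow (Polynomial.C u'), ← map_pow, Polynomial.coeff_mul]
      refine Finset.sum_congr rfl fun q _ => ?_
      rw [coeff_scaledSq, Polynomial.coeff_C_mul_X_pow, Polynomial.coeff_monomial]
      by_cases hm : q.2 = m
      · subst hm; simp [mul_assoc]
      · simp [hm, Ne.symm hm]
  exact h _

/-- The Bullett–Macdonald identity on an element `y` with `P y = y + t x²`, `P x = x + t z²`. -/
theorem bullett_macdonald (h2 : (1 + 1 : R) = 0) {x y z : R}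
    (hx : P x = Polynomial.C x + Polynomial.X * Polynomial.C (z ^ 2))
    (hy : P y = Polynomial.C y + Polynomial.X * Polynomial.C (x ^ 2)) :
    scaledSqComp P (Polynomial.X ^ 2 + Polynomial.X) 1 y =
      scaledSqComp P (1 + Polynomial.X) (Polynomial.X ^ 2) y := by
  have h2' : (1 + 1 : R[X][X]) = 0 := by
    have h := congrArg (fun r : R => Polynomial.C (Polynomial.C r)) h2
    simpa using h
  have key (S : Type) [CommRing S] (f : R →+* S) (w : S) (a b : R) :
      Polynomial.eval₂RingHom f w (Polynomial.C a + Polynomial.X * Polynomial.C (b ^ 2)) =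
        f a + w * f b ^ 2 := by simp [Polynomial.eval₂_pow]
  simp only [scaledSqComp, scaledSq, RingHom.comp_apply, hx, hy, key]
  simp only [map_add, map_pow, map_one]
  linear_combination (((Polynomial.C Polynomial.X ^ 2 + Polynomial.C Polynomial.X) -
      Polynomial.C Polynomial.X ^ 2 * (1 + Polynomial.C Polynomial.X)) * Polynomial.X ^ 2 *
    Polynomial.C (Polynomial.C x) * Polynomial.C (Polynomial.C z) ^ 2) * h2'

/-- The coefficient of `s ^ a` in `f (s) / (1 + s) ^ (a + 1)`, that is, the residue at zero of
`f (s) ds / (s + s²) ^ (a + 1)`. -/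
def residue (a : ℕ) (f : R[X]) : R :=
  PowerSeries.coeff a ((f : PowerSeries R) * (PowerSeries.mk 1) ^ (a + 1))

theorem residue_sum {ι : Type} (a : ℕ) (s : Finset ι) (f : ι → R[X]) :
    residue a (∑ i ∈ s, f i) = ∑ i ∈ s, residue a (f i) := by
  simp only [residue]
  rw [← Polynomial.coeToPowerSeries.ringHom_apply, map_sum, Finset.sum_mul, map_sum]
  rfl

theorem one_add_X_mul_mk_one (h2 : (1 + 1 : R) = 0) :
    (1 + PowerSeries.X : PowerSeries R) * PowerSeries.mk 1 = 1 := by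
  have h := PowerSeries.mk_one_mul_one_sub_eq_one R
  have h2 : (1 + 1 : PowerSeries R) = 0 := by
    have h' := congrArg (PowerSeries.C (R := R)) h2
    rwa [map_add, map_one, map_zero] at h'
  linear_combination h + PowerSeries.X * PowerSeries.mk 1 * h2

theorem one_add_X_pow_mul_mk_one_pow (h2 : (1 + 1 : R) = 0) {i n : ℕ} (h : i ≤ n) :
    (1 + PowerSeries.X : PowerSeries R) ^ i * PowerSeries.mk 1 ^ n =
      PowerSeries.mk 1 ^ (n - i) := by
  obtain ⟨m, rfl⟩ := Nat.exists_eq_add_of_le h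
  rw [pow_add, ← mul_assoc, ← mul_pow, one_add_X_mul_mk_one h2, one_pow, one_mul,
    Nat.add_sub_cancel_left]

theorem residue_left (h2 : (1 + 1 : R) = 0) (a i : ℕ) (w : R) :
    residue a (Polynomial.C w * (Polynomial.X ^ 2 + Polynomial.X) ^ i) =
      if i = a then w else 0 := by
  have e : ((Polynomial.C w * (Polynomial.X ^ 2 + Polynomial.X) ^ i : R[X]) :
      PowerSeries R) = PowerSeries.C w * (PowerSeries.X ^ i * (1 + PowerSeries.X) ^ i) := by
    rw [← mul_pow]
    simp only [Polynomial.coe_mul, Polynomial.coe_C, Polynomial.coe_pow, Polynomial.coe_add,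
      Polynomial.coe_X]
    ring
  rw [residue, e, mul_assoc, mul_assoc, PowerSeries.coeff_C_mul, PowerSeries.coeff_X_pow_mul']
  split_ifs with h1 h3 h3
  · subst h3
    rw [one_add_X_pow_mul_mk_one_pow h2 (Nat.le_succ i)]
    simp
  · rw [one_add_X_pow_mul_mk_one_pow h2 (by omega), show a + 1 - i = (a - i) + 1 by omega,
      PowerSeries.mk_one_pow_eq_mk_choose_add, PowerSeries.coeff_mk, ← two_mul,
      ← Nat.centralBinom_eq_two_mul_choose]
    -- central binomial coefficients are even
    obtain ⟨q, hq⟩ := Nat.two_dvd_centralBinom_of_one_le (n := a - i) (by omega)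
    rw [hq, Nat.cast_mul, Nat.cast_two, ← one_add_one_eq_two, h2, zero_mul, mul_zero]
  · omega
  · simp

theorem residue_right (h2 : (1 + 1 : R) = 0) (a b c : ℕ) (hab : a < 2 * b) (w : R) :
    residue a (Polynomial.C w * ((1 + Polynomial.X) ^ (a + b - c) * (Polynomial.X ^ 2) ^ c)) =
      if c ≤ a / 2 then ((b - 1 - c).choose (a - 2 * c) : R) * w else 0 := by
  have e : ((Polynomial.C w * ((1 + Polynomial.X) ^ (a + b - c) * (Polynomial.X ^ 2) ^ c) :
      R[X]) : PowerSeries R) =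
        PowerSeries.C w * (PowerSeries.X ^ (2 * c) * (1 + PowerSeries.X) ^ (a + b - c)) := by
    rw [pow_mul, mul_comm ((1 + Polynomial.X : R[X]) ^ _)]; simp
  rw [residue, e, mul_assoc, mul_assoc, PowerSeries.coeff_C_mul, PowerSeries.coeff_X_pow_mul']
  split_ifs with h1 h3 h3
  · rw [show a + b - c = (b - 1 - c) + (a + 1) by omega, pow_add, mul_assoc,
      one_add_X_pow_mul_mk_one_pow h2 le_rfl, Nat.sub_self, pow_zero, mul_one, mul_comm]
    congr 1
    have := Polynomial.coeff_one_add_X_pow R (b - 1 - c) (a - 2 * c)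
    rw [← this, ← Polynomial.coeff_coe]
    simp
  · omega
  · omega
  · simp

/-- The coefficients of a total square that satisfies the Bullett–Macdonald identity satisfy the
Adem relations: take residues. -/
theorem adem_of_bullett_macdonald (h2 : (1 + 1 : R) = 0) {v : R}
    (hv : scaledSqComp P (Polynomial.X ^ 2 + Polynomial.X) 1 v =
      scaledSqComp P (1 + Polynomial.X) (Polynomial.X ^ 2) v) (a b : ℕ) (hab : a < 2 * b) :
    (P ((P v).coeff b)).coeff a = ∑ c ∈ Finset.range (a / 2 + 1),
      ((b - 1 - c).choose (a - 2 * c) : R) * (P ((P v).coeff c)).coeff (a + b - c) := by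
  have h := congrArg (fun f : R[X][X] => residue a (f.coeff (a + b))) hv
  simp only [coeff_scaledSqComp, residue_sum, one_pow, mul_one, residue_left h2] at h
  rw [Finset.sum_eq_single (a, b)] at h
  · rw [if_pos rfl] at h
    rw [h, Finset.Nat.sum_antidiagonal_eq_sum_range_succ_mk, ← Finset.sum_range_reflect]
    have hc (c : ℕ) (hc : c ∈ Finset.range (a + b).succ) :
        residue a (Polynomial.C ((P ((P v).coeff (a + b - ((a + b).succ - 1 - c)))).coeff
          ((a + b).succ - 1 - c)) *
            ((1 + Polynomial.X) ^ ((a + b).succ - 1 - c) *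
              (Polynomial.X ^ 2) ^ (a + b - ((a + b).succ - 1 - c)))) =
        if c ≤ a / 2 then
          ((b - 1 - c).choose (a - 2 * c) : R) * (P ((P v).coeff c)).coeff (a + b - c) else 0 := by
      have := Finset.mem_range.1 hc
      rw [show (a + b).succ - 1 - c = a + b - c by omega,
        show a + b - (a + b - c) = c by omega, residue_right h2 a b c hab]
    rw [Finset.sum_congr rfl hc, ← Finset.sum_filter]
    refine Finset.sum_congr ?_ fun _ _ => rfl
    ext c
    simp only [Finset.mem_filter, Finset.mem_range]
    omega
  · intro p hp hne
    rw [if_neg]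
    intro h1
    have := Finset.HasAntidiagonal.mem_antidiagonal.1 hp
    exact hne (Prod.ext h1 (by simp; omega))
  · intro h0
    exact absurd ((Finset.HasAntidiagonal.mem_antidiagonal (n := a + b) (a := (a, b))).2 rfl) h0

end BullettMacdonald

/-! ### The action of the classical Steenrod algebra on a polynomial ring -/

section XiRing

/-- The polynomial ring `𝔽₂[ξ₁, ξ₂, ξ₃]`, a subcomodule algebra of the dual Steenrod algebra. -/
abbrev XiRing : Type := MvPolynomial (Fin 3) (ZMod 2)

/-- The generators `ξ₁`, `ξ₂`, `ξ₃`, as `i = 0, 1, 2`. -/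
abbrev xi (i : Fin 3) : XiRing := MvPolynomial.X i

theorem xi_one_add_one : (1 + 1 : XiRing) = 0 := by
  rw [one_add_one_eq_two]; exact CharTwo.two_eq_zero

/-- The total Steenrod square `∑ Sq^n t ^ n`: it is the ring homomorphism with
`ξ₁ ↦ ξ₁ + t`, `ξ₂ ↦ ξ₂ + t ξ₁²`, `ξ₃ ↦ ξ₃ + t ξ₂²`. -/
def totalSq : XiRing →+* XiRing[X] :=
  MvPolynomial.eval₂Hom (Polynomial.C.comp MvPolynomial.C) fun i =>
    Polynomial.C (xi i) + Polynomial.X * Polynomial.C ((![1, xi 0, xi 1] i) ^ 2)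

theorem totalSq_C (r : ZMod 2) :
    totalSq (MvPolynomial.C r) = Polynomial.C (MvPolynomial.C r) := by
  simp [totalSq]

theorem totalSq_xi (i : Fin 3) : totalSq (xi i) =
    Polynomial.C (xi i) + Polynomial.X * Polynomial.C ((![1, xi 0, xi 1] i) ^ 2) := by
  simp [totalSq]

/-- The operation `Sq^n`. -/
def sqOp (n : ℕ) : XiRing →ₗ[ZMod 2] XiRing where
  toFun v := (totalSq v).coeff n
  map_add' v w := by simp
  map_smul' r v := by
    rw [MvPolynomial.smul_eq_C_mul, map_mul, totalSq_C, Polynomial.coeff_C_mul,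
      MvPolynomial.smul_eq_C_mul]
    rfl

theorem sqOp_apply (n : ℕ) (v : XiRing) : sqOp n v = (totalSq v).coeff n := rfl

theorem sqOp_mul (n : ℕ) (v w : XiRing) :
    sqOp n (v * w) =
      ∑ p ∈ Finset.HasAntidiagonal.antidiagonal n, sqOp p.1 v * sqOp p.2 w := by
  simp only [sqOp_apply, map_mul, Polynomial.coeff_mul]

theorem sqOp_zero (v : XiRing) : sqOp 0 v = v := by
  have h : (Polynomial.evalRingHom 0).comp totalSq = RingHom.id XiRing := by
    refine MvPolynomial.ringHom_ext (fun r => ?_) fun i => ?_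
    · simp [totalSq_C]
    · rw [RingHom.comp_apply, totalSq_xi]; simp
  rw [sqOp_apply, Polynomial.coeff_zero_eq_eval_zero]
  exact RingHom.congr_fun h v

/-- The Bullett–Macdonald identity for the total square; both sides are ring homomorphisms, so
that it suffices to compare them on the variables. -/
theorem totalSq_bullett_macdonald :
    scaledSqComp totalSq (Polynomial.X ^ 2 + Polynomial.X) 1 =
      scaledSqComp totalSq (1 + Polynomial.X) (Polynomial.X ^ 2) := by
  refine MvPolynomial.ringHom_ext (fun r => ?_) fun i => ?_
  · exact RingHom.congr_fun (Subsingleton.elim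
      ((scaledSqComp totalSq (Polynomial.X ^ 2 + Polynomial.X) 1).comp MvPolynomial.C)
      ((scaledSqComp totalSq (1 + Polynomial.X) (Polynomial.X ^ 2)).comp MvPolynomial.C)) r
  · match i with
    | 0 => exact bullett_macdonald _ xi_one_add_one (z := 0) (by simp) (totalSq_xi 0)
    | 1 => exact bullett_macdonald _ xi_one_add_one (totalSq_xi 0) (totalSq_xi 1)
    | 2 => exact bullett_macdonald _ xi_one_add_one (totalSq_xi 1) (totalSq_xi 2)

/-- The action of the classical Steenrod algebra on `𝔽₂[ξ₁, ξ₂, ξ₃]`. -/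
def xiAction : SteenrodAlg (ZMod 2) 1 →ₐ[ZMod 2] Module.End (ZMod 2) XiRing :=
  steenrodLift sqOp (LinearMap.ext sqOp_zero) fun a b _ hab => LinearMap.ext fun v => by
    rw [LinearMap.sum_apply]
    refine (adem_of_bullett_macdonald totalSq xi_one_add_one
      (RingHom.congr_fun totalSq_bullett_macdonald v) a b hab).trans
        (Finset.sum_congr rfl fun c _ => ?_)
    rw [one_pow, mul_one, LinearMap.smul_apply, Nat.cast_smul_eq_nsmul, nsmul_eq_mul]
    rfl

theorem xiAction_Sq (n : ℕ) (v : XiRing) : xiAction (Sq (ZMod 2) 1 n) v = sqOp n v :=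
  LinearMap.congr_fun (steenrodLift_Sq _ _ _ n) v

end XiRing

/-! ### The top monomial does not vanish -/

section Top

theorem sqOp_xi_eq_zero (n : ℕ) (i : Fin 3) : sqOp (n + 2) (xi i) = 0 := by
  rw [sqOp_apply, totalSq_xi]
  rw [Polynomial.coeff_add, Polynomial.coeff_X_mul, Polynomial.coeff_C_succ,
    Polynomial.coeff_C_succ, add_zero]

theorem sqOp_one_xi (i : Fin 3) : sqOp 1 (xi i) = (![1, xi 0, xi 1] i) ^ 2 := by
  rw [sqOp_apply, totalSq_xi]
  rw [Polynomial.coeff_add, Polynomial.coeff_X_mul, Polynomial.coeff_C_succ,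
    Polynomial.coeff_C_zero, zero_add]

theorem xi_add_self (v : XiRing) : v + v = 0 := CharTwo.add_self_eq_zero v

/-- The Cartan formula on squares. -/
theorem sqOp_two_sq (w : XiRing) : sqOp 2 (w ^ 2) = sqOp 1 w ^ 2 := by
  rw [pow_two, sqOp_mul]
  simp only [Finset.Nat.antidiagonal_succ, Finset.Nat.antidiagonal_zero, Finset.sum_cons,
    Finset.map_cons, Finset.map_singleton, Finset.sum_singleton, Function.Embedding.prodMap,
    Function.Embedding.coeFn_mk, Prod.map, Function.Embedding.refl_apply, sqOp_zero,
    Nat.succ_eq_add_one, zero_add, Nat.reduceAdd]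
  linear_combination w * sqOp 2 w * xi_one_add_one

theorem sqOp_four_sq (w : XiRing) : sqOp 4 (w ^ 2) = sqOp 2 w ^ 2 := by
  rw [pow_two, sqOp_mul]
  simp only [Finset.Nat.antidiagonal_succ, Finset.Nat.antidiagonal_zero, Finset.sum_cons,
    Finset.map_cons, Finset.map_singleton, Finset.sum_singleton, Function.Embedding.prodMap,
    Function.Embedding.coeFn_mk, Prod.map, Function.Embedding.refl_apply, sqOp_zero,
    Nat.succ_eq_add_one, zero_add, Nat.reduceAdd]
  linear_combination (w * sqOp 4 w + sqOp 1 w * sqOp 3 w) * xi_one_add_one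

/-- The primitive operation `Sq^1`. -/
def xiDer₁ : Derivation (ZMod 2) XiRing XiRing :=
  Derivation.mk' (sqOp 1) fun v w => by
    rw [sqOp_mul]
    simp [Finset.Nat.antidiagonal_succ, sqOp_zero]
    ring

theorem sqOp_one_one (v : XiRing) : sqOp 1 (sqOp 1 v) = 0 := by
  rw [← xiAction_Sq, ← xiAction_Sq, ← Module.End.mul_apply, ← map_mul, adem_1_1, map_zero]
  rfl

theorem sqOp_one_two (v : XiRing) : sqOp 1 (sqOp 2 v) = sqOp 3 v := by
  rw [← xiAction_Sq, ← xiAction_Sq, ← Module.End.mul_apply, ← map_mul, adem_1_2, xiAction_Sq]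

theorem sqOp_two_two (v : XiRing) : sqOp 2 (sqOp 2 v) = sqOp 1 (sqOp 2 (sqOp 1 v)) := by
  rw [sqOp_one_two, ← xiAction_Sq, ← xiAction_Sq, ← Module.End.mul_apply, ← map_mul, adem_2_2,
    one_smul, map_mul, Module.End.mul_apply, xiAction_Sq, xiAction_Sq]

/-- The primitive operation `[Sq^1, Sq^2]`. -/
def xiDer₂ : Derivation (ZMod 2) XiRing XiRing :=
  Derivation.mk' (sqOp 1 ∘ₗ sqOp 2 + sqOp 2 ∘ₗ sqOp 1) fun v w => by
    have h1 (v w : XiRing) : sqOp 1 (v * w) = v * sqOp 1 w + w * sqOp 1 v :=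
      xiDer₁.leibniz v w
    have h2 (v w : XiRing) : sqOp 2 (v * w) =
        v * sqOp 2 w + sqOp 1 v * sqOp 1 w + sqOp 2 v * w := by
      rw [sqOp_mul]
      simp [Finset.Nat.antidiagonal_succ, sqOp_zero, add_assoc]
    simp only [LinearMap.add_apply, LinearMap.comp_apply, h1, h2, map_add, sqOp_one_one,
      smul_eq_mul]
    linear_combination (sqOp 1 v * sqOp 2 w + sqOp 1 w * sqOp 2 v) * xi_one_add_one

theorem xiDer₂_apply (v : XiRing) :
    xiDer₂ v = sqOp 1 (sqOp 2 v) + sqOp 2 (sqOp 1 v) := rfl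

theorem xiDer₂_sqOp_one (v : XiRing) : xiDer₂ (sqOp 1 v) = sqOp 1 (xiDer₂ v) := by
  simp [xiDer₂_apply, sqOp_one_one]

theorem xiDer₂_sqOp_two (v : XiRing) : xiDer₂ (sqOp 2 v) = sqOp 2 (xiDer₂ v) := by
  simp only [xiDer₂_apply, map_add, sqOp_two_two, sqOp_one_one, map_zero, zero_add, add_zero]

theorem xiDer₂_sqOp_three (v : XiRing) : xiDer₂ (sqOp 3 v) = sqOp 3 (xiDer₂ v) := by
  rw [← sqOp_one_two, ← sqOp_one_two, xiDer₂_sqOp_one, xiDer₂_sqOp_two]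

/-- The primitive operation `[[Sq^1, Sq^2], Sq^4]`. -/
def xiDer₃ : Derivation (ZMod 2) XiRing XiRing :=
  Derivation.mk' ((xiDer₂ : XiRing →ₗ[ZMod 2] XiRing) ∘ₗ sqOp 4 +
      sqOp 4 ∘ₗ (xiDer₂ : XiRing →ₗ[ZMod 2] XiRing)) fun v w => by
    have h4 (v w : XiRing) : sqOp 4 (v * w) =
        v * sqOp 4 w + sqOp 1 v * sqOp 3 w + sqOp 2 v * sqOp 2 w + sqOp 3 v * sqOp 1 w +
          sqOp 4 v * w := by
      rw [sqOp_mul]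
      simp [Finset.Nat.antidiagonal_succ, sqOp_zero, add_assoc]
    simp only [LinearMap.add_apply, LinearMap.comp_apply, Derivation.coeFn_coe,
      Derivation.leibniz, h4, map_add, smul_eq_mul, xiDer₂_sqOp_one, xiDer₂_sqOp_two,
      xiDer₂_sqOp_three]
    linear_combination (sqOp 4 w * xiDer₂ v + sqOp 4 v * xiDer₂ w +
      sqOp 1 v * sqOp 3 (xiDer₂ w) + sqOp 3 w * sqOp 1 (xiDer₂ v) +
      sqOp 2 v * sqOp 2 (xiDer₂ w) + sqOp 2 w * sqOp 2 (xiDer₂ v) +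
      sqOp 3 v * sqOp 1 (xiDer₂ w) + sqOp 1 w * sqOp 3 (xiDer₂ v)) * xi_one_add_one

theorem xiDer₃_apply (v : XiRing) :
    xiDer₃ v = xiDer₂ (sqOp 4 v) + sqOp 4 (xiDer₂ v) := rfl

theorem derivation_sq (D : Derivation (ZMod 2) XiRing XiRing) (v : XiRing) : D (v ^ 2) = 0 := by
  rw [pow_two, D.leibniz, xi_add_self]

theorem derivation_mul_sq (D : Derivation (ZMod 2) XiRing XiRing) (v w : XiRing) :
    D (v * w ^ 2) = D v * w ^ 2 := by
  rw [D.leibniz, derivation_sq, smul_zero, zero_add, smul_eq_mul, mul_comm]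

theorem xiDer₁_xi (i : Fin 3) : xiDer₁ (xi i) = (![1, xi 0, xi 1] i) ^ 2 := sqOp_one_xi i

theorem xiDer₂_xi (i : Fin 3) : xiDer₂ (xi i) = (![0, 1, xi 0 ^ 2] i) ^ 2 := by
  rw [xiDer₂_apply, sqOp_xi_eq_zero, map_zero, zero_add, sqOp_one_xi, sqOp_two_sq]
  match i with
  | 0 => exact congrArg (· ^ 2) xiDer₁.map_one_eq_zero
  | 1 => exact congrArg (· ^ 2) ((sqOp_one_xi 0).trans (one_pow 2))
  | 2 => exact congrArg (· ^ 2) (sqOp_one_xi 1)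

theorem xiDer₃_xi (i : Fin 3) : xiDer₃ (xi i) = ![0, 0, 1] i := by
  have h1 : sqOp 2 (1 : XiRing) = 0 := by simp [sqOp_apply, Polynomial.coeff_one]
  rw [xiDer₃_apply, sqOp_xi_eq_zero, map_zero, zero_add, xiDer₂_xi, sqOp_four_sq]
  match i with
  | 0 => simp
  | 1 => simp [h1]
  | 2 =>
    change sqOp 2 (xi 0 ^ 2) ^ 2 = 1
    rw [sqOp_two_sq, sqOp_one_xi]
    simp

theorem xiDer_product : xiDer₃ (xiDer₂ (xiDer₁ (xi 0 * xi 1 * xi 2))) = 1 := by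
  simp [Derivation.leibniz, xiDer₁_xi, xiDer₂_xi, xiDer₃_xi]
  exact xiDer₃.map_natCast 2

theorem sqOp_witness : sqOp 2 (xiDer₂ (xiDer₁ (xi 0 ^ 3 * xi 1))) = 1 := by
  have h : xi 0 ^ 3 * xi 1 = xi 0 * xi 1 * xi 0 ^ 2 := by ring
  rw [h, derivation_mul_sq, derivation_mul_sq]
  simp [Derivation.leibniz, xiDer₁_xi, xiDer₂_xi,
    sqOp_two_sq, sqOp_one_xi]

/-- An element of `𝔽₂[ξ₁, ξ₂, ξ₃]` on which the top monomial takes the value `1`. -/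
def xiWitness : XiRing := xi 0 * xi 1 * xi 2 * (xi 0 ^ 3 * xi 1) ^ 2

/-- The last three factors of the top monomial are derivations, hence linear over squares, and they
take `ξ₁ ξ₂ ξ₃` to `1`. The first three factors `Sq^4`, `[Sq^2, Sq^4]`, `Sq^2` take `v ^ 2` to the
squares of `Sq^2 v`, `[Sq^1, Sq^2] v`, `Sq^1 v`, and the product of these operations takes
`ξ₁³ ξ₂` to `1`. -/
theorem xiAction_mayTop : xiAction (mayMono (fun i : Fin 3 => Sq (ZMod 2) 1 (2 ^ (i : ℕ))) mayTop)
    xiWitness = 1 := by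
  have h1 (v : XiRing) : xiAction (comm₂ (Sq (ZMod 2) 1 1) (Sq (ZMod 2) 1 2)) v = xiDer₂ v := by
    rw [comm₂, map_add, map_mul, map_mul]
    simp only [LinearMap.add_apply, Module.End.mul_apply, xiAction_Sq]
    rfl
  have h2 (v : XiRing) : xiAction (comm₂ (comm₂ (Sq (ZMod 2) 1 1) (Sq (ZMod 2) 1 2))
      (Sq (ZMod 2) 1 4)) v = xiDer₃ v := by
    rw [comm₂, map_add, map_mul, map_mul]
    simp only [LinearMap.add_apply, Module.End.mul_apply, xiAction_Sq, h1]
    rfl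
  have h3 (v : XiRing) : xiAction (comm₂ (Sq (ZMod 2) 1 2) (Sq (ZMod 2) 1 4)) (v ^ 2) =
      xiDer₂ v ^ 2 := by
    rw [comm₂, map_add, map_mul, map_mul]
    simp only [LinearMap.add_apply, Module.End.mul_apply, xiAction_Sq, sqOp_four_sq, sqOp_two_sq,
      xiDer₂_apply, CharTwo.add_sq]
  have e : mayMono (fun i : Fin 3 => Sq (ZMod 2) 1 (2 ^ (i : ℕ))) mayTop =
      Sq (ZMod 2) 1 4 * (comm₂ (Sq (ZMod 2) 1 2) (Sq (ZMod 2) 1 4) * (Sq (ZMod 2) 1 2 *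
        (comm₂ (comm₂ (Sq (ZMod 2) 1 1) (Sq (ZMod 2) 1 2)) (Sq (ZMod 2) 1 4) *
          (comm₂ (Sq (ZMod 2) 1 1) (Sq (ZMod 2) 1 2) * Sq (ZMod 2) 1 1)))) :=
    mayMono_eq _ _ _ _ _ _ _
  rw [e]
  simp only [map_mul, Module.End.mul_apply, xiAction_Sq, h1, h2]
  have h4 (v : XiRing) : sqOp 1 v = xiDer₁ v := rfl
  rw [xiWitness, h4, derivation_mul_sq, derivation_mul_sq, derivation_mul_sq, xiDer_product,
    one_mul, sqOp_two_sq, h3, sqOp_four_sq, h4, sqOp_witness, one_pow]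

theorem evalWords_map {R S ι : Type} [Ring R] [Ring S] (f : R →+* S) (g : ι → R)
    (P : List (List ι)) : f (evalWords g P) = evalWords (f ∘ g) P := by
  simp [evalWords, map_list_sum, map_list_prod, Function.comp_def]

theorem A2val_mayMono {k : Type} [CommRing k] (τ : k) (S : MayIdx) :
    A2val k τ (mayMono (A2gen k τ) S) = mayMono (fun i : Fin 3 => Sq k τ (2 ^ (i : ℕ))) S :=
  evalWords_map (A2val k τ).toRingHom _ _

/-- The linear form on the classical Steenrod algebra that detects the top monomial. -/
def topForm : SteenrodAlg (ZMod 2) 1 →ₗ[ZMod 2] ZMod 2 :=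
  (MvPolynomial.lcoeff (ZMod 2) 0) ∘ₗ (LinearMap.applyₗ xiWitness) ∘ₗ xiAction.toLinearMap

theorem topForm_mayTop :
    topForm (mayMono (fun i : Fin 3 => Sq (ZMod 2) 1 (2 ^ (i : ℕ))) mayTop) = 1 := by
  change MvPolynomial.coeff 0 (xiAction _ xiWitness) = 1
  rw [xiAction_mayTop, MvPolynomial.coeff_zero_one]

theorem classical_mayTop (c : ZMod 2) (hc : c • mayMono (A2gen (ZMod 2) 1) mayTop = 0) :
    c = 0 := by
  have h := congrArg (fun x => topForm (A2val (ZMod 2) 1 x)) hc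
  simpa [A2val_mayMono, topForm_mayTop] using h

/-- The comparison with the classical Steenrod algebra: `Sq^n ↦ τ ^ w ⊗ Sq^n`, where `w` is the
weight of `Sq^n`. -/
def motivicToClassical : SteenrodAlg M2 tau →ₐ[M2] M2 ⊗[ZMod 2] SteenrodAlg (ZMod 2) 1 :=
  steenrodLift (fun n => (tau ^ sqWeight n) ⊗ₜ[ZMod 2] Sq (ZMod 2) 1 n)
    (by rw [Sq_zero]; rfl) fun a b ha hab => by
      rw [Algebra.TensorProduct.tmul_mul_tmul, ← pow_add, adem a b ha hab,
        TensorProduct.tmul_sum]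
      refine Finset.sum_congr rfl fun c hc => ?_
      rw [Algebra.TensorProduct.tmul_mul_tmul, one_pow, mul_one]
      by_cases h : (((b - 1 - c).choose (a - 2 * c) : ℕ) : ZMod 2) = 0
      · rw [h, choose_cast_eq_zero h, zero_smul, zero_mul, zero_smul, TensorProduct.tmul_zero]
      · have hw := tauExp_spec a b c hab (by have := Finset.mem_range.1 hc; omega) h
        rw [TensorProduct.tmul_smul, TensorProduct.smul_tmul', TensorProduct.smul_tmul', ← hw,
          pow_add, pow_add]
        congr 1
        rw [smul_eq_mul, mul_assoc, ← nsmul_eq_mul, Nat.cast_smul_eq_nsmul]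

theorem motivicToClassical_Sq (n : ℕ) : motivicToClassical (Sq M2 tau n) =
    (tau ^ sqWeight n) ⊗ₜ[ZMod 2] Sq (ZMod 2) 1 n := steenrodLift_Sq _ _ _ n

theorem evalWords_of_forall {R S ι : Type} [Ring R] [Ring S] (f : S →+ R) (g : ι → R) (h : ι → S)
    (P : List (List ι)) (hP : ∀ l ∈ P, (l.map g).prod = f (l.map h).prod) :
    evalWords g P = f (evalWords h P) := by
  induction P with
  | nil => simp [evalWords]
  | cons l P ih =>
    rw [evalWords_cons, evalWords_cons, map_add, hP l List.mem_cons_self,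
      ih fun l hl => hP l (List.mem_cons_of_mem _ hl)]

theorem motivicToClassical_mayMono (S : MayIdx) :
    motivicToClassical (mayMono (fun i : Fin 3 => Sq M2 tau (2 ^ (i : ℕ))) S) =
      (tau ^ mayDeg (fun i : Fin 3 => sqWeight (2 ^ (i : ℕ))) S) ⊗ₜ[ZMod 2]
        mayMono (fun i : Fin 3 => Sq (ZMod 2) 1 (2 ^ (i : ℕ))) S := by
  refine (evalWords_map motivicToClassical.toRingHom _ _).trans ?_
  refine evalWords_of_forall ((TensorProduct.mk (ZMod 2) M2 (SteenrodAlg (ZMod 2) 1)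
    (tau ^ mayDeg (fun i : Fin 3 => sqWeight (2 ^ (i : ℕ))) S)).toAddMonoidHom) _ _ _
    fun l hl => ?_
  rw [← mayDeg_words _ hl]
  clear hl
  change _ = (tau ^ (l.map fun i : Fin 3 => sqWeight (2 ^ (i : ℕ))).sum) ⊗ₜ[ZMod 2] _
  induction l with
  | nil => rfl
  | cons i l ih =>
    simp only [List.map_cons, List.prod_cons, List.sum_cons, pow_add] at ih ⊢
    rw [ih, ← Algebra.TensorProduct.tmul_mul_tmul]
    congr 1
    exact motivicToClassical_Sq _

/-- No multiple of the top monomial vanishes: its image under `motivicToClassical` is a power of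
`τ` times the classical top monomial, and `𝕄₂` has no zero divisors. -/
theorem motivic_mayTop (c : M2) (hc : c • mayMono (A2gen M2 tau) mayTop = 0) : c = 0 := by
  have h := congrArg (fun x => TensorProduct.rid (ZMod 2) M2 (topForm.lTensor M2
    (motivicToClassical (A2val M2 tau x)))) hc
  simp only [map_smul, A2val_mayMono, motivicToClassical_mayMono, TensorProduct.smul_tmul',
    LinearMap.lTensor_tmul, topForm_mayTop, TensorProduct.rid_tmul, one_smul, map_zero,
    smul_eq_mul] at h
  exact (mul_eq_zero.1 h).resolve_right (pow_ne_zero _ Polynomial.X_ne_zero)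

theorem closure_powers_tau : AddSubgroup.closure (Set.range fun j : ℕ => tau ^ j) = ⊤ := by
  rw [eq_top_iff]
  rintro p -
  induction p using Polynomial.induction_on' with
  | add p q hp hq => exact add_mem hp hq
  | monomial n a =>
    rw [← Polynomial.C_mul_X_pow_eq_monomial]
    obtain rfl | rfl : a = 0 ∨ a = 1 := by revert a; decide
    · rw [map_zero, zero_mul]; exact zero_mem _
    · rw [map_one, one_mul]; exact AddSubgroup.subset_closure ⟨n, rfl⟩

theorem closure_powers_one : AddSubgroup.closure (Set.range fun j : ℕ => (1 : ZMod 2) ^ j) = ⊤ := by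
  rw [eq_top_iff]
  rintro a -
  obtain rfl | rfl : a = 0 ∨ a = 1 := by revert a; decide
  · exact zero_mem _
  · exact AddSubgroup.subset_closure ⟨0, rfl⟩

/-- The basis of `Gr A(2)` over `𝕄₂`. -/
def motivicBasis : Module.Basis MayIdx M2 (GrA2 M2 tau) :=
  grBasis closure_powers_tau motivic_mayTop

/-- The basis of classical `Gr A(2)`. -/
def classicalBasis : Module.Basis MayIdx (ZMod 2) (GrA2 (ZMod 2) 1) :=
  grBasis closure_powers_one classical_mayTop

theorem motivicBasis_apply (S : MayIdx) : motivicBasis S = mayMono (grGen M2 tau) S :=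
  grBasis_apply _ _ S

theorem classicalBasis_apply (S : MayIdx) : classicalBasis S = mayMono (grGen (ZMod 2) 1) S :=
  grBasis_apply _ _ S

end Top

/-! ### Gradings with a homogeneous basis -/

section Gradings

/-- A sum of subgroups that exhausts the group is direct if there are projections onto the
subgroups. -/
theorem isInternal_of_projections {ι M : Type} [DecidableEq ι] [AddCommGroup M]
    (ℳ : ι → AddSubgroup M) (π : ι → M →+ M) (h1 : ∀ d, ∀ x ∈ ℳ d, π d x = x)
    (h0 : ∀ d d', d ≠ d' → ∀ x ∈ ℳ d', π d x = 0)
    (hs : ∀ x, x ∈ AddSubgroup.closure {y | ∃ d, y ∈ ℳ d}) : DirectSum.IsInternal ℳ := by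
  have key (d : ι) (z : ⨁ i, ℳ i) : π d (DirectSum.coeAddMonoidHom ℳ z) = z d := by
    induction z using DirectSum.induction_on with
    | zero => simp
    | add x y hx hy => rw [map_add, map_add, hx, hy, DirectSum.add_apply]; rfl
    | of i x =>
      rw [DirectSum.coeAddMonoidHom_of]
      by_cases h : d = i
      · subst h
        rw [DirectSum.of_eq_same, h1 d _ x.2]
      · rw [DirectSum.of_eq_of_ne _ _ _ h, h0 d i h _ x.2]; rfl
  constructor
  · intro x y hxy
    refine DFinsupp.ext fun d => Subtype.ext ?_
    exact (key d x).symm.trans ((congrArg (π d) hxy).trans (key d y))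
  · intro x
    have : AddSubgroup.closure {y | ∃ d, y ∈ ℳ d} ≤
        (DirectSum.coeAddMonoidHom ℳ).range := by
      refine (AddSubgroup.closure_le _).2 ?_
      rintro y ⟨d, hy⟩
      exact ⟨DirectSum.of _ d ⟨y, hy⟩, DirectSum.coeAddMonoidHom_of _ _ _⟩
    exact this (hs x)

theorem nonempty_gradedRing {ι R : Type} [DecidableEq ι] [AddMonoid ι] [Ring R]
    (ℳ : ι → AddSubgroup R) (hone : (1 : R) ∈ ℳ 0)
    (hmul : ∀ d d', ∀ x ∈ ℳ d, ∀ y ∈ ℳ d', x * y ∈ ℳ (d + d'))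
    (h : DirectSum.IsInternal ℳ) : Nonempty (GradedRing ℳ) :=
  ⟨{ h.chooseDecomposition with
      one_mem := hone
      mul_mem := fun {i j x y} hx hy => hmul i j x hx y hy }⟩

theorem closure_mul_mem {R : Type} [Ring R] {s t u : Set R} {x y : R}
    (h : ∀ x ∈ s, ∀ y ∈ t, x * y ∈ AddSubgroup.closure u) (hx : x ∈ AddSubgroup.closure s)
    (hy : y ∈ AddSubgroup.closure t) : x * y ∈ AddSubgroup.closure u := by
  induction hx using AddSubgroup.closure_induction with
  | mem x hx =>
    induction hy using AddSubgroup.closure_induction with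
    | mem y hy => exact h x hx y hy
    | zero => rw [mul_zero]; exact zero_mem _
    | add y z _ _ h1 h2 => rw [mul_add]; exact add_mem h1 h2
    | neg y _ h => rw [mul_neg]; exact neg_mem h
  | zero => rw [zero_mul]; exact zero_mem _
  | add x z _ _ h1 h2 => rw [add_mul]; exact add_mem h1 h2
  | neg x _ h => rw [neg_mul]; exact neg_mem h

theorem nonempty_gradedRing_M2 {ι : Type} [DecidableEq ι] [AddCommMonoid ι] (u : ι)
    (hu : Function.Injective fun j : ℕ => j • u) : Nonempty (GradedRing (M2Grading u)) := by
  classical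
  refine nonempty_gradedRing _ (AddSubgroup.subset_closure ⟨0, by simp⟩)
    (fun d d' x hx y hy => closure_mul_mem ?_ hx hy) ?_
  · rintro _ ⟨i, rfl, rfl⟩ _ ⟨j, rfl, rfl⟩
    exact AddSubgroup.subset_closure ⟨i + j, by rw [add_smul], by rw [pow_add]⟩
  · -- the coefficient of the power of `τ` of degree `d`, if there is one
    let π (d : ι) : M2 →+ M2 := if h : ∃ j : ℕ, d = j • u then
      ((Polynomial.monomial h.choose).comp (Polynomial.lcoeff _ h.choose)).toAddMonoidHom else 0
    have hπ (d : ι) (j : ℕ) : π d (tau ^ j) = if d = j • u then tau ^ j else 0 := by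
      by_cases h : ∃ j : ℕ, d = j • u
      · have hc := h.choose_spec
        simp only [π, dif_pos h]
        change Polynomial.monomial _ (Polynomial.coeff (tau ^ j) _) = _
        rw [Polynomial.coeff_X_pow]
        split_ifs with h1 h2 h2
        · rw [h1, ← Polynomial.X_pow_eq_monomial]
        · exact absurd (h1 ▸ hc) h2
        · exact absurd (hu (hc.symm.trans h2)) h1
        · simp
      · rw [if_neg fun h' => h ⟨j, h'⟩]
        simp only [π, dif_neg h]
        rfl
    refine isInternal_of_projections _ π (fun d x hx => ?_) (fun d d' hd x hx => ?_) fun x => ?_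
    · induction hx using AddSubgroup.closure_induction with
      | mem x hx => obtain ⟨j, rfl, rfl⟩ := hx; rw [hπ, if_pos rfl]
      | zero => rw [map_zero]
      | add x y _ _ hx hy => rw [map_add, hx, hy]
      | neg x _ hx => rw [map_neg, hx]
    · induction hx using AddSubgroup.closure_induction with
      | mem x hx => obtain ⟨j, rfl, rfl⟩ := hx; rw [hπ, if_neg hd]
      | zero => rw [map_zero]
      | add x y _ _ hx hy => rw [map_add, hx, hy, add_zero]
      | neg x _ hx => rw [map_neg, hx, neg_zero]
    · have hx : x ∈ AddSubgroup.closure (Set.range fun j : ℕ => tau ^ j) :=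
        closure_powers_tau ▸ AddSubgroup.mem_top x
      refine AddSubgroup.closure_mono ?_ hx
      rintro _ ⟨j, rfl⟩
      exact ⟨j • u, AddSubgroup.subset_closure ⟨j, rfl, rfl⟩⟩

theorem mem_F2Grading_zero (x : ZMod 2) : x ∈ F2Grading 0 := by
  obtain rfl | rfl : x = 0 ∨ x = 1 := by revert x; decide
  · exact zero_mem _
  · exact AddSubgroup.subset_closure ⟨rfl, rfl⟩

theorem F2Grading_of_ne {d : ℤ × ℤ × ℤ} (hd : d ≠ 0) : F2Grading d = ⊥ := by
  refine AddSubgroup.closure_eq_bot_iff.2 ?_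
  rintro x ⟨h, -⟩
  exact absurd h hd

theorem nonempty_gradedRing_F2 : Nonempty (GradedRing F2Grading) := by
  refine nonempty_gradedRing _ (mem_F2Grading_zero 1)
    (fun d d' x hx y hy => closure_mul_mem ?_ hx hy) ?_
  · rintro _ ⟨rfl, rfl⟩ _ ⟨rfl, rfl⟩
    exact AddSubgroup.subset_closure ⟨rfl, rfl⟩
  · refine isInternal_of_projections _ (fun d => if d = 0 then AddMonoidHom.id _ else 0)
      (fun d x hx => ?_) (fun d d' hd x hx => ?_) fun x =>
        AddSubgroup.subset_closure ⟨0, mem_F2Grading_zero x⟩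
    · by_cases h : d = 0
      · simp [h]
      · rw [F2Grading_of_ne h, AddSubgroup.mem_bot] at hx
        rw [hx, map_zero]
    · by_cases h : d' = 0
      · rw [if_neg (h ▸ hd)]; rfl
      · rw [F2Grading_of_ne h, AddSubgroup.mem_bot] at hx
        rw [hx, map_zero]

/-- The grading `𝒢` of the `k`-module `R` is the one for which the basis elements `b i` are
homogeneous of degree `deg i`, over the grading `𝒦` of `k`. -/
def IsHomogeneousBasis {ι J k R : Type} [AddCommGroup ι] [CommRing k] [Ring R] [Algebra k R]
    (𝒦 : ι → AddSubgroup k) (𝒢 : ι → AddSubgroup R) (b : Module.Basis J k R) (deg : J → ι) :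
    Prop :=
  ∀ d, 𝒢 d = AddSubgroup.closure {x | ∃ p i, p + deg i = d ∧ ∃ c ∈ 𝒦 p, x = c • b i}

section

variable {ι J k R : Type} [DecidableEq ι] [AddCommGroup ι] [CommRing k] [Ring R] [Algebra k R]
  {𝒦 : ι → AddSubgroup k} [GradedRing 𝒦] {𝒢 : ι → AddSubgroup R} {b : Module.Basis J k R}
  {deg : J → ι}

theorem IsHomogeneousBasis.smul_mem (h : IsHomogeneousBasis 𝒦 𝒢 b deg) {p d : ι} {i : J} {c : k}
    (hc : c ∈ 𝒦 p) (hd : p + deg i = d) : c • b i ∈ 𝒢 d := by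
  rw [h]
  exact AddSubgroup.subset_closure ⟨p, i, hd, c, hc, rfl⟩

theorem IsHomogeneousBasis.basis_mem (h : IsHomogeneousBasis 𝒦 𝒢 b deg) (i : J) :
    b i ∈ 𝒢 (deg i) := by
  have := h.smul_mem (i := i) (d := deg i) (SetLike.one_mem_graded 𝒦) (zero_add _)
  rwa [one_smul] at this

theorem IsHomogeneousBasis.smul_mem' (h : IsHomogeneousBasis 𝒦 𝒢 b deg) {p d : ι} {c : k} {x : R}
    (hc : c ∈ 𝒦 p) (hx : x ∈ 𝒢 d) : c • x ∈ 𝒢 (p + d) := by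
  rw [h] at hx
  induction hx using AddSubgroup.closure_induction with
  | mem x hx =>
    obtain ⟨q, i, rfl, c', hc', rfl⟩ := hx
    rw [smul_smul]
    exact h.smul_mem (SetLike.mul_mem_graded hc hc') (add_assoc _ _ _)
  | zero => rw [smul_zero]; exact zero_mem _
  | add x y _ _ hx hy => rw [smul_add]; exact add_mem hx hy
  | neg x _ hx => rw [smul_neg]; exact neg_mem hx

/-- The projection onto the part of degree `d` of `k`. -/
def gradedProj (𝒦 : ι → AddSubgroup k) [GradedRing 𝒦] (d : ι) : k →+ k where
  toFun x := DirectSum.decompose 𝒦 x d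
  map_zero' := by simp
  map_add' x y := by simp

theorem gradedProj_mem (d : ι) (x : k) : gradedProj 𝒦 d x ∈ 𝒦 d := SetLike.coe_mem _

theorem gradedProj_of_mem {d : ι} {x : k} (hx : x ∈ 𝒦 d) : gradedProj 𝒦 d x = x :=
  DirectSum.decompose_of_mem_same 𝒦 hx

theorem gradedProj_of_mem_ne {d d' : ι} {x : k} (hx : x ∈ 𝒦 d') (hd : d' ≠ d) :
    gradedProj 𝒦 d x = 0 :=
  DirectSum.decompose_of_mem_ne 𝒦 hx hd

theorem gradedProj_mul {p d : ι} {c : k} (hc : c ∈ 𝒦 p) (x : k) :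
    gradedProj 𝒦 d (c * x) = c * gradedProj 𝒦 (d - p) x := by
  have := DirectSum.coe_decompose_mul_add_of_left_mem 𝒦 (j := d - p) (b := x) hc
  rwa [add_sub_cancel] at this

theorem exists_sum_gradedProj (x : k) :
    ∃ s : Finset ι, ∀ t, s ⊆ t → ∑ d ∈ t, gradedProj 𝒦 d x = x := by
  classical
  refine ⟨(DirectSum.decompose 𝒦 x).support, fun t ht => ?_⟩
  refine Eq.trans ?_ (DirectSum.sum_support_decompose 𝒦 x)
  refine (Finset.sum_subset ht fun d _ hd => ?_).symm
  have : DirectSum.decompose 𝒦 x d = 0 := by simpa using hd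
  change ((DirectSum.decompose 𝒦 x d : 𝒦 d) : k) = 0
  rw [this]; rfl

theorem IsHomogeneousBasis.isInternal [Fintype J] (h : IsHomogeneousBasis 𝒦 𝒢 b deg) :
    DirectSum.IsInternal 𝒢 := by
  let π (d : ι) : R →+ R :=
    { toFun := fun x => ∑ i, gradedProj 𝒦 (d - deg i) (b.repr x i) • b i
      map_zero' := by simp
      map_add' := fun x y => by simp [add_smul, Finset.sum_add_distrib] }
  have hπ (d : ι) (c : k) (i : J) : π d (c • b i) = gradedProj 𝒦 (d - deg i) c • b i := by
    classical
    change ∑ j, gradedProj 𝒦 (d - deg j) (b.repr (c • b i) j) • b j = _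
    rw [Finset.sum_eq_single i]
    · simp
    · intro j _ hj
      simp [hj.symm]
    · simp
  refine isInternal_of_projections _ π (fun d x hx => ?_) (fun d d' hd x hx => ?_) fun x => ?_
  · rw [h] at hx
    induction hx using AddSubgroup.closure_induction with
    | mem x hx =>
      obtain ⟨p, i, rfl, c, hc, rfl⟩ := hx
      rw [hπ, add_sub_cancel_right, gradedProj_of_mem hc]
    | zero => rw [map_zero]
    | add x y _ _ hx hy => rw [map_add, hx, hy]
    | neg x _ hx => rw [map_neg, hx]
  · rw [h] at hx
    induction hx using AddSubgroup.closure_induction with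
    | mem x hx =>
      obtain ⟨p, i, rfl, c, hc, rfl⟩ := hx
      rw [hπ, gradedProj_of_mem_ne hc, zero_smul]
      rintro rfl
      exact hd (by rw [sub_add_cancel])
    | zero => rw [map_zero]
    | add x y _ _ hx hy => rw [map_add, hx, hy, add_zero]
    | neg x _ hx => rw [map_neg, hx, neg_zero]
  · rw [← b.sum_repr x]
    refine sum_mem fun i _ => ?_
    obtain ⟨s, hs⟩ := exists_sum_gradedProj (𝒦 := 𝒦) (b.repr x i)
    rw [← hs s subset_rfl, Finset.sum_smul]
    exact sum_mem fun d _ => AddSubgroup.subset_closure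
      ⟨d + deg i, h.smul_mem (gradedProj_mem d _) rfl⟩

theorem IsHomogeneousBasis.nonempty_gradedRing [Fintype J] (h : IsHomogeneousBasis 𝒦 𝒢 b deg)
    (hone : (1 : R) ∈ 𝒢 0) (hmul : ∀ i j, b i * b j ∈ 𝒢 (deg i + deg j)) :
    Nonempty (GradedRing 𝒢) := by
  refine _root_.nonempty_gradedRing _ hone (fun d d' x hx y hy => ?_) h.isInternal
  have hm := h (d + d')
  rw [h] at hx hy
  rw [hm]
  refine closure_mul_mem ?_ hx hy
  rw [← hm]
  rintro _ ⟨p, i, rfl, c, hc, rfl⟩ _ ⟨q, j, rfl, c', hc', rfl⟩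
  rw [smul_mul_smul_comm, add_add_add_comm]
  exact h.smul_mem' (SetLike.mul_mem_graded hc hc') (hmul i j)

end

end Gradings

/-! ### The gradings of `Gr A(2)` -/

section GrGradings

/-- The tridegrees `(m, t, w)` of the generators. -/
def genDeg (i : Fin 3) : ℤ × ℤ × ℤ :=
  (1, ((2 ^ (i : ℕ) : ℕ) : ℤ), (sqWeight (2 ^ (i : ℕ)) : ℤ))

theorem mayDeg_map {Γ Γ' : Type} [AddCommMonoid Γ] [AddCommMonoid Γ'] (f : Γ →+ Γ')
    (δ : Fin 3 → Γ) (S : MayIdx) : f (mayDeg δ S) = mayDeg (fun i => f (δ i)) S := by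
  simp [mayDeg]

theorem sum_map_genDeg (l : List (Fin 3)) : (l.map genDeg).sum =
    ((l.length : ℤ), (l.map fun i : Fin 3 => ((2 ^ (i : ℕ) : ℕ) : ℤ)).sum,
      (l.map fun i : Fin 3 => (sqWeight (2 ^ (i : ℕ)) : ℤ)).sum) := by
  induction l with
  | nil => rfl
  | cons i l ih =>
    simp only [List.map_cons, List.sum_cons, ih, genDeg, Prod.mk_add_mk, List.length_cons]
    push_cast
    rw [add_comm (1 : ℤ)]

theorem mayDeg_genDeg_fst (S : MayIdx) :
    ((mayDeg (fun _ => (1 : ℕ)) S : ℕ) : ℤ) = (mayDeg genDeg S).1 := by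
  rw [← Nat.coe_castAddMonoidHom, mayDeg_map,
    ← AddMonoidHom.coe_fst (M := ℤ) (N := ℤ × ℤ), mayDeg_map]
  simp [genDeg]

theorem mayDeg_genDeg_bot : mayDeg genDeg mayBot = 0 := by
  simp [mayDeg, mayBot, mayCount, Fin.sum_univ_three]

theorem evalWords_mem {R ι : Type} [Ring R] (g : ι → R) (W : AddSubgroup R) (P : List (List ι))
    (h : ∀ l ∈ P, (l.map g).prod ∈ W) : evalWords g P ∈ W := by
  refine AddSubgroup.list_sum_mem _ fun y hy => ?_
  obtain ⟨l, hl, rfl⟩ := List.mem_map.1 hy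
  exact h l hl

theorem homComponent_of_mem {Γ : Type} [AddCommMonoid Γ] {k : Type} [CommRing k] {τ : k}
    {γ : SteenrodAlg k τ →+* AddMonoidAlgebra (SteenrodAlg k τ) Γ} {u : Γ} {g : ℕ → Γ}
    (hγ : IsCoaction γ u g) {d : Γ} {x : SteenrodAlg k τ}
    (hx : x ∈ AddSubgroup.closure {x | ∃ (j : ℕ) (l : List ℕ), j • u + (l.map g).sum = d ∧
      x = τ ^ j • (l.map (Sq k τ)).prod}) : homComponent γ d x = x := by
  induction hx using AddSubgroup.closure_induction with
  | mem x hx =>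
    obtain ⟨j, l, rfl, rfl⟩ := hx
    change (γ _).coeff _ = _
    rw [hγ.word, AddMonoidAlgebra.coeff_single, Finsupp.single_eq_same]
  | zero => rw [map_zero]
  | add x y _ _ hx hy => rw [map_add, hx, hy]
  | neg x _ hx => rw [map_neg, hx]

/-- The class of a homogeneous element of `I ^ n` is a combination of Poincaré–Birkhoff–Witt
monomials of the same degree. -/
theorem grClass_mem_closure {Γ : Type} [AddCommMonoid Γ] {k : Type} [CommRing k] [CharP k 2] {τ : k}
    (hk : AddSubgroup.closure (Set.range fun j : ℕ => τ ^ j) = ⊤)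
    {γ : SteenrodAlg k τ →+* AddMonoidAlgebra (SteenrodAlg k τ) Γ} {u : Γ} {g : ℕ → Γ}
    (hγ : IsCoaction γ u g) {d : Γ} {n : ℕ} {x : A2 k τ} (hx : x ∈ A2ideal k τ ^ n)
    (hd : A2val k τ x ∈ AddSubgroup.closure {x | ∃ (j : ℕ) (l : List ℕ),
      j • u + (l.map g).sum = d ∧ x = τ ^ j • (l.map (Sq k τ)).prod}) :
    grClass k _ n x hx ∈ AddSubgroup.closure {y | ∃ j l S,
      j • u + (l.map fun i : Fin 3 => g (2 ^ (i : ℕ))).sum = d ∧ l.length = n ∧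
        S ∈ mayMulWord l mayBot ∧ y = τ ^ j • mayMono (grGen k τ) S} := by
  obtain ⟨v, hv, hv'⟩ := lifts_of_mem_wordSpan (mem_wordSpan_of_homogeneous hγ
    (A2_pow_le_wordSpan hk hx) (homComponent_of_mem hγ hd))
  rwa [hv.unique ⟨hx, rfl⟩] at hv'

/-- The trigrading of `Gr A(2)` is the one in which the monomials are homogeneous; the
coaction of degree and weight shows that a homogeneous class involves only monomials of its
tridegree. -/
theorem motivicGrading_basis :
    IsHomogeneousBasis (M2Grading (0, 0, 1)) motivicGrading motivicBasis (mayDeg genDeg) := by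
  rintro ⟨m, t, w⟩
  refine le_antisymm ((AddSubgroup.closure_le _).2 ?_) ((AddSubgroup.closure_le _).2 ?_)
  · rintro y ⟨n, x, hx, hn, hd, rfl⟩
    obtain ⟨γ, hγ⟩ := exists_motivic_coaction
    refine AddSubgroup.closure_mono ?_ (grClass_mem_closure (d := (t, w)) closure_powers_tau hγ hx
      (AddSubgroup.closure_mono ?_ hd))
    · rintro _ ⟨j, l, S, h1, h2, h3, rfl⟩
      refine ⟨j • (0, 0, 1), S, ?_, tau ^ j, AddSubgroup.subset_closure ⟨j, rfl, rfl⟩,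
        by rw [motivicBasis_apply]⟩
      rw [mayDeg_mulWord _ h3, sum_map_genDeg, h2, hn]
      have h4 : (l.map fun i : Fin 3 => (((2 ^ (i : ℕ) : ℕ) : ℤ),
          (sqWeight (2 ^ (i : ℕ)) : ℤ))).sum = ((l.map fun i : Fin 3 =>
            ((2 ^ (i : ℕ) : ℕ) : ℤ)).sum,
              (l.map fun i : Fin 3 => (sqWeight (2 ^ (i : ℕ)) : ℤ)).sum) := by
        clear h1 h2 h3
        induction l with
        | nil => rfl
        | cons i l ih => simp only [List.map_cons, List.sum_cons, ih, Prod.mk_add_mk]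
      rw [h4] at h1
      obtain ⟨h5, h6⟩ := Prod.mk.inj h1
      ext
      · simp
      · simpa using h5
      · simpa using h6
    · rintro _ ⟨j, l, h1, h2, rfl⟩
      refine ⟨j, l, ?_, rfl⟩
      have h4 : (l.map fun n : ℕ => ((n : ℤ), (sqWeight n : ℤ))).sum =
          (((l.sum : ℕ) : ℤ), (((l.map sqWeight).sum : ℕ) : ℤ)) := by
        clear h1 h2
        induction l with
        | nil => rfl
        | cons i l ih =>
          simp only [List.map_cons, List.sum_cons, ih, Prod.mk_add_mk]
          push_cast
          rfl
      rw [h4, ← h1, ← h2]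
      ext <;> simp
  · rintro _ ⟨p, S, hp, c, hc, rfl⟩
    rw [motivicBasis_apply]
    induction hc using AddSubgroup.closure_induction with
    | mem c hc =>
      obtain ⟨j, rfl, rfl⟩ := hc
      obtain ⟨hS, hS'⟩ := lifts_mayMono (k := M2) (τ := tau) S
      refine AddSubgroup.subset_closure ⟨mayDeg (fun _ => (1 : ℕ)) S,
        tau ^ j • mayMono (A2gen M2 tau) S, A2_smul_mem _ hS, ?_, ?_, ?_⟩
      · rw [mayDeg_genDeg_fst]
        simpa using congrArg Prod.fst hp
      · rw [map_smul, A2val_mayMono]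
        have : ∀ l ∈ mayWords S, tau ^ j • (l.map fun i : Fin 3 =>
            Sq M2 tau (2 ^ (i : ℕ))).prod ∈ motivicPart t w := by
          intro l hl
          rw [← mayDeg_words _ hl, sum_map_genDeg] at hp
          refine AddSubgroup.subset_closure ⟨j, l.map fun i : Fin 3 => 2 ^ (i : ℕ), ?_, ?_, ?_⟩
          · have := congrArg (fun p => p.2.1) hp
            simp only [Prod.snd_add, Prod.fst_add, Prod.smul_snd, Prod.smul_fst, smul_zero,
              zero_add] at this
            rw [← this]
            push_cast
            rw [List.map_map]
            rfl
          · have := congrArg (fun p => p.2.2) hp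
            simp only [Prod.snd_add, Prod.smul_snd] at this
            rw [← this]
            push_cast
            rw [List.map_map, List.map_map]
            simp [Function.comp_def]
          · rw [List.map_map]; rfl
        refine AddSubgroup.closure_induction (p := fun x _ => x ∈ motivicPart t w)
          (fun x hx => ?_) (zero_mem _) (fun _ _ _ _ => add_mem) (fun _ _ => neg_mem)
          (x := tau ^ j • mayMono _ S) (k := {tau ^ j • mayMono _ S})
          (AddSubgroup.subset_closure rfl)
        rw [Set.mem_singleton_iff.1 hx]
        exact evalWords_mem _ ((motivicPart t w).comap
          (DistribSMul.toAddMonoidHom _ (tau ^ j))) _ this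
      · exact (Lifts.smul (tau ^ j) ⟨hS, hS'⟩).unique ⟨_, rfl⟩
    | zero => rw [zero_smul]; exact zero_mem _
    | add x y _ _ hx hy => rw [add_smul]; exact add_mem hx hy
    | neg x _ hx => rw [neg_smul]; exact neg_mem hx

/-- Over `𝔽₂`, the span of some of the basis elements, described by coordinates. -/
theorem mem_closure_basis {J R : Type} [Fintype J] [Ring R] [Algebra (ZMod 2) R]
    (b : Module.Basis J (ZMod 2) R) (P : J → Prop) (x : R) :
    x ∈ AddSubgroup.closure {y | ∃ i, P i ∧ y = b i} ↔ ∀ i, ¬ P i → b.repr x i = 0 := by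
  classical
  constructor
  · intro hx i hi
    induction hx using AddSubgroup.closure_induction with
    | mem x hx =>
      obtain ⟨j, hj, rfl⟩ := hx
      rw [b.repr_self, Finsupp.single_eq_of_ne]
      rintro rfl
      exact hi hj
    | zero => simp
    | add x y _ _ hx hy => simp [hx, hy]
    | neg x _ hx => simp [hx]
  · intro h
    rw [← b.sum_repr x]
    refine sum_mem fun i _ => ?_
    obtain h0 | h1 : b.repr x i = 0 ∨ b.repr x i = 1 := by
      generalize b.repr x i = c
      revert c
      decide
    · rw [h0, zero_smul]; exact zero_mem _
    · rw [h1, one_smul]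
      refine AddSubgroup.subset_closure ⟨i, ?_, rfl⟩
      by_contra hi
      rw [h i hi] at h1
      exact zero_ne_one h1

theorem classicalBigrading_eq (m t : ℤ) : classicalBigrading m t = AddSubgroup.closure
    {y | ∃ S, ((mayDeg genDeg S).1 = m ∧ (mayDeg genDeg S).2.1 = t) ∧
      y = classicalBasis S} := by
  refine le_antisymm ((AddSubgroup.closure_le _).2 ?_) ((AddSubgroup.closure_le _).2 ?_)
  · rintro y ⟨n, x, hx, hn, hd, rfl⟩
    obtain ⟨γ, hγ⟩ := exists_degree_coaction (ZMod 2) 1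
    refine AddSubgroup.closure_mono ?_ (grClass_mem_closure (d := t) closure_powers_one hγ hx
      (AddSubgroup.closure_mono ?_ hd))
    · rintro _ ⟨j, l, S, h1, h2, h3, rfl⟩
      refine ⟨S, ?_, by rw [classicalBasis_apply, one_pow, one_smul]⟩
      rw [mayDeg_mulWord _ h3, sum_map_genDeg, h2, hn]
      exact ⟨rfl, by simpa using h1⟩
    · rintro _ ⟨l, h1, rfl⟩
      exact ⟨0, l, by rw [← h1]; simp, by simp⟩
  · rintro _ ⟨S, ⟨hm, ht⟩, rfl⟩
    rw [classicalBasis_apply]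
    obtain ⟨hS, hS'⟩ := lifts_mayMono (k := ZMod 2) (τ := 1) S
    refine AddSubgroup.subset_closure ⟨mayDeg (fun _ => (1 : ℕ)) S,
      mayMono (A2gen (ZMod 2) 1) S, hS, ?_, ?_, hS'⟩
    · rw [mayDeg_genDeg_fst, hm]
    · rw [A2val_mayMono]
      refine evalWords_mem _ _ _ fun l hl => ?_
      rw [← mayDeg_words _ hl, sum_map_genDeg] at ht
      refine AddSubgroup.subset_closure ⟨l.map fun i : Fin 3 => 2 ^ (i : ℕ), ?_, ?_⟩
      · rw [← ht]
        push_cast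
        rw [List.map_map]
        rfl
      · rw [List.map_map]; rfl

theorem classicalWeight_eq (w : ℤ) : classicalWeight w = AddSubgroup.closure
    {y | ∃ S, (mayDeg genDeg S).2.2 = w ∧ y = classicalBasis S} := by
  refine le_antisymm ((AddSubgroup.closure_le _).2 ?_) ((AddSubgroup.closure_le _).2 ?_)
  · rintro _ ⟨l, hl, rfl⟩
    rw [SetLike.mem_coe, show classicalGen = grGen (ZMod 2) 1 from rfl,
      word_eq_sum_mayMono mayRelations_gr]
    refine AddSubgroup.list_sum_mem _ fun y hy => ?_
    obtain ⟨S, hS, rfl⟩ := List.mem_map.1 hy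
    refine AddSubgroup.subset_closure ⟨S, ?_, (classicalBasis_apply S).symm⟩
    rw [mayDeg_mulWord _ hS, sum_map_genDeg, ← hl]
    push_cast
    simp only [bind_pure_comp, List.map_eq_map, List.map_map]
    rfl
  · rintro _ ⟨S, hS, rfl⟩
    rw [classicalBasis_apply]
    refine evalWords_mem _ _ _ fun l hl => ?_
    rw [← mayDeg_words _ hl, sum_map_genDeg] at hS
    refine AddSubgroup.subset_closure ⟨l, ?_, rfl⟩
    rw [← hS]
    push_cast
    simp only [bind_pure_comp, List.map_eq_map, List.map_map]
    rfl

/-- The bigrading and the weight are compatible, since both are read off from the same basis. -/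
theorem classicalGrading_eq (d : ℤ × ℤ × ℤ) : classicalGrading d = AddSubgroup.closure
    {y | ∃ S, mayDeg genDeg S = d ∧ y = classicalBasis S} := by
  obtain ⟨m, t, w⟩ := d
  change classicalBigrading m t ⊓ classicalWeight w = _
  rw [classicalBigrading_eq, classicalWeight_eq]
  ext x
  rw [AddSubgroup.mem_inf, mem_closure_basis, mem_closure_basis, mem_closure_basis]
  refine ⟨fun ⟨h1, h2⟩ S hS => ?_, fun h => ⟨fun S hS => h S ?_, fun S hS => h S ?_⟩⟩
  · by_cases hw : (mayDeg genDeg S).2.2 = w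
    · exact h1 S fun ⟨hm, ht⟩ => hS (Prod.ext hm (Prod.ext ht hw))
    · exact h2 S hw
  · exact fun e => hS (by rw [e]; exact ⟨rfl, rfl⟩)
  · exact fun e => hS (by rw [e])

theorem classicalGrading_basis :
    IsHomogeneousBasis F2Grading classicalGrading classicalBasis (mayDeg genDeg) := by
  intro d
  rw [classicalGrading_eq]
  refine le_antisymm ((AddSubgroup.closure_le _).2 ?_) ((AddSubgroup.closure_le _).2 ?_)
  · rintro _ ⟨S, hS, rfl⟩
    exact AddSubgroup.subset_closure ⟨0, S, by rw [zero_add, hS], 1, mem_F2Grading_zero 1,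
      (one_smul _ _).symm⟩
  · rintro _ ⟨p, S, hp, c, hc, rfl⟩
    induction hc using AddSubgroup.closure_induction with
    | mem c hc =>
      obtain ⟨rfl, rfl⟩ := hc
      exact AddSubgroup.subset_closure ⟨S, by rw [← hp, zero_add], one_smul _ _⟩
    | zero => rw [zero_smul]; exact zero_mem _
    | add x y _ _ hx hy => rw [add_smul]; exact add_mem hx hy
    | neg x _ hx => rw [neg_smul]; exact neg_mem hx

theorem tau_degree_injective : Function.Injective fun j : ℕ => j • ((0, 0, 1) : ℤ × ℤ × ℤ) := by
  intro i j h
  simpa using congrArg (fun p : ℤ × ℤ × ℤ => p.2.2) h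

instance : GradedRing (M2Grading ((0, 0, 1) : ℤ × ℤ × ℤ)) :=
  (nonempty_gradedRing_M2 _ tau_degree_injective).some

instance : GradedRing F2Grading := nonempty_gradedRing_F2.some

/-- Products of monomials are homogeneous of the expected degree. -/
theorem mayMono_mul_mem {k R : Type} [CommRing k] [Ring R] [Algebra k R] {g : Fin 3 → R}
    (hg : MayRelations g) (W : AddSubgroup R) (S T : MayIdx)
    (h : ∀ Q, mayDeg genDeg Q = mayDeg genDeg S + mayDeg genDeg T → mayMono g Q ∈ W) :
    mayMono g S * mayMono g T ∈ W := by
  refine evalWords_mem g (W.comap (AddMonoidHom.mulLeft (mayMono g S))) _ fun l hl => ?_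
  change mayMono g S * (l.map g).prod ∈ W
  rw [mayMono_mul_word hg]
  refine AddSubgroup.list_sum_mem _ fun y hy => ?_
  obtain ⟨Q, hQ, rfl⟩ := List.mem_map.1 hy
  refine h Q ?_
  rw [← mayDeg_words _ hl, sum_map_eq_count, mayDeg, mayDeg, ← Finset.sum_add_distrib]
  refine Finset.sum_congr rfl fun i _ => ?_
  rw [mayCount_mulWord l S Q hQ, add_smul]

theorem motivicBasis_mul_mem (S T : MayIdx) : motivicBasis S * motivicBasis T ∈
    motivicGrading (mayDeg genDeg S + mayDeg genDeg T) := by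
  rw [motivicBasis_apply, motivicBasis_apply]
  refine mayMono_mul_mem (k := M2) mayRelations_gr _ S T fun Q hQ => ?_
  rw [← hQ, ← motivicBasis_apply]
  exact motivicGrading_basis.basis_mem Q

theorem classicalBasis_mul_mem (S T : MayIdx) : classicalBasis S * classicalBasis T ∈
    classicalGrading (mayDeg genDeg S + mayDeg genDeg T) := by
  rw [classicalBasis_apply, classicalBasis_apply]
  refine mayMono_mul_mem (k := ZMod 2) mayRelations_gr _ S T fun Q hQ => ?_
  rw [← hQ, ← classicalBasis_apply]
  exact classicalGrading_basis.basis_mem Q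

theorem nonempty_gradedRing_motivic : Nonempty (GradedRing motivicGrading) := by
  refine motivicGrading_basis.nonempty_gradedRing ?_ motivicBasis_mul_mem
  have := motivicGrading_basis.basis_mem mayBot
  rwa [motivicBasis_apply, mayMono_bot, mayDeg_genDeg_bot] at this

theorem nonempty_gradedRing_classical : Nonempty (GradedRing classicalGrading) := by
  refine classicalGrading_basis.nonempty_gradedRing ?_ classicalBasis_mul_mem
  have := classicalGrading_basis.basis_mem mayBot
  rwa [classicalBasis_apply, mayMono_bot, mayDeg_genDeg_bot] at this

end GrGradings

/-! ### The comparison of the associated graded algebras -/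

section GrComparison

theorem map_comm₂ {R S : Type} [Ring R] [Ring S] (f : R →+* S) (x y : R) :
    f (comm₂ x y) = comm₂ (f x) (f y) := by
  simp [comm₂]

theorem MayRelations.map {R S : Type} [Ring R] [Ring S] {g : Fin 3 → R} (hg : MayRelations g)
    (f : R →+* S) : MayRelations (f ∘ g) where
  add_self x := by
    have h := congrArg f (hg.add_self 1)
    rw [map_add, map_one, map_zero] at h
    rw [← one_mul x, ← add_mul, h, zero_mul]
  sq0 := by simpa using congrArg f hg.sq0
  sq1 := by simpa using congrArg f hg.sq1
  sq2 := by simpa using congrArg f hg.sq2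
  comm02 := by simpa using congrArg f hg.comm02
  sq01 := by simpa [map_comm₂] using congrArg f hg.sq01
  sq12 := by simpa [map_comm₂] using congrArg f hg.sq12
  sq012 := by simpa [map_comm₂] using congrArg f hg.sq012
  comm1 := by simpa [map_comm₂] using congrArg f hg.comm1

/-- A linear map that preserves the monomials is multiplicative, because the multiplication
table of the monomials is determined by the relations. -/
theorem map_mul_of_map_mayMono {k R R' : Type} [CommRing k] [Ring R] [Algebra k R] [Ring R']
    [Algebra k R'] {g : Fin 3 → R} {g' : Fin 3 → R'} (hg : MayRelations g)
    (hg' : MayRelations g') (b : Module.Basis MayIdx k R) (hb : ∀ S, b S = mayMono g S)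
    (f : R →ₗ[k] R') (hf : ∀ S, f (mayMono g S) = mayMono g' S) (x y : R) :
    f (x * y) = f x * f y := by
  have h1 (S : MayIdx) (l : List (Fin 3)) :
      f (mayMono g S * (l.map g).prod) = mayMono g' S * (l.map g').prod := by
    rw [mayMono_mul_word hg, mayMono_mul_word hg', map_list_sum, List.map_map]
    congr 2
    exact funext hf
  have h2 (S T : MayIdx) : f (mayMono g S * mayMono g T) = mayMono g' S * mayMono g' T := by
    change f (mayMono g S * evalWords g (mayWords T)) = mayMono g' S * evalWords g' (mayWords T)
    rw [evalWords, evalWords, ← List.sum_map_mul_left, ← List.sum_map_mul_left, map_list_sum,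
      List.map_map]
    refine congrArg _ (List.map_congr_left fun l _ => ?_)
    exact h1 S l
  have h3 : (LinearMap.mul k R).compr₂ f = (LinearMap.mul k R').compl₁₂ f f := by
    refine b.ext fun S => b.ext fun T => ?_
    simp only [LinearMap.compr₂_apply, LinearMap.compl₁₂_apply, LinearMap.mul_apply', hb, h2, hf]
  exact LinearMap.congr_fun₂ h3 x y

/-- `Gr A(2)` is obtained from its classical counterpart by base change: both have the same
relations and the same basis. -/
def grEquiv : GrA2 M2 tau ≃ₐ[M2] M2 ⊗[ZMod 2] GrA2 (ZMod 2) 1 :=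
  have hf (S : MayIdx) : motivicBasis.equiv (classicalBasis.baseChange M2) (Equiv.refl _)
      (mayMono (grGen M2 tau) S) =
        mayMono ((Algebra.TensorProduct.includeRight : GrA2 (ZMod 2) 1 →ₐ[ZMod 2]
          M2 ⊗[ZMod 2] GrA2 (ZMod 2) 1).toRingHom ∘ grGen (ZMod 2) 1) S := by
    rw [← motivicBasis_apply, Module.Basis.equiv_apply, Module.Basis.baseChange_apply,
      Equiv.refl_apply, classicalBasis_apply]
    exact evalWords_map (Algebra.TensorProduct.includeRight : GrA2 (ZMod 2) 1 →ₐ[ZMod 2]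
          M2 ⊗[ZMod 2] GrA2 (ZMod 2) 1).toRingHom _ _
  AlgEquiv.ofLinearEquiv (motivicBasis.equiv (classicalBasis.baseChange M2) (Equiv.refl _))
    (by
      have := hf mayBot
      rwa [mayMono_bot, mayMono_bot] at this)
    (map_mul_of_map_mayMono mayRelations_gr (mayRelations_gr.map _) motivicBasis
      motivicBasis_apply _ hf)

theorem grEquiv_basis (S : MayIdx) : grEquiv (motivicBasis S) = 1 ⊗ₜ classicalBasis S := by
  refine (Module.Basis.equiv_apply _ _ _ _).trans ?_
  rw [Module.Basis.baseChange_apply]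
  rfl

theorem grEquiv_symm_basis (S : MayIdx) :
    grEquiv.symm (1 ⊗ₜ classicalBasis S) = motivicBasis S := by
  rw [← grEquiv_basis, AlgEquiv.symm_apply_apply]

theorem grEquiv_grading (d : ℤ × ℤ × ℤ) (x : GrA2 M2 tau) :
    grEquiv x ∈ tensorGrading (M2Grading (0, 0, 1)) classicalGrading d ↔
      x ∈ motivicGrading d := by
  constructor
  · intro hx
    rw [← grEquiv.symm_apply_apply x]
    generalize grEquiv x = z at hx
    induction hx using AddSubgroup.closure_induction with
    | mem z hz =>
      obtain ⟨p, q, rfl, c, hc, y, hy, rfl⟩ := hz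
      rw [classicalGrading_basis] at hy
      induction hy using AddSubgroup.closure_induction with
      | mem y hy =>
        obtain ⟨r, S, rfl, c', hc', rfl⟩ := hy
        by_cases hr : r = 0
        · subst hr
          rw [zero_add, ← TensorProduct.smul_tmul, ← mul_one (c' • c), ← smul_eq_mul,
            ← TensorProduct.smul_tmul', map_smul, grEquiv_symm_basis]
          refine motivicGrading_basis.smul_mem (p := p) ?_ rfl
          obtain rfl | rfl : c' = 0 ∨ c' = 1 := by
            clear hc'; revert c'; decide
          · rw [zero_smul]; exact zero_mem _
          · rwa [one_smul]
        · rw [F2Grading_of_ne hr, AddSubgroup.mem_bot] at hc'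
          rw [hc', zero_smul, TensorProduct.tmul_zero, map_zero]
          exact zero_mem _
      | zero => rw [TensorProduct.tmul_zero, map_zero]; exact zero_mem _
      | add x y _ _ hx hy => rw [TensorProduct.tmul_add, map_add]; exact add_mem hx hy
      | neg x _ hx => rw [TensorProduct.tmul_neg, map_neg]; exact neg_mem hx
    | zero => rw [map_zero]; exact zero_mem _
    | add x y _ _ hx hy => rw [map_add]; exact add_mem hx hy
    | neg x _ hx => rw [map_neg]; exact neg_mem hx
  · intro hx
    rw [motivicGrading_basis] at hx
    induction hx using AddSubgroup.closure_induction with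
    | mem x hx =>
      obtain ⟨p, S, rfl, c, hc, rfl⟩ := hx
      rw [map_smul, grEquiv_basis, TensorProduct.smul_tmul', smul_eq_mul, mul_one]
      exact AddSubgroup.subset_closure ⟨p, _, rfl, c, hc, _,
        classicalGrading_basis.basis_mem S, rfl⟩
    | zero => rw [map_zero]; exact zero_mem _
    | add x y _ _ hx hy => rw [map_add]; exact add_mem hx hy
    | neg x _ hx => rw [map_neg]; exact neg_mem hx

/-- Classical `Gr A(2)` as a subring of motivic `Gr A(2)`. -/
def grIncl : GrA2 (ZMod 2) 1 →+* GrA2 M2 tau :=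
  (grEquiv.symm : M2 ⊗[ZMod 2] GrA2 (ZMod 2) 1 →+* GrA2 M2 tau).comp
    (Algebra.TensorProduct.includeRight : GrA2 (ZMod 2) 1 →ₐ[ZMod 2]
      M2 ⊗[ZMod 2] GrA2 (ZMod 2) 1).toRingHom

theorem grIncl_basis (S : MayIdx) : grIncl (classicalBasis S) = motivicBasis S :=
  grEquiv_symm_basis S

theorem grIncl_smul (c : ZMod 2) (x : GrA2 (ZMod 2) 1) :
    grIncl (c • x) = (Polynomial.C c : M2) • grIncl x := by
  change grEquiv.symm (1 ⊗ₜ (c • x)) = (Polynomial.C c : M2) • grEquiv.symm (1 ⊗ₜ x)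
  rw [← map_smul, TensorProduct.smul_tmul', ← TensorProduct.smul_tmul, Polynomial.smul_eq_C_mul,
    smul_eq_mul]

/-- The augmentation is the coordinate of the unit. -/
theorem GrA2aug_mayMono {k : Type} [CommRing k] [IsDomain k] [CharP k 2] (τ : k) (S : MayIdx) :
    GrA2aug k τ (mayMono (grGen k τ) S) = if S = mayBot then 1 else 0 := by
  have hg (i : Fin 3) : GrA2aug k τ (grGen k τ i) = 0 := by
    have hr := mayRelations_gr (k := k) (τ := τ)
    have hsq : grGen k τ i * grGen k τ i = 0 := match i with
      | 0 => hr.sq0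
      | 1 => hr.sq1
      | 2 => hr.sq2
    -- the generators have square zero, and the augmentation takes values in a domain
    rw [← mul_self_eq_zero, ← map_mul, hsq, map_zero]
  split_ifs with h
  · rw [h, mayMono_bot, map_one]
  · have h0 : ∀ S, S ≠ mayBot → ∀ l ∈ mayWords S, l ≠ [] := by decide +kernel
    refine (evalWords_map (GrA2aug k τ).toRingHom _ _).trans ?_
    refine List.sum_eq_zero fun x hx => ?_
    obtain ⟨l, hl, rfl⟩ := List.mem_map.1 hx
    obtain ⟨i, l, rfl⟩ := List.exists_cons_of_ne_nil (h0 S h l hl)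
    rw [List.map_cons, List.prod_cons]
    exact mul_eq_zero_of_left (hg i) _

theorem grIncl_aug (x : GrA2 (ZMod 2) 1) :
    GrA2aug M2 tau (grIncl x) = Polynomial.C (GrA2aug (ZMod 2) 1 x) := by
  rw [← classicalBasis.sum_repr x]
  simp only [map_sum, grIncl_smul, map_smul, grIncl_basis, smul_eq_mul, map_mul]
  refine Finset.sum_congr rfl fun S _ => ?_
  rw [classicalBasis_apply, motivicBasis_apply, GrA2aug_mayMono, GrA2aug_mayMono]
  split_ifs <;> simp

theorem GrA2aug_motivic_mem (S : MayIdx) :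
    GrA2aug M2 tau (motivicBasis S) ∈ M2Grading (0, 0, 1) (mayDeg genDeg S) := by
  rw [motivicBasis_apply, GrA2aug_mayMono]
  split_ifs with h
  · rw [h, mayDeg_genDeg_bot]
    exact SetLike.one_mem_graded _
  · exact zero_mem _

theorem GrA2aug_classical_mem (S : MayIdx) :
    GrA2aug (ZMod 2) 1 (classicalBasis S) ∈ F2Grading (mayDeg genDeg S) := by
  rw [classicalBasis_apply, GrA2aug_mayMono]
  split_ifs with h
  · rw [h, mayDeg_genDeg_bot]
    exact mem_F2Grading_zero _
  · exact zero_mem _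

end GrComparison

/-! ### Cochains with prescribed values on basis elements -/

section CochainBasis

variable {k R J : Type} [CommRing k] [Ring R] [Algebra k R] [Fintype J]
  (b : Module.Basis J k R)

/-- The cochain with prescribed values on tuples of basis elements. -/
def Cochain.ofValues {n : ℕ} (g : (Fin n → J) → k) : Cochain k R n :=
  ∑ σ, g σ • (show Cochain k R n from
    (MultilinearMap.mkPiAlgebra k (Fin n) k).compLinearMap fun i => b.coord (σ i))

theorem Cochain.ofValues_apply {n : ℕ} (g : (Fin n → J) → k) (v : Fin n → R) :
    Cochain.ofValues b g v = ∑ σ, g σ * ∏ i, b.repr (v i) (σ i) :=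
  Cochain.sum_apply _ _ _

theorem Cochain.ofValues_basis {n : ℕ} (g : (Fin n → J) → k) (σ : Fin n → J) :
    Cochain.ofValues b g (fun i => b (σ i)) = g σ := by
  classical
  rw [Cochain.ofValues_apply, Finset.sum_eq_single σ]
  · simp
  · intro τ _ hτ
    obtain ⟨i, hi⟩ := Function.ne_iff.1 hτ
    rw [Finset.prod_eq_zero (Finset.mem_univ i), mul_zero]
    rw [b.repr_self, Finsupp.single_eq_of_ne hi]
  · simp

theorem Cochain.ext_basis {n : ℕ} {f g : Cochain k R n}
    (h : ∀ σ : Fin n → J, f (fun i => b (σ i)) = g fun i => b (σ i)) : f = g :=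
  Module.Basis.ext_multilinear (fun _ => b) h

theorem Cochain.apply_eq_sum {n : ℕ} (f : Cochain k R n) (v : Fin n → R) :
    f v = ∑ σ : Fin n → J, (∏ i, b.repr (v i) (σ i)) * f fun i => b (σ i) := by
  have h : f = Cochain.ofValues b fun σ => f fun i => b (σ i) :=
    Cochain.ext_basis b fun σ => (Cochain.ofValues_basis b (fun σ => f fun i => b (σ i)) σ).symm
  conv_lhs => rw [h, Cochain.ofValues_apply]
  exact Finset.sum_congr rfl fun σ _ => mul_comm _ _

end CochainBasis

/-! ### The grading of `Ext` -/

section ExtGrading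

variable {k R J : Type} [CommRing k] [Ring R] [Algebra k R] [Fintype J]
  {𝒦 : ℤ × ℤ × ℤ → AddSubgroup k} [GradedRing 𝒦] {𝒢 : ℤ × ℤ × ℤ → AddSubgroup R}
  {b : Module.Basis J k R} {deg : J → ℤ × ℤ × ℤ}

theorem IsHomogeneousBasis.repr_mem (h : IsHomogeneousBasis 𝒦 𝒢 b deg) {d : ℤ × ℤ × ℤ} {x : R}
    (hx : x ∈ 𝒢 d) (i : J) : b.repr x i ∈ 𝒦 (d - deg i) := by
  classical
  rw [h] at hx
  induction hx using AddSubgroup.closure_induction with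
  | mem x hx =>
    obtain ⟨p, j, rfl, c, hc, rfl⟩ := hx
    rw [map_smul, b.repr_self, Finsupp.smul_single, smul_eq_mul, mul_one, Finsupp.single_apply]
    split_ifs with hij
    · rwa [hij, add_sub_cancel_right]
    · exact zero_mem _
  | zero => simp
  | add x y _ _ hx hy => rw [map_add]; exact add_mem hx hy
  | neg x _ hx => rw [map_neg]; exact neg_mem hx

theorem prod_mem_graded {ι : Type} (s : Finset ι) (c : ι → k) (d : ι → ℤ × ℤ × ℤ)
    (h : ∀ i, c i ∈ 𝒦 (d i)) : ∏ i ∈ s, c i ∈ 𝒦 (∑ i ∈ s, d i) := by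
  classical
  induction s using Finset.induction_on with
  | empty => exact SetLike.one_mem_graded 𝒦
  | insert i s hi ih =>
    rw [Finset.prod_insert hi, Finset.sum_insert hi]
    exact SetLike.mul_mem_graded (h i) ih

/-- Homogeneity may be tested on tuples of basis elements. -/
theorem isHomogeneous_iff (h : IsHomogeneousBasis 𝒦 𝒢 b deg) {n : ℕ} (f : Cochain k R n)
    (e : ℤ × ℤ × ℤ) : f.IsHomogeneous 𝒢 𝒦 e ↔
      ∀ σ : Fin n → J, f (fun i => b (σ i)) ∈ 𝒦 (∑ i, deg (σ i) - e) := by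
  refine ⟨fun hf σ => hf _ _ fun i => h.basis_mem (σ i), fun hf d v hv => ?_⟩
  rw [f.apply_eq_sum b]
  refine sum_mem fun σ _ => ?_
  have := SetLike.mul_mem_graded (prod_mem_graded (𝒦 := 𝒦) Finset.univ _ _
    fun i => h.repr_mem (hv i) (σ i)) (hf σ)
  rwa [Finset.sum_sub_distrib, sub_add_sub_cancel] at this

variable (𝒦 b deg) in
/-- The part of internal degree `e` of a cochain. -/
def homPart {n : ℕ} (e : ℤ × ℤ × ℤ) : Cochain k R n →+ Cochain k R n where
  toFun f := Cochain.ofValues b fun σ => gradedProj 𝒦 (∑ i, deg (σ i) - e) (f fun i => b (σ i))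
  map_zero' := Cochain.ext_basis b fun σ => by rw [Cochain.ofValues_basis]; simp
  map_add' f g := Cochain.ext_basis b fun σ => by
    rw [Cochain.add_apply, Cochain.ofValues_basis, Cochain.ofValues_basis,
      Cochain.ofValues_basis, Cochain.add_apply, map_add]

theorem homPart_basis {n : ℕ} (e : ℤ × ℤ × ℤ) (f : Cochain k R n) (σ : Fin n → J) :
    homPart 𝒦 b deg e f (fun i => b (σ i)) =
      gradedProj 𝒦 (∑ i, deg (σ i) - e) (f fun i => b (σ i)) :=
  Cochain.ofValues_basis b _ σ

/-- The projection can be computed on homogeneous arguments, not only on the basis; this is what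
the differential needs, since it evaluates cochains on products of basis elements. -/
theorem homPart_apply (h : IsHomogeneousBasis 𝒦 𝒢 b deg) {n : ℕ} (e : ℤ × ℤ × ℤ)
    (f : Cochain k R n) {d : Fin n → ℤ × ℤ × ℤ} {v : Fin n → R} (hv : ∀ i, v i ∈ 𝒢 (d i)) :
    homPart 𝒦 b deg e f v = gradedProj 𝒦 (∑ i, d i - e) (f v) := by
  rw [(homPart 𝒦 b deg e f).apply_eq_sum b, f.apply_eq_sum b v, map_sum]
  refine Finset.sum_congr rfl fun σ _ => ?_
  rw [homPart_basis, gradedProj_mul (prod_mem_graded (𝒦 := 𝒦) Finset.univ _ _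
    fun i => h.repr_mem (hv i) (σ i)), Finset.sum_sub_distrib, sub_sub_sub_comm, sub_self,
    zero_sub, neg_sub]

theorem homPart_isHomogeneous (h : IsHomogeneousBasis 𝒦 𝒢 b deg) {n : ℕ} (e : ℤ × ℤ × ℤ)
    (f : Cochain k R n) : (homPart 𝒦 b deg e f).IsHomogeneous 𝒢 𝒦 e := by
  rw [isHomogeneous_iff h]
  intro σ
  rw [homPart_basis]
  exact gradedProj_mem _ _

theorem homPart_of_isHomogeneous (h : IsHomogeneousBasis 𝒦 𝒢 b deg) {n : ℕ} {e : ℤ × ℤ × ℤ}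
    {f : Cochain k R n} (hf : f.IsHomogeneous 𝒢 𝒦 e) : homPart 𝒦 b deg e f = f := by
  refine Cochain.ext_basis b fun σ => ?_
  rw [homPart_basis, gradedProj_of_mem ((isHomogeneous_iff h f e).1 hf σ)]

theorem homPart_of_isHomogeneous_ne (h : IsHomogeneousBasis 𝒦 𝒢 b deg) {n : ℕ}
    {e e' : ℤ × ℤ × ℤ} {f : Cochain k R n} (hf : f.IsHomogeneous 𝒢 𝒦 e') (he : e' ≠ e) :
    homPart 𝒦 b deg e f = 0 := by
  refine Cochain.ext_basis b fun σ => ?_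
  rw [homPart_basis, gradedProj_of_mem_ne ((isHomogeneous_iff h f e').1 hf σ)
    (sub_right_injective.ne he)]
  rfl

theorem exists_sum_homPart {n : ℕ} (f : Cochain k R n) :
    ∃ s : Finset (ℤ × ℤ × ℤ), ∑ e ∈ s, homPart 𝒦 b deg e f = f := by
  classical
  choose s hs using fun σ : Fin n → J =>
    exists_sum_gradedProj (𝒦 := 𝒦) (f fun i => b (σ i))
  refine ⟨Finset.univ.biUnion fun σ => (s σ).image fun d => ∑ i, deg (σ i) - d,
    Cochain.ext_basis b fun σ => ?_⟩
  rw [Cochain.sum_apply]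
  simp only [homPart_basis]
  refine Eq.trans ?_ (hs σ ((Finset.univ.biUnion fun σ => (s σ).image
    fun d => ∑ i, deg (σ i) - d).image fun e => ∑ i, deg (σ i) - e) ?_)
  · rw [Finset.sum_image fun x _ y _ hxy => sub_right_injective (b := ∑ i, deg (σ i)) hxy]
  · intro d hd
    exact Finset.mem_image.2 ⟨∑ i, deg (σ i) - d, Finset.mem_biUnion.2 ⟨σ, Finset.mem_univ _,
      Finset.mem_image.2 ⟨d, hd, rfl⟩⟩, sub_sub_cancel _ _⟩

theorem sum_contractNth {Γ : Type} [AddCommMonoid Γ] {n : ℕ} (i : Fin n) (d : Fin (n + 1) → Γ) :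
    ∑ a, i.castSucc.contractNth (· + ·) d a = ∑ a, d a := by
  have h (a : Fin n) : i.castSucc.contractNth (· + ·) d a =
      d (i.succ.succAbove a) + if a = i then d i.succ else 0 := by
    rcases lt_trichotomy a i with hl | rfl | hl
    · rw [Fin.contractNth_apply_of_lt _ _ _ _ hl, if_neg hl.ne, add_zero,
        Fin.succAbove_of_castSucc_lt _ _ (Fin.lt_def.2 (by simp; omega))]
    · rw [Fin.contractNth_apply_of_eq _ _ _ _ rfl, if_pos rfl,
        Fin.succAbove_of_castSucc_lt _ _ (Fin.lt_def.2 (by simp))]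
    · rw [Fin.contractNth_apply_of_gt _ _ _ _ hl, if_neg hl.ne', add_zero,
        Fin.succAbove_of_le_castSucc _ _ (Fin.le_def.2 (by simp; omega))]
  rw [Finset.sum_congr rfl fun a _ => h a, Finset.sum_add_distrib, Finset.sum_ite_eq',
    if_pos (Finset.mem_univ _), Fin.sum_univ_succAbove d i.succ, add_comm]

variable {ε : R →ₐ[k] k}

/-- The differential preserves the internal degree. -/
theorem cobarδ_homPart (h : IsHomogeneousBasis 𝒦 𝒢 b deg)
    (hmul : ∀ i j, b i * b j ∈ 𝒢 (deg i + deg j)) (hε : ∀ i, ε (b i) ∈ 𝒦 (deg i)) {n : ℕ}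
    (e : ℤ × ℤ × ℤ) (f : Cochain k R n) :
    cobarδ ε n (homPart 𝒦 b deg e f) = homPart 𝒦 b deg e (cobarδ ε n f) := by
  refine Cochain.ext_basis b fun σ => ?_
  rw [homPart_basis, cobarδ_apply, cobarδ_apply, map_add, map_add, map_sum]
  congr 1
  · congr 1
    · rw [homPart_basis e f fun i => σ i.succ, gradedProj_mul (hε _), Fin.sum_univ_succ,
        add_sub_assoc, add_sub_cancel_left]
    · refine Finset.sum_congr rfl fun i _ => ?_
      rw [homPart_apply h e f (d := i.castSucc.contractNth (· + ·) fun i => deg (σ i)),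
        sum_contractNth]
      intro a
      rcases lt_trichotomy a i with hl | rfl | hl
      · rw [Fin.contractNth_apply_of_lt _ _ _ _ hl, Fin.contractNth_apply_of_lt _ _ _ _ hl]
        exact h.basis_mem _
      · rw [Fin.contractNth_apply_of_eq _ _ _ _ rfl, Fin.contractNth_apply_of_eq _ _ _ _ rfl]
        exact hmul _ _
      · rw [Fin.contractNth_apply_of_gt _ _ _ _ hl, Fin.contractNth_apply_of_gt _ _ _ _ hl]
        exact h.basis_mem _
  · rw [homPart_basis e f fun i => σ i.castSucc, mul_comm, mul_comm (f _),
      gradedProj_mul (hε _), Fin.sum_univ_castSucc,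
      add_sub_right_comm, add_sub_cancel_right]

/-- The `a`-th component of a cochain in the algebra of all cochains, followed by the projection
to internal degree `e`. -/
def homPartD (𝒦 : ℤ × ℤ × ℤ → AddSubgroup k) [GradedRing 𝒦] (b : Module.Basis J k R)
    (deg : J → ℤ × ℤ × ℤ) (e : ℤ × ℤ × ℤ) (a : ℕ) : CochainAlg k R →+ CochainAlg k R where
  toFun x := DirectSum.of (Cochain k R) a (homPart 𝒦 b deg e (x a))
  map_zero' := by rw [DirectSum.zero_apply, map_zero, map_zero]
  map_add' x y := by rw [DirectSum.add_apply, map_add, map_add]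

theorem homPartD_of (e : ℤ × ℤ × ℤ) (a : ℕ) (f : Cochain k R a) :
    homPartD 𝒦 b deg e a (DirectSum.of _ a f) = DirectSum.of _ a (homPart 𝒦 b deg e f) := by
  change DirectSum.of (Cochain k R) a (homPart 𝒦 b deg e (DirectSum.of (Cochain k R) a f a)) = _
  rw [DirectSum.of_eq_same]

theorem homPartD_of_ne (e : ℤ × ℤ × ℤ) {a a' : ℕ} (ha : a ≠ a') (f : Cochain k R a') :
    homPartD 𝒦 b deg e a (DirectSum.of _ a' f) = 0 := by
  change DirectSum.of (Cochain k R) a (homPart 𝒦 b deg e (DirectSum.of (Cochain k R) a' f a)) = _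
  rw [DirectSum.of_eq_of_ne _ _ _ ha, map_zero, map_zero]

theorem cobarD_homPartD (h : IsHomogeneousBasis 𝒦 𝒢 b deg)
    (hmul : ∀ i j, b i * b j ∈ 𝒢 (deg i + deg j)) (hε : ∀ i, ε (b i) ∈ 𝒦 (deg i))
    (e : ℤ × ℤ × ℤ) (a : ℕ) (x : CochainAlg k R) :
    cobarD ε (homPartD 𝒦 b deg e a x) = homPartD 𝒦 b deg e (a + 1) (cobarD ε x) := by
  induction x using DirectSum.induction_on with
  | zero => simp only [map_zero]
  | add x y hx hy => simp only [map_add, hx, hy]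
  | of n f =>
    rw [cobarD_of]
    by_cases ha : a = n
    · subst ha
      rw [homPartD_of, homPartD_of, cobarD_of, cobarδ_homPart h hmul hε]
    · rw [homPartD_of_ne _ ha, homPartD_of_ne _ (by omega), map_zero]

theorem cobarD_apply_succ (x : CochainAlg k R) (a : ℕ) :
    cobarD ε x (a + 1) = cobarδ ε a (x a) := by
  induction x using DirectSum.induction_on with
  | zero => simp only [map_zero, DirectSum.zero_apply]
  | add x y hx hy => simp only [map_add, DirectSum.add_apply, hx, hy]
  | of n f =>
    rw [cobarD_of]
    by_cases ha : a = n
    · subst ha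
      rw [DirectSum.of_eq_same, DirectSum.of_eq_same]
    · rw [DirectSum.of_eq_of_ne _ _ _ ha, DirectSum.of_eq_of_ne _ _ _ (by omega), map_zero]

theorem homPartD_zero_cobarD (e : ℤ × ℤ × ℤ) (x : CochainAlg k R) :
    homPartD 𝒦 b deg e 0 (cobarD ε x) = 0 := by
  induction x using DirectSum.induction_on with
  | zero => simp only [map_zero]
  | add x y hx hy => simp only [map_add, hx, hy, add_zero]
  | of n f => rw [cobarD_of, homPartD_of_ne _ (by omega)]

theorem of_mem_cocycles [CharP k 2] {n : ℕ} {f : Cochain k R n} (hf : cobarδ ε n f = 0) :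
    DirectSum.of _ n f ∈ cocycles ε := by
  change cobarD ε _ = 0
  rw [cobarD_of, hf, map_zero]

theorem cobarδ_eq_zero [CharP k 2] {x : CochainAlg k R} (hx : x ∈ cocycles ε) (n : ℕ) :
    cobarδ ε n (x n) = 0 := by
  rw [← cobarD_apply_succ, show cobarD ε x = 0 from hx, DirectSum.zero_apply]

theorem extMk_surjective [CharP k 2] : Function.Surjective (extMk ε) :=
  Ideal.Quotient.mk_surjective

theorem extMk_eq_zero [CharP k 2] {z : cocycles ε} :
    extMk ε z = 0 ↔ ∃ c, cobarD ε c = z :=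
  Ideal.Quotient.eq_zero_iff_mem

/-- An additive map of cochain algebras that preserves cocycles and coboundaries induces a map
on `Ext`. -/
theorem exists_extMap [CharP k 2] {k' R' : Type} [CommRing k'] [CharP k' 2] [Ring R']
    [Algebra k' R'] {ε' : R' →ₐ[k'] k'} (F : CochainAlg k R →+ CochainAlg k' R')
    (hF : ∀ x ∈ cocycles ε, F x ∈ cocycles ε') (hF' : ∀ c, ∃ c', cobarD ε' c' = F (cobarD ε c)) :
    ∃ G : ExtAlg ε →+ ExtAlg ε', ∀ z : cocycles ε, G (extMk ε z) = extMk ε' ⟨F z, hF z z.2⟩ := by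
  let H : cocycles ε →+ ExtAlg ε' :=
    { toFun := fun z => extMk ε' ⟨F z, hF z z.2⟩
      map_zero' := by
        rw [← map_zero (extMk ε')]
        congr 1
        exact Subtype.ext (map_zero F)
      map_add' := fun z z' => by
        rw [← map_add (extMk ε')]
        congr 1
        exact Subtype.ext (map_add F _ _) }
  have hH : (extMk ε : cocycles ε →+ ExtAlg ε).ker ≤ H.ker := by
    intro z hz
    obtain ⟨c, hc⟩ := extMk_eq_zero.1 (show extMk ε z = 0 from hz)
    refine extMk_eq_zero.2 ?_
    obtain ⟨c', hc'⟩ := hF' c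
    exact ⟨c', by rw [hc', hc]⟩
  exact ⟨(extMk ε : cocycles ε →+ ExtAlg ε).liftOfSurjective extMk_surjective ⟨H, hH⟩, fun z =>
    AddMonoidHom.liftOfRightInverse_comp_apply _ _ _ _ _⟩

theorem extMk_mem [CharP k 2] {𝒢 : ℤ × ℤ × ℤ → AddSubgroup R} {m s w : ℤ} {a : ℕ}
    {f : Cochain k R a} (hf : DirectSum.of _ a f ∈ cocycles ε)
    (h : f.IsHomogeneous 𝒢 𝒦 (m, s + a, w)) :
    extMk ε ⟨_, hf⟩ ∈ extGrading ε 𝒢 𝒦 (m, s, a, w) :=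
  AddSubgroup.subset_closure ⟨f, hf, h, rfl⟩

theorem extMk_mul_mem [CharP k 2] {d d' : ℤ × ℤ × ℕ × ℤ} {x y : ExtAlg ε}
    (hx : x ∈ extGrading ε 𝒢 𝒦 d) (hy : y ∈ extGrading ε 𝒢 𝒦 d') :
    x * y ∈ extGrading ε 𝒢 𝒦 (d + d') := by
  obtain ⟨m, s, a, w⟩ := d
  obtain ⟨m', s', a', w'⟩ := d'
  refine closure_mul_mem ?_ hx hy
  rintro _ ⟨f, hf, hfh, rfl⟩ _ ⟨g, hg, hgh, rfl⟩
  have hfg : DirectSum.of _ (a + a') (cup f g) ∈ cocycles ε := by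
    have := mul_mem hf hg
    rwa [DirectSum.of_mul_of] at this
  rw [← map_mul, show (⟨_, hf⟩ * ⟨_, hg⟩ : cocycles ε) = ⟨_, hfg⟩ from
    Subtype.ext (DirectSum.of_mul_of _ _)]
  refine extMk_mem hfg fun d v hv => ?_
  have := SetLike.mul_mem_graded (hfh (fun i => d (Fin.castAdd a' i)) _ fun i => hv _)
    (hgh (fun i => d (Fin.natAdd a i)) _ fun i => hv _)
  rw [cup_apply]
  convert this using 2
  rw [Fin.sum_univ_add, sub_add_sub_comm]
  congr 1
  ext <;> simp
  ring

/-- The projections to the parts of internal degree `e` and cohomological degree `a` commute with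
the differential and therefore induce projections on `Ext`. -/
theorem nonempty_gradedRing_ext [CharP k 2] (h : IsHomogeneousBasis 𝒦 𝒢 b deg)
    (hmul : ∀ i j, b i * b j ∈ 𝒢 (deg i + deg j)) (hε : ∀ i, ε (b i) ∈ 𝒦 (deg i)) :
    Nonempty (GradedRing (extGrading ε 𝒢 𝒦)) := by
  refine nonempty_gradedRing _ ?_ (fun d d' x hx y hy => extMk_mul_mem hx hy) ?_
  · refine extMk_mem (m := 0) (s := 0) (w := 0) (a := 0) (one_mem (cocycles ε)) fun d v hv => ?_
    have : ∑ i, d i - ((0, 0 + ((0 : ℕ) : ℤ), 0) : ℤ × ℤ × ℤ) = 0 := by simp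
    rw [this]
    exact SetLike.one_mem_graded 𝒦
  · have hπ (e : ℤ × ℤ × ℤ) (a : ℕ) : ∃ G : ExtAlg ε →+ ExtAlg ε, ∀ z : cocycles ε,
        ∃ hz, G (extMk ε z) = extMk ε ⟨homPartD 𝒦 b deg e a z, hz⟩ := by
      obtain ⟨G, hG⟩ := exists_extMap (ε := ε) (ε' := ε) (homPartD 𝒦 b deg e a) (fun x hx => by
        change cobarD ε _ = 0
        rw [cobarD_homPartD h hmul hε, show cobarD ε x = 0 from hx, map_zero]) (fun c => by
        match a with
        | 0 => exact ⟨0, by rw [map_zero, homPartD_zero_cobarD]⟩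
        | a + 1 => exact ⟨_, cobarD_homPartD h hmul hε e a c⟩)
      exact ⟨G, fun z => ⟨_, hG z⟩⟩
    choose G hG using hπ
    refine isInternal_of_projections _ (fun d => G (d.1, d.2.1 + d.2.2.1, d.2.2.2) d.2.2.1)
      (fun d x hx => ?_) (fun d d' hd x hx => ?_) fun x => ?_
    · obtain ⟨m, s, a, w⟩ := d
      induction hx using AddSubgroup.closure_induction with
      | mem x hx =>
        obtain ⟨f, hf, hfh, rfl⟩ := hx
        obtain ⟨hz, hG⟩ := hG (m, s + a, w) a ⟨_, hf⟩
        refine hG.trans (congrArg _ (Subtype.ext ?_))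
        change homPartD 𝒦 b deg _ a (DirectSum.of _ a f) = _
        rw [homPartD_of, homPart_of_isHomogeneous h hfh]
      | zero => rw [map_zero]
      | add x y _ _ hx hy => rw [map_add, hx, hy]
      | neg x _ hx => rw [map_neg, hx]
    · obtain ⟨m, s, a, w⟩ := d
      obtain ⟨m', s', a', w'⟩ := d'
      induction hx using AddSubgroup.closure_induction with
      | mem x hx =>
        obtain ⟨f, hf, hfh, rfl⟩ := hx
        obtain ⟨hz, hG⟩ := hG (m, s + a, w) a ⟨_, hf⟩
        refine hG.trans ((congrArg _ (Subtype.ext ?_)).trans (map_zero (extMk ε)))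
        change homPartD 𝒦 b deg _ a (DirectSum.of _ a' f) = 0
        by_cases ha : a = a'
        · subst ha
          rw [homPartD_of, homPart_of_isHomogeneous_ne h hfh, map_zero]
          intro he
          refine hd ?_
          simp only [Prod.mk.injEq, add_left_inj] at he ⊢
          exact ⟨he.1.symm, he.2.1.symm, trivial, he.2.2.symm⟩
        · rw [homPartD_of_ne _ ha]
      | zero => rw [map_zero]
      | add x y _ _ hx hy => rw [map_add, hx, hy, add_zero]
      | neg x _ hx => rw [map_neg, hx, neg_zero]
    · obtain ⟨z, rfl⟩ := extMk_surjective x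
      have hz (n : ℕ) : cobarδ ε n ((z : CochainAlg k R) n) = 0 := cobarδ_eq_zero z.2 n
      have hze (n : ℕ) (e : ℤ × ℤ × ℤ) :
          cobarδ ε n (homPart 𝒦 b deg e ((z : CochainAlg k R) n)) = 0 := by
        rw [cobarδ_homPart h hmul hε, hz, map_zero]
      classical
      choose s hs using fun n => exists_sum_homPart (𝒦 := 𝒦) (b := b) (deg := deg)
        ((z : CochainAlg k R) n)
      have hsum : z = ∑ n ∈ DFinsupp.support (z : CochainAlg k R), ∑ e ∈ s n,
          (⟨_, of_mem_cocycles (hze n e)⟩ : cocycles ε) := by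
        refine Subtype.ext ?_
        push_cast
        conv_lhs => rw [← DirectSum.sum_support_of (z : CochainAlg k R)]
        refine Finset.sum_congr rfl fun n _ => ?_
        rw [← map_sum, hs]
      rw [hsum, map_sum]
      refine sum_mem fun n _ => ?_
      rw [map_sum]
      refine sum_mem fun e _ => AddSubgroup.subset_closure
        ⟨(e.1, e.2.1 - n, n, e.2.2), extMk_mem _ ?_⟩
      rw [sub_add_cancel]
      exact homPart_isHomogeneous h e _

end ExtGrading

/-! ### Base change of the cobar complex -/

section ExtComparison

/-- The `𝕄₂`-algebra `R`, with augmentation `ε`, is the base change of the `𝔽₂`-algebra `R₀`, with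
augmentation `ε₀`, along the inclusion `j`: a basis `b₀` of `R₀` is sent to a basis `b` of `R`. -/
structure IsBaseChange₂ {R₀ R J : Type} [Ring R₀] [Algebra (ZMod 2) R₀] [Ring R] [Algebra M2 R]
    (b₀ : Module.Basis J (ZMod 2) R₀) (b : Module.Basis J M2 R) (ε₀ : R₀ →ₐ[ZMod 2] ZMod 2)
    (ε : R →ₐ[M2] M2) (j : R₀ →+* R) : Prop where
  basis : ∀ i, j (b₀ i) = b i
  smul : ∀ c x, j (c • x) = (Polynomial.C c : M2) • j x
  aug : ∀ x, ε (j x) = Polynomial.C (ε₀ x)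

variable {R₀ R J : Type} [Ring R₀] [Algebra (ZMod 2) R₀] [Ring R] [Algebra M2 R] [Fintype J]
  {b₀ : Module.Basis J (ZMod 2) R₀} {b : Module.Basis J M2 R} {ε₀ : R₀ →ₐ[ZMod 2] ZMod 2}
  {ε : R →ₐ[M2] M2} {j : R₀ →+* R}

theorem IsBaseChange₂.repr (h : IsBaseChange₂ b₀ b ε₀ ε j) (x : R₀) (i : J) :
    b.repr (j x) i = Polynomial.C (b₀.repr x i) := by
  classical
  have hx : j x = ∑ i, (Polynomial.C (b₀.repr x i) : M2) • b i := by
    conv_lhs => rw [← b₀.sum_repr x]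
    rw [map_sum]
    exact Finset.sum_congr rfl fun i _ => by rw [h.smul, h.basis]
  rw [hx]
  exact congrFun (b.repr_sum_self _) i

variable (b₀ b) in
/-- The extension of scalars of a cochain. -/
def extendCochain (n : ℕ) : Cochain (ZMod 2) R₀ n →+ Cochain M2 R n where
  toFun f := Cochain.ofValues b fun σ => Polynomial.C (f fun i => b₀ (σ i))
  map_zero' := Cochain.ext_basis b fun σ => by rw [Cochain.ofValues_basis]; simp
  map_add' f g := Cochain.ext_basis b fun σ => by
    rw [Cochain.add_apply, Cochain.ofValues_basis, Cochain.ofValues_basis,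
      Cochain.ofValues_basis, Cochain.add_apply, map_add]

variable (b₀ b) in
/-- The coefficient of `τ ^ m` in the restriction of a cochain to `R₀`. -/
def coeffCochain (m n : ℕ) : Cochain M2 R n →+ Cochain (ZMod 2) R₀ n where
  toFun f := Cochain.ofValues b₀ fun σ => (f fun i => b (σ i)).coeff m
  map_zero' := Cochain.ext_basis b₀ fun σ => by rw [Cochain.ofValues_basis]; simp
  map_add' f g := Cochain.ext_basis b₀ fun σ => by
    rw [Cochain.add_apply, Cochain.ofValues_basis, Cochain.ofValues_basis,
      Cochain.ofValues_basis, Cochain.add_apply, Polynomial.coeff_add]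

theorem extendCochain_basis {n : ℕ} (f : Cochain (ZMod 2) R₀ n) (σ : Fin n → J) :
    extendCochain b₀ b n f (fun i => b (σ i)) = Polynomial.C (f fun i => b₀ (σ i)) :=
  Cochain.ofValues_basis b _ σ

theorem coeffCochain_basis (m : ℕ) {n : ℕ} (f : Cochain M2 R n) (σ : Fin n → J) :
    coeffCochain b₀ b m n f (fun i => b₀ (σ i)) = (f fun i => b (σ i)).coeff m :=
  Cochain.ofValues_basis b₀ _ σ

theorem extendCochain_apply (h : IsBaseChange₂ b₀ b ε₀ ε j) {n : ℕ} (f : Cochain (ZMod 2) R₀ n)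
    (v : Fin n → R₀) : extendCochain b₀ b n f (fun i => j (v i)) = Polynomial.C (f v) := by
  rw [(extendCochain b₀ b n f).apply_eq_sum b, f.apply_eq_sum b₀, map_sum]
  refine Finset.sum_congr rfl fun σ _ => ?_
  rw [extendCochain_basis, map_mul, map_prod]
  simp only [h.repr]

theorem coeffCochain_apply (h : IsBaseChange₂ b₀ b ε₀ ε j) (m : ℕ) {n : ℕ} (f : Cochain M2 R n)
    (v : Fin n → R₀) : coeffCochain b₀ b m n f v = (f fun i => j (v i)).coeff m := by
  rw [(coeffCochain b₀ b m n f).apply_eq_sum b₀, f.apply_eq_sum b, Polynomial.finsetSum_coeff]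
  refine Finset.sum_congr rfl fun σ _ => ?_
  simp only [h.repr]
  rw [coeffCochain_basis, ← map_prod, Polynomial.coeff_C_mul]

theorem contractNth_map (j : R₀ →+* R) {n : ℕ} (i : Fin n) (v : Fin (n + 1) → R₀) :
    i.castSucc.contractNth (· * ·) (fun a => j (v a)) =
      fun a => j (i.castSucc.contractNth (· * ·) v a) := by
  funext a
  simp only [Fin.contractNth]
  split_ifs
  · rfl
  · rw [map_mul]
  · rfl

theorem cobarδ_extendCochain (h : IsBaseChange₂ b₀ b ε₀ ε j) {n : ℕ}
    (f : Cochain (ZMod 2) R₀ n) :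
    cobarδ ε n (extendCochain b₀ b n f) = extendCochain b₀ b (n + 1) (cobarδ ε₀ n f) := by
  refine Cochain.ext_basis b fun σ => ?_
  rw [extendCochain_basis]
  simp only [← h.basis]
  rw [cobarδ_apply, cobarδ_apply, map_add, map_add, map_sum, map_mul, map_mul]
  simp only [contractNth_map, extendCochain_apply h, h.aug]

theorem cobarδ_coeffCochain (h : IsBaseChange₂ b₀ b ε₀ ε j) (m : ℕ) {n : ℕ}
    (f : Cochain M2 R n) :
    cobarδ ε₀ n (coeffCochain b₀ b m n f) = coeffCochain b₀ b m (n + 1) (cobarδ ε n f) := by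
  refine Cochain.ext_basis b₀ fun σ => ?_
  rw [coeffCochain_basis]
  simp only [← h.basis]
  rw [cobarδ_apply, cobarδ_apply, Polynomial.coeff_add, Polynomial.coeff_add,
    Polynomial.finsetSum_coeff]
  simp only [contractNth_map, coeffCochain_apply h, h.aug, Polynomial.coeff_C_mul,
    Polynomial.coeff_mul_C]

theorem extendCochain_cup {m n : ℕ} (f : Cochain (ZMod 2) R₀ m) (g : Cochain (ZMod 2) R₀ n) :
    extendCochain b₀ b (m + n) (cup f g) =
      cup (extendCochain b₀ b m f) (extendCochain b₀ b n g) := by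
  refine Cochain.ext_basis b fun σ => ?_
  rw [extendCochain_basis, cup_apply, cup_apply, map_mul,
    extendCochain_basis f fun i => σ (Fin.castAdd n i),
    extendCochain_basis g fun i => σ (Fin.natAdd m i)]

theorem coeffCochain_smul_extendCochain (m : ℕ) {n : ℕ} (p : M2) (f : Cochain (ZMod 2) R₀ n) :
    coeffCochain b₀ b m n (p • extendCochain b₀ b n f) = p.coeff m • f := by
  refine Cochain.ext_basis b₀ fun σ => ?_
  rw [coeffCochain_basis, Cochain.smul_apply, extendCochain_basis, Polynomial.coeff_mul_C,
    Cochain.smul_apply]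

/-- Every cochain is a polynomial in `τ` whose coefficients come from `R₀`; the degrees in `τ` are
bounded, because there are finitely many tuples of basis elements. -/
theorem exists_sum_coeffCochain {n : ℕ} (f : Cochain M2 R n) :
    ∃ N : ℕ, f = ∑ m ∈ Finset.range N,
      tau ^ m • extendCochain b₀ b n (coeffCochain b₀ b m n f) := by
  classical
  refine ⟨Finset.univ.sup (fun σ : Fin n → J => (f fun i => b (σ i)).natDegree) + 1,
    Cochain.ext_basis b fun σ => ?_⟩
  rw [Cochain.sum_apply]
  simp only [Cochain.smul_apply, extendCochain_basis, coeffCochain_basis]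
  refine (Polynomial.as_sum_range_C_mul_X_pow' _ (Nat.lt_succ_of_le (Finset.le_sup
    (f := fun σ : Fin n → J => (f fun i => b (σ i)).natDegree) (Finset.mem_univ σ)))).trans ?_
  exact Finset.sum_congr rfl fun m _ => mul_comm _ _

variable (b₀ b) in
/-- The extension of scalars on the group of all cochains. -/
def extendCochainA : CochainAlg (ZMod 2) R₀ →+ CochainAlg M2 R :=
  DirectSum.toAddMonoid fun n => (DirectSum.of (Cochain M2 R) n).comp (extendCochain b₀ b n)

theorem extendCochainA_of {n : ℕ} (f : Cochain (ZMod 2) R₀ n) :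
    extendCochainA b₀ b (DirectSum.of _ n f) = DirectSum.of _ n (extendCochain b₀ b n f) :=
  DirectSum.toAddMonoid_of _ _ _

variable (b₀ b) in
/-- The extension of scalars on the algebra of all cochains. -/
def extendCochainD : CochainAlg (ZMod 2) R₀ →+* CochainAlg M2 R :=
  { extendCochainA b₀ b with
    map_one' := by
      refine (extendCochainA_of _).trans ?_
      refine congrArg (DirectSum.of (Cochain M2 R) 0) (Cochain.ext_basis b fun σ => ?_)
      rw [extendCochain_basis]
      exact map_one _
    map_mul' := fun x y => by
      change extendCochainA b₀ b _ = extendCochainA b₀ b _ * extendCochainA b₀ b _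
      induction x using DirectSum.induction_on with
      | zero => simp only [map_zero, zero_mul]
      | add x x' hx hx' => simp only [add_mul, map_add, hx, hx']
      | of m f =>
        induction y using DirectSum.induction_on with
        | zero => simp only [map_zero, mul_zero]
        | add y y' hy hy' => simp only [mul_add, map_add, hy, hy']
        | of n g =>
          rw [DirectSum.of_mul_of, extendCochainA_of, extendCochainA_of, extendCochainA_of,
            DirectSum.of_mul_of]
          exact congrArg (DirectSum.of (Cochain M2 R) (m + n)) (extendCochain_cup f g) }

theorem extendCochainD_of {n : ℕ} (f : Cochain (ZMod 2) R₀ n) :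
    extendCochainD b₀ b (DirectSum.of _ n f) = DirectSum.of _ n (extendCochain b₀ b n f) :=
  extendCochainA_of f

variable (b₀ b) in
/-- The coefficients of `τ ^ m` on the algebra of all cochains. -/
def coeffCochainD (m : ℕ) : CochainAlg M2 R →+ CochainAlg (ZMod 2) R₀ :=
  DirectSum.toAddMonoid fun n => (DirectSum.of (Cochain (ZMod 2) R₀) n).comp
    (coeffCochain b₀ b m n)

theorem coeffCochainD_of (m : ℕ) {n : ℕ} (f : Cochain M2 R n) :
    coeffCochainD b₀ b m (DirectSum.of _ n f) = DirectSum.of _ n (coeffCochain b₀ b m n f) :=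
  DirectSum.toAddMonoid_of _ _ _

theorem cobarD_extendCochainD (h : IsBaseChange₂ b₀ b ε₀ ε j) (x : CochainAlg (ZMod 2) R₀) :
    cobarD ε (extendCochainD b₀ b x) = extendCochainD b₀ b (cobarD ε₀ x) := by
  induction x using DirectSum.induction_on with
  | zero => simp only [map_zero]
  | add x y hx hy => simp only [map_add, hx, hy]
  | of n f =>
    rw [extendCochainD_of, cobarD_of, cobarD_of, extendCochainD_of, cobarδ_extendCochain h]

theorem cobarD_coeffCochainD (h : IsBaseChange₂ b₀ b ε₀ ε j) (m : ℕ) (x : CochainAlg M2 R) :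
    cobarD ε₀ (coeffCochainD b₀ b m x) = coeffCochainD b₀ b m (cobarD ε x) := by
  induction x using DirectSum.induction_on with
  | zero => simp only [map_zero]
  | add x y hx hy => simp only [map_add, hx, hy]
  | of n f =>
    rw [coeffCochainD_of, cobarD_of, cobarD_of, coeffCochainD_of, cobarδ_coeffCochain h]

theorem coeffCochainD_smul_extendCochainD (m : ℕ) (p : M2) (x : CochainAlg (ZMod 2) R₀) :
    coeffCochainD b₀ b m (p • extendCochainD b₀ b x) = p.coeff m • x := by
  induction x using DirectSum.induction_on with
  | zero => simp only [map_zero, smul_zero]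
  | add x y hx hy => simp only [map_add, smul_add, hx, hy]
  | of n f =>
    rw [extendCochainD_of, ← DirectSum.lof_eq_of M2, ← map_smul, DirectSum.lof_eq_of,
      coeffCochainD_of, coeffCochain_smul_extendCochain, ← DirectSum.lof_eq_of (ZMod 2),
      map_smul, DirectSum.lof_eq_of]

theorem extendCochainD_mem (h : IsBaseChange₂ b₀ b ε₀ ε j) {x : CochainAlg (ZMod 2) R₀}
    (hx : x ∈ cocycles ε₀) : extendCochainD b₀ b x ∈ cocycles ε := by
  change cobarD ε _ = 0
  rw [cobarD_extendCochainD h, show cobarD ε₀ x = 0 from hx, map_zero]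

theorem coeffCochainD_mem (h : IsBaseChange₂ b₀ b ε₀ ε j) (m : ℕ) {x : CochainAlg M2 R}
    (hx : x ∈ cocycles ε) : coeffCochainD b₀ b m x ∈ cocycles ε₀ := by
  change cobarD ε₀ _ = 0
  rw [cobarD_coeffCochainD h, show cobarD ε x = 0 from hx, map_zero]

theorem of_coeffCochain_mem (h : IsBaseChange₂ b₀ b ε₀ ε j) (m : ℕ) {n : ℕ} {f : Cochain M2 R n}
    (hf : DirectSum.of _ n f ∈ cocycles ε) :
    DirectSum.of _ n (coeffCochain b₀ b m n f) ∈ cocycles ε₀ := by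
  rw [← coeffCochainD_of]
  exact coeffCochainD_mem h m hf

/-- The coefficients of a cocycle are cocycles, since the differential is linear over `𝔽₂[τ]`. -/
theorem exists_sum_extMk (h : IsBaseChange₂ b₀ b ε₀ ε j) {n : ℕ} {f : Cochain M2 R n}
    (hf : DirectSum.of _ n f ∈ cocycles ε) :
    ∃ N : ℕ, extMk ε ⟨_, hf⟩ = ∑ m ∈ Finset.range N,
      tau ^ m • extMk ε ⟨_, extendCochainD_mem h (of_coeffCochain_mem h m hf)⟩ := by
  obtain ⟨N, hN⟩ := exists_sum_coeffCochain (b₀ := b₀) (b := b) f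
  refine ⟨N, ?_⟩
  simp only [← map_smul]
  rw [← map_sum]
  refine congrArg _ (Subtype.ext ?_)
  push_cast
  conv_lhs => rw [hN, map_sum]
  refine Finset.sum_congr rfl fun m _ => ?_
  rw [extendCochainD_of, ← DirectSum.lof_eq_of M2, map_smul]
  rfl

theorem exists_extRingHom (h : IsBaseChange₂ b₀ b ε₀ ε j) :
    ∃ G : ExtAlg ε₀ →+* ExtAlg ε, ∀ z : cocycles ε₀,
      G (extMk ε₀ z) = extMk ε ⟨_, extendCochainD_mem h z.2⟩ := by
  obtain ⟨G, hG⟩ := exists_extMap (ε := ε₀) (ε' := ε)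
    (extendCochainD b₀ b : CochainAlg (ZMod 2) R₀ →+ CochainAlg M2 R)
    (fun x hx => extendCochainD_mem h hx) fun c => ⟨_, cobarD_extendCochainD h c⟩
  refine ⟨{ G with
    map_one' := ?_
    map_mul' := fun x y => ?_ }, hG⟩
  · refine (hG 1).trans ((congrArg _ (Subtype.ext ?_)).trans (map_one (extMk ε)))
    exact map_one (extendCochainD b₀ b)
  · obtain ⟨x, rfl⟩ := extMk_surjective x
    obtain ⟨y, rfl⟩ := extMk_surjective y
    change G _ = G _ * G _
    rw [← map_mul, hG, hG, hG, ← map_mul]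
    exact congrArg _ (Subtype.ext (map_mul (extendCochainD b₀ b) _ _))

theorem exists_extAlgHom (h : IsBaseChange₂ b₀ b ε₀ ε j) :
    ∃ Φ : M2 ⊗[ZMod 2] ExtAlg ε₀ →ₐ[M2] ExtAlg ε, ∀ (p : M2) (z : cocycles ε₀),
      Φ (p ⊗ₜ extMk ε₀ z) = p • extMk ε ⟨_, extendCochainD_mem h z.2⟩ := by
  obtain ⟨G, hG⟩ := exists_extRingHom h
  let : Algebra (ZMod 2) (ExtAlg ε) :=
    Algebra.compHom (ExtAlg ε) (Polynomial.C : ZMod 2 →+* M2)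
  have : IsScalarTower (ZMod 2) M2 (ExtAlg ε) := IsScalarTower.of_algebraMap_eq fun _ => rfl
  let Ga : ExtAlg ε₀ →ₐ[ZMod 2] ExtAlg ε :=
    { G with
      commutes' := fun c => RingHom.congr_fun (Subsingleton.elim
        (G.comp (algebraMap (ZMod 2) (ExtAlg ε₀))) (algebraMap (ZMod 2) (ExtAlg ε))) c }
  refine ⟨Algebra.TensorProduct.lift (Algebra.ofId M2 (ExtAlg ε)) Ga
    fun p x => Algebra.commutes p _, fun p z => ?_⟩
  refine (Algebra.TensorProduct.lift_tmul _ _ _ _ _).trans ?_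
  rw [Algebra.ofId_apply, ← Algebra.smul_def]
  exact congrArg _ (hG z)

/-- `Ext` commutes with the base change from `𝔽₂` to `𝕄₂`: every cochain is uniquely a polynomial
in `τ` with coefficients in the cochains over `𝔽₂`, and the differential and the product are
linear over `𝔽₂[τ]`. -/
theorem exists_extEquiv (h : IsBaseChange₂ b₀ b ε₀ ε j) :
    ∃ Φ : M2 ⊗[ZMod 2] ExtAlg ε₀ ≃ₐ[M2] ExtAlg ε, ∀ (p : M2) (z : cocycles ε₀),
      Φ (p ⊗ₜ extMk ε₀ z) = p • extMk ε ⟨_, extendCochainD_mem h z.2⟩ := by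
  obtain ⟨Φ, hΦ⟩ := exists_extAlgHom h
  choose K hK using fun m => exists_extMap (ε := ε) (ε' := ε₀) (coeffCochainD b₀ b m)
    (fun x hx => coeffCochainD_mem h m hx) fun c => ⟨_, cobarD_coeffCochainD h m c⟩
  have hcoef (m : ℕ) (z : M2 ⊗[ZMod 2] ExtAlg ε₀) :
      TensorProduct.equivFinsuppOfBasisLeft (Polynomial.basisMonomials (ZMod 2)) z m =
        K m (Φ z) := by
    induction z using TensorProduct.induction_on with
    | zero => simp
    | add x y hx hy => rw [map_add, map_add, map_add, Finsupp.add_apply, hx, hy]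
    | tmul p x =>
      obtain ⟨z, rfl⟩ := extMk_surjective x
      rw [TensorProduct.equivFinsuppOfBasisLeft_apply_tmul_apply, hΦ, ← map_smul, ← map_smul, hK]
      refine congrArg _ (Subtype.ext ?_)
      exact (coeffCochainD_smul_extendCochainD m p (z : CochainAlg (ZMod 2) R₀)).symm
  have hinj : Function.Injective Φ := by
    refine (injective_iff_map_eq_zero Φ).2 fun z hz => ?_
    refine (TensorProduct.equivFinsuppOfBasisLeft (Polynomial.basisMonomials (ZMod 2))).injective ?_
    rw [map_zero]
    ext m
    rw [hcoef, hz, map_zero]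
    rfl
  have hof (n : ℕ) (f : Cochain M2 R n) (hf : DirectSum.of _ n f ∈ cocycles ε) :
      extMk ε ⟨_, hf⟩ ∈ Φ.range := by
    obtain ⟨N, hN⟩ := exists_sum_extMk h hf
    rw [hN]
    exact sum_mem fun m _ => Φ.mem_range.2
      ⟨(tau ^ m) ⊗ₜ extMk ε₀ ⟨_, of_coeffCochain_mem h m hf⟩, hΦ _ _⟩
  have hsurj : Function.Surjective Φ := by
    intro x
    obtain ⟨z, rfl⟩ := extMk_surjective x
    rw [← AlgHom.coe_toRingHom, ← RingHom.mem_range]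
    classical
    have hsum : z = ∑ n ∈ DFinsupp.support (z : CochainAlg M2 R),
        (⟨_, of_mem_cocycles (cobarδ_eq_zero z.2 n)⟩ : cocycles ε) := by
      refine Subtype.ext ?_
      push_cast
      exact (DirectSum.sum_support_of (z : CochainAlg M2 R)).symm
    rw [hsum, map_sum]
    exact sum_mem fun n _ => hof n _ _
  exact ⟨AlgEquiv.ofBijective Φ ⟨hinj, hsurj⟩, hΦ⟩

end ExtComparison

/-! ### The comparison of the `Ext` algebras -/

section Main

theorem grIncl_isBaseChange : IsBaseChange₂ classicalBasis motivicBasis (GrA2aug (ZMod 2) 1)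
    (GrA2aug M2 tau) grIncl where
  basis := grIncl_basis
  smul := grIncl_smul
  aug := grIncl_aug

theorem coeff_eq_zero_of_mem {ι : Type} [AddCommMonoid ι] {u d : ι} {m : ℕ} (hd : d ≠ m • u)
    {p : M2} (hp : p ∈ M2Grading u d) : p.coeff m = 0 := by
  induction hp using AddSubgroup.closure_induction with
  | mem p hp =>
    obtain ⟨j, rfl, rfl⟩ := hp
    rw [Polynomial.coeff_X_pow, if_neg]
    rintro rfl
    exact hd rfl
  | zero => exact Polynomial.coeff_zero m
  | add p q _ _ hp hq => rw [Polynomial.coeff_add, hp, hq, add_zero]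
  | neg p _ hp => rw [Polynomial.coeff_neg, hp, neg_zero]

/-- Multiplication by `τ ^ m` raises the values by `m` in weight, hence it lowers the internal
degree, by which homomorphisms lower degrees, by `m`. -/
theorem smul_extendCochain_isHomogeneous {n : ℕ} {f : Cochain (ZMod 2) (GrA2 (ZMod 2) 1) n}
    {e : ℤ × ℤ × ℤ} (hf : f.IsHomogeneous classicalGrading F2Grading e) (m : ℕ) :
    (tau ^ m • extendCochain classicalBasis motivicBasis n f).IsHomogeneous motivicGrading
      (M2Grading (0, 0, 1)) (e - m • (0, 0, 1)) := by
  rw [isHomogeneous_iff motivicGrading_basis]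
  intro σ
  have h := (isHomogeneous_iff classicalGrading_basis f e).1 hf σ
  rw [Cochain.smul_apply, extendCochain_basis]
  by_cases hd : ∑ i, mayDeg genDeg (σ i) - e = 0
  · rw [← sub_add, hd, zero_add]
    generalize f (fun i => classicalBasis (σ i)) = c
    obtain rfl | rfl : c = 0 ∨ c = 1 := by revert c; decide
    · rw [map_zero, mul_zero]; exact zero_mem _
    · rw [map_one, mul_one]; exact AddSubgroup.subset_closure ⟨m, rfl, rfl⟩
  · rw [F2Grading_of_ne hd, AddSubgroup.mem_bot] at h
    rw [h, map_zero, mul_zero]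
    exact zero_mem _

theorem coeffCochain_isHomogeneous {n : ℕ} {f : Cochain M2 (GrA2 M2 tau) n}
    {e : ℤ × ℤ × ℤ} (hf : f.IsHomogeneous motivicGrading (M2Grading (0, 0, 1)) e) (m : ℕ) :
    (coeffCochain classicalBasis motivicBasis m n f).IsHomogeneous classicalGrading
      F2Grading (e + m • (0, 0, 1)) := by
  rw [isHomogeneous_iff classicalGrading_basis]
  intro σ
  have h := (isHomogeneous_iff motivicGrading_basis f e).1 hf σ
  rw [coeffCochain_basis]
  by_cases hd : ∑ i, mayDeg genDeg (σ i) - e = m • (0, 0, 1)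
  · rw [← sub_sub, hd, sub_self]
    exact mem_F2Grading_zero _
  · rw [coeff_eq_zero_of_mem hd h]
    exact zero_mem _

theorem mainTheorem5 :
    -- the trigraded algebras
    (Nonempty (GradedRing motivicGrading) ∧ Nonempty (GradedRing classicalGrading) ∧
      ∃ e : GrA2 M2 tau ≃ₐ[M2] M2 ⊗[ZMod 2] GrA2 (ZMod 2) 1,
        ∀ d x, e x ∈ tensorGrading (M2Grading (0, 0, 1)) classicalGrading d ↔
          x ∈ motivicGrading d) ∧
    -- the quadruply graded `Ext` rings; `τ` has weight `-1` in `Ext`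
    (Nonempty (GradedRing motivicExtGrading) ∧ Nonempty (GradedRing classicalExtGrading) ∧
      ∃ e : ExtGrA2 M2 tau ≃ₐ[M2] M2 ⊗[ZMod 2] ExtGrA2 (ZMod 2) 1,
        ∀ d x, e x ∈ tensorGrading (M2Grading (0, 0, 0, -1)) classicalExtGrading d ↔
          x ∈ motivicExtGrading d) := by
  refine ⟨⟨nonempty_gradedRing_motivic, nonempty_gradedRing_classical, grEquiv,
    grEquiv_grading⟩, nonempty_gradedRing_ext motivicGrading_basis motivicBasis_mul_mem
      GrA2aug_motivic_mem, nonempty_gradedRing_ext classicalGrading_basis classicalBasis_mul_mem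
      GrA2aug_classical_mem, ?_⟩
  obtain ⟨Φ, hΦ⟩ := exists_extEquiv grIncl_isBaseChange
  refine ⟨Φ.symm, fun d x => ⟨fun hx => ?_, fun hx => ?_⟩⟩
  · rw [← Φ.apply_symm_apply x]
    generalize Φ.symm x = z at hx
    induction hx using AddSubgroup.closure_induction with
    | mem z hz =>
      obtain ⟨p, ⟨m, s, a, w⟩, rfl, c, hc, y, hy, rfl⟩ := hz
      induction hc using AddSubgroup.closure_induction with
      | mem c hc =>
        obtain ⟨j, rfl, rfl⟩ := hc
        induction hy using AddSubgroup.closure_induction with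
        | mem y hy =>
          obtain ⟨f, hf, hfh, rfl⟩ := hy
          rw [hΦ, ← map_smul]
          have hsm : DirectSum.of _ a (tau ^ j • extendCochain classicalBasis motivicBasis a f) =
              tau ^ j • extendCochainD classicalBasis motivicBasis (DirectSum.of _ a f) := by
            rw [← DirectSum.lof_eq_of M2, map_smul, DirectSum.lof_eq_of, ← extendCochainD_of]
          have hf' : DirectSum.of _ a (tau ^ j • extendCochain classicalBasis motivicBasis a f) ∈
              cocycles (GrA2aug M2 tau) :=
            hsm ▸ Subalgebra.smul_mem _ (extendCochainD_mem grIncl_isBaseChange hf) _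
          -- the stem is the topological degree minus `a`, which `τ` does not change
          have he : (j • (0, 0, 0, -1) + (m, s, a, w) : ℤ × ℤ × ℕ × ℤ) = (m, s, a, w - j) := by
            ext <;> simp [sub_eq_neg_add]
          rw [he]
          refine AddSubgroup.subset_closure ⟨_, hf', ?_, congrArg _ (Subtype.ext hsm.symm)⟩
          have := smul_extendCochain_isHomogeneous hfh j
          have he' : ((m, s + a, w) - j • (0, 0, 1) : ℤ × ℤ × ℤ) = (m, s + a, w - j) := by
            ext <;> simp
          rwa [he'] at this
        | zero => rw [TensorProduct.tmul_zero, map_zero]; exact zero_mem _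
        | add x y _ _ hx hy => rw [TensorProduct.tmul_add, map_add]; exact add_mem hx hy
        | neg x _ hx => rw [TensorProduct.tmul_neg, map_neg]; exact neg_mem hx
      | zero => rw [TensorProduct.zero_tmul, map_zero]; exact zero_mem _
      | add x y _ _ hx hy => rw [TensorProduct.add_tmul, map_add]; exact add_mem hx hy
      | neg x _ hx => rw [TensorProduct.neg_tmul, map_neg]; exact neg_mem hx
    | zero => rw [map_zero]; exact zero_mem _
    | add x y _ _ hx hy => rw [map_add]; exact add_mem hx hy
    | neg x _ hx => rw [map_neg]; exact neg_mem hx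
  · obtain ⟨m, s, a, w⟩ := d
    induction hx using AddSubgroup.closure_induction with
    | mem x hx =>
      obtain ⟨f, hf, hfh, rfl⟩ := hx
      obtain ⟨N, hN⟩ := exists_sum_extMk grIncl_isBaseChange hf
      rw [hN, map_sum]
      refine sum_mem fun i _ => ?_
      have hfi := of_coeffCochain_mem grIncl_isBaseChange i hf
      rw [← hΦ (tau ^ i) ⟨_, hfi⟩, AlgEquiv.symm_apply_apply]
      refine AddSubgroup.subset_closure ⟨i • (0, 0, 0, -1), (m, s, a, w + i), ?_, _,
        AddSubgroup.subset_closure ⟨i, rfl, rfl⟩, _,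
        AddSubgroup.subset_closure ⟨_, hfi, ?_, rfl⟩, rfl⟩
      · ext <;> simp
      · have := coeffCochain_isHomogeneous hfh i
        have he' : ((m, s + a, w) + i • (0, 0, 1) : ℤ × ℤ × ℤ) = (m, s + a, w + i) := by
          ext <;> simp
        rwa [he'] at this
    | zero => rw [map_zero]; exact zero_mem _
    | add x y _ _ hx hy => rw [map_add]; exact add_mem hx hy
    | neg x _ hx => rw [map_neg]; exact neg_mem hx

end Main

end
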